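/- All $C^*$-algebras are complex and need not be unital. For $C^*$-algebras $A,B$ let $\|\cdot\|_{\min}$ and $\|\cdot\|_{\max}$ denote the minimal (spatial) and the maximal $C^*$-norm on the algebraic tensor product $A\otimes B$; the pair $(A,B)$ is called nuclear if the two norms coincide on $A\otimes B$. A $C^*$-algebra $C$ has the LLP if the pair $(C,B(\ell_2))$ is nuclear. For $\varepsilon>0$ and a self-adjoint subspace $\mathcal E$ of a $C^*$-algebra $B$, a linear map $\psi:\mathcal E\to C$ into a $C^*$-algebra is an $\varepsilon$-morphism if $\|\psi\|\le 1+\varepsilon$, $\psi(x^*)=\psi(x)^*$ for all $x\in\mathcal E$, and $\|\psi(xy)-\psi(x)\psi(y)\|\le\varepsilon\|x\|\|y\|$ whenever $x,y,xy\in\mathcal E$. A surjective $*$-homomorphism $q:C\to B$ almost allows liftings if for every $\varepsilon>0$ and every finite dimensional self-adjoint subspace $\mathcal E\subset B$ there is an $\varepsilon$-morphism $\psi:\mathcal E\to C$ with $\|q\psi(x)-x\|\le\varepsilon\|x\|$ for all $x\in\mathcal E$. For operator spaces $E,F$ let $d_{cb}(E,F)=\inf\{\|u\|_{cb}\|u^{-1}\|_{cb}\}$,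 the infimum over all complete isomorphisms $u:E\to F$. A $C^*$-algebra $A$ locally embeds in $C$ if for every $\varepsilon>0$ and every finite dimensional subspace $Z\subset A$ there is a finite dimensional subspace $Z'\subset C$ with $d_{cb}(Z,Z')\le 1+\varepsilon$; $A$ and $C$ are locally equivalent if each locally embeds in the other. **Corollary.** Let $C$ be a separable $C^*$-algebra with the LLP, let $B$ be a $C^*$-algebra, let $i:C\to B$ be an injective $*$-homomorphism and let $q:C\to B$ be a surjective $*$-homomorphism that almost allows liftings. Let $D$ be a separable $C^*$-algebra such that $i\otimes \mathrm{Id}_D: C\otimes_{\min}D\to B\otimes_{\max}D$ is continuous (that is, bounded from the min-norm on $C\otimes D$ to the max-norm on $B\otimes D$). Then $i\otimes \mathrm{Id}_D$ is isometric for these norms, and there is a separable $C^*$-algebra $A$ such that $(A,D)$ is a nuclear pair and $A$ and $C$ are locally equivalent. -/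

import Mathlib

open scoped TensorProduct ENNReal NNReal

universe u v w

/-! ### The minimal and the maximal C⋆-norm on the algebraic tensor product

C⋆-algebras are complex and not assumed unital; `A ⊗[ℂ] B` is the algebraic tensor product with its
usual structure of a ⋆-algebra. The norms take values in `ℝ≥0∞`, so that all suprema make sense. -/

section MinNorm

lemma clm_tensor_ext {H K : Type*} [NormedAddCommGroup H] [InnerProductSpace ℂ H]
    [NormedAddCommGroup K] [InnerProductSpace ℂ K] {S T : (H ⊗[ℂ] K) →L[ℂ] (H ⊗[ℂ] K)}
    (hST : ∀ h k, S (h ⊗ₜ[ℂ] k) = T (h ⊗ₜ[ℂ] k)) : S = T := by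
  ext x
  induction x using TensorProduct.induction_on with
  | zero => rw [S.map_zero, T.map_zero]
  | tmul h k => exact hST h k
  | add x y hx hy => rw [S.map_add, T.map_add, hx, hy]

variable {A B H K : Type*} [NonUnitalCStarAlgebra A] [NonUnitalCStarAlgebra B]
  [NormedAddCommGroup H] [InnerProductSpace ℂ H] [CompleteSpace H]
  [NormedAddCommGroup K] [InnerProductSpace ℂ K] [CompleteSpace K]

/-- The tensor product `π ⊗ σ` of two Hilbert space representations, `a ⊗ b ↦ π a ⊗ σ b`.
The operators act on the algebraic tensor product `H ⊗ K` with its inner product, a dense subspace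
of the Hilbert space tensor product, so that operator norms are the usual ones. -/
noncomputable def tensorRep (π : A →⋆ₙₐ[ℂ] (H →L[ℂ] H)) (σ : B →⋆ₙₐ[ℂ] (K →L[ℂ] K)) :
    A ⊗[ℂ] B →ₗ[ℂ] ((H ⊗[ℂ] K) →L[ℂ] (H ⊗[ℂ] K)) :=
  TensorProduct.lift <| LinearMap.mk₂ ℂ (fun a b => TensorProduct.mapL (π a) (σ b))
    (fun a a' b => clm_tensor_ext fun h k => by simp [TensorProduct.add_tmul])
    (fun c a b => clm_tensor_ext fun h k => by simp [TensorProduct.smul_tmul'])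
    (fun a b b' => clm_tensor_ext fun h k => by simp [TensorProduct.tmul_add])
    (fun c a b => clm_tensor_ext fun h k => by simp)

@[simp] lemma tensorRep_tmul_apply_tmul (π : A →⋆ₙₐ[ℂ] (H →L[ℂ] H)) (σ : B →⋆ₙₐ[ℂ] (K →L[ℂ] K))
    (a : A) (b : B) (h : H) (k : K) :
    tensorRep π σ (a ⊗ₜ[ℂ] b) (h ⊗ₜ[ℂ] k) = π a h ⊗ₜ[ℂ] σ b k := by
  simp [tensorRep]

end MinNorm

/-- The minimal (spatial) norm on `A ⊗ B`: the supremum of `‖(π ⊗ σ)(t)‖` over all representations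
`π` of `A` and `σ` of `B` on Hilbert spaces. (The universal representation of a C⋆-algebra lives in
the universe of the algebra, so the Hilbert spaces in these universes suffice.) -/
noncomputable def minNorm {A : Type u} {B : Type v} [NonUnitalCStarAlgebra A]
    [NonUnitalCStarAlgebra B] (t : A ⊗[ℂ] B) : ℝ≥0∞ :=
  ⨆ (H : Type u) (_ : NormedAddCommGroup H) (_ : InnerProductSpace ℂ H) (_ : CompleteSpace H)
    (K : Type v) (_ : NormedAddCommGroup K) (_ : InnerProductSpace ℂ K) (_ : CompleteSpace K)
    (π : A →⋆ₙₐ[ℂ] (H →L[ℂ] H)) (σ : B →⋆ₙₐ[ℂ] (K →L[ℂ] K)), ‖tensorRep π σ t‖ₑ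

/-- `p` is a C⋆-seminorm on the ⋆-algebra `A ⊗ B`. -/
structure IsCStarSeminorm {A B : Type*} [NonUnitalCStarAlgebra A] [NonUnitalCStarAlgebra B]
    (p : Seminorm ℂ (A ⊗[ℂ] B)) : Prop where
  mul_le : ∀ s t, p (s * t) ≤ p s * p t
  star_mul_self : ∀ t, p (star t * t) = p t ^ 2

/-- The maximal C⋆-norm on `A ⊗ B`: the supremum of all C⋆-seminorms. -/
noncomputable def maxNorm {A B : Type*} [NonUnitalCStarAlgebra A] [NonUnitalCStarAlgebra B]
    (t : A ⊗[ℂ] B) : ℝ≥0∞ :=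
  ⨆ (p : Seminorm ℂ (A ⊗[ℂ] B)) (_ : IsCStarSeminorm p), ENNReal.ofReal (p t)

/-- `(A, B)` is a nuclear pair: the minimal and the maximal norm coincide on `A ⊗ B`. -/
def IsNuclearPair (A B : Type*) [NonUnitalCStarAlgebra A] [NonUnitalCStarAlgebra B] : Prop :=
  ∀ t : A ⊗[ℂ] B, minNorm t = maxNorm t

/-- The local lifting property: `(A, B(ℓ₂))` is a nuclear pair. -/
def HasLLP (A : Type*) [NonUnitalCStarAlgebra A] : Prop :=
  IsNuclearPair A (lp (fun _ : ℕ => ℂ) 2 →L[ℂ] lp (fun _ : ℕ => ℂ) 2)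

/-- The linear map `i ⊗ Id_D` on the algebraic tensor product `C ⊗ D`. -/
noncomputable def tensorId {C B : Type*} [NonUnitalCStarAlgebra C] [NonUnitalCStarAlgebra B]
    (i : C →⋆ₙₐ[ℂ] B) (D : Type*) [NonUnitalCStarAlgebra D] : C ⊗[ℂ] D →ₗ[ℂ] B ⊗[ℂ] D :=
  TensorProduct.map (i : C →ₗ[ℂ] B) LinearMap.id

/-- `i ⊗ Id_D : C ⊗_min D → B ⊗_max D` is continuous, that is, bounded for the minimal norm on
`C ⊗ D` and the maximal norm on `B ⊗ D`. -/
def IsMinMaxContinuous {C B : Type*} [NonUnitalCStarAlgebra C] [NonUnitalCStarAlgebra B]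
    (i : C →⋆ₙₐ[ℂ] B) (D : Type*) [NonUnitalCStarAlgebra D] : Prop :=
  ∃ c : ℝ≥0, ∀ t : C ⊗[ℂ] D, maxNorm (tensorId i D t) ≤ c * minNorm t

/-! ### Approximately multiplicative liftings -/

/-- `ψ : E → C` is an `ε`-morphism, for a self-adjoint subspace `E` of `B`: it has norm at most
`1 + ε`, is multiplicative up to `ε` as far as products stay in `E`, and is self-adjoint. -/
structure IsEpsMorphism {B C : Type*} [NonUnitalCStarAlgebra B] [NonUnitalCStarAlgebra C]
    (ε : ℝ) (E : Submodule ℂ B) (ψ : E →ₗ[ℂ] C) : Prop where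
  norm_le : ∀ x : E, ‖ψ x‖ ≤ (1 + ε) * ‖x‖
  mul_approx : ∀ (x y : E) (hxy : (x : B) * (y : B) ∈ E),
    ‖ψ ⟨(x : B) * (y : B), hxy⟩ - ψ x * ψ y‖ ≤ ε * ‖x‖ * ‖y‖
  map_star : ∀ (x : E) (hx : star (x : B) ∈ E), ψ ⟨star (x : B), hx⟩ = star (ψ x)

/-- The (surjective) ⋆-homomorphism `q : C → B` almost allows liftings. -/
def AlmostAllowsLiftings {C B : Type*} [NonUnitalCStarAlgebra C] [NonUnitalCStarAlgebra B]
    (q : C →⋆ₙₐ[ℂ] B) : Prop :=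
  ∀ ε : ℝ, 0 < ε → ∀ E : Submodule ℂ B, FiniteDimensional ℂ E → (∀ x ∈ E, star x ∈ E) →
    ∃ ψ : E →ₗ[ℂ] C, IsEpsMorphism ε E ψ ∧ ∀ x : E, ‖q (ψ x) - (x : B)‖ ≤ ε * ‖x‖

/-! ### Completely bounded maps between operator subspaces and local equivalence -/

/-- The C⋆-norm of `M_n(A)`. The order on `A` is only used by Mathlib to set up this norm. -/
noncomputable def matrixNorm {A : Type*} [NonUnitalCStarAlgebra A] (n : ℕ)
    (x : Matrix (Fin n) (Fin n) A) : ℝ :=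
  letI : PartialOrder A := CStarAlgebra.spectralOrder A
  haveI : StarOrderedRing A := CStarAlgebra.spectralOrderedRing A
  ‖CStarMatrix.ofMatrix x‖

/-- The completely bounded norm of a linear map `u : E → F`, where `E ⊆ A` and `F ⊆ C` carry the
operator space structures inherited from the C⋆-algebras `A` and `C`: the supremum over `n` of the
norms of `Id ⊗ u : M_n(E) → M_n(F)`. -/
noncomputable def cbNorm {A C : Type*} [NonUnitalCStarAlgebra A] [NonUnitalCStarAlgebra C]
    {E : Submodule ℂ A} {F : Submodule ℂ C} (u : E →ₗ[ℂ] F) : ℝ≥0∞ :=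
  ⨆ (n : ℕ) (x : Matrix (Fin n) (Fin n) E) (_ : matrixNorm n (x.map fun e => (e : A)) ≤ 1),
    ENNReal.ofReal (matrixNorm n (x.map fun e => (u e : C)))

/-- The distance `d_cb(E, F) = inf ‖u‖_cb ‖u⁻¹‖_cb`; it is `∞` if `E` and `F` are not completely
isomorphic. -/
noncomputable def dcb {A C : Type*} [NonUnitalCStarAlgebra A] [NonUnitalCStarAlgebra C]
    (E : Submodule ℂ A) (F : Submodule ℂ C) : ℝ≥0∞ :=
  ⨅ u : E ≃ₗ[ℂ] F, cbNorm (u : E →ₗ[ℂ] F) * cbNorm (u.symm : F →ₗ[ℂ] E)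

/-- `A` locally embeds in `C`. -/
def LocallyEmbeds (A C : Type*) [NonUnitalCStarAlgebra A] [NonUnitalCStarAlgebra C] : Prop :=
  ∀ ε : ℝ, 0 < ε → ∀ Z : Submodule ℂ A, FiniteDimensional ℂ Z →
    ∃ Z' : Submodule ℂ C, FiniteDimensional ℂ Z' ∧ dcb Z Z' ≤ ENNReal.ofReal (1 + ε)

/-- `A` and `C` are locally equivalent. -/
def LocallyEquivalent (A C : Type*) [NonUnitalCStarAlgebra A] [NonUnitalCStarAlgebra C] : Prop :=
  LocallyEmbeds A C ∧ LocallyEmbeds C A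

/-!
# A nuclear companion of an algebra with the local lifting property

**The norm identity.** The composition of `i ⊗ Id_D` with the maximal norm and the minimal norm on
`C ⊗ D` both satisfy the C⋆-identity. If one of two such functions is at most a constant times the
other, the constant may be taken to be one (apply the inequality to `(t⋆ t)^(2^n)` and take roots;
`le_of_le_const_mul_of_star_mul_self`), so continuity of `i ⊗ Id_D` makes it contractive. It is
also bounded below, since the minimal tensor product is injective (`minSeminorm_le_tensorId`) and
the maximal norm dominates the minimal one.

**The algebra `A`.** Choose approximate liftings `Ψ m : B → C` of `q` that are better and better
almost morphisms on larger and larger finite-dimensional spaces `F m ⊆ B`, and finite-dimensional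
self-adjoint spaces `E m` exhausting `C`, with `F m` containing `i (E m)` and its products and
`Ψ m (F m) ⊆ E (m + 1)` (`LiftingTower`, `exists_liftingTower`). The maps `Ψ m ∘ i` form an
inductive system `E 0 → E 1 → ⋯`. Sending an element to its orbit gives maps `Θ m` from `E m` to an
ultrapower of `C` (`exists_ultrapower`), and `A` is the closure of the union of the spaces
`Θ m (E m)`. It is closed under products as `Θ m = κ ∘ i` on `E m`, where `κ = Θ (m + 1) ∘ Ψ m` is
an almost morphism on `F m` (`LiftingTower.IsLimit.almostMorphismOn`), hence almost multiplicative
on `i (E m)` (`LiftingTower.IsLimit.exists_separable`).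

The factorization of `Θ m` through the almost morphism `κ` on `B` yields all estimates.

* *Upper bounds on matrices.* By the local lifting property, good almost morphisms on `C` are
  almost completely contractive on a given finite-dimensional space
  (`HasLLP.exists_matrixNorm_map_le`). To see this, place a dense sequence of matrices over the
  space on the diagonal of one tensor `t ∈ C ⊗ B(ℓ₂)` of minimal norm one; its maximal norm is one
  as well, and an almost morphism does not increase the maximal norm of `t` by much, because the
  limit of maximal norms along an asymptotic morphism is a C⋆-seminorm
  (`exists_almostMorphism_maxSeminorm_le`). The blocks are recovered by compression.
* *Lower bounds on matrices.* `q` is completely contractive and `q ∘ Ψ m ∘ i` is close to the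
  complete isometry `i` on `E m` (`LiftingTower.matrixNorm_le_iter`). Together with the upper bounds
  this makes `Θ m` almost completely isometric on `E m`, so `A` and `C` are locally equivalent
  (`locallyEquivalent_of_dense`).
* *Nuclearity of `(A, D)`.* A tensor in `A ⊗ D` is nearly `∑ Θ m (x j) ⊗ d j = ∑ κ (i (x j)) ⊗ d j`,
  whose maximal norm is nearly at most the maximal norm of `∑ i (x j) ⊗ d j` in `B ⊗ D`. This is at
  most the minimal norm of `∑ x j ⊗ d j` in `C ⊗ D`, by the first part, and that one is nearly at
  most the minimal norm of `∑ Θ m (x j) ⊗ d j` by the lower bounds (`isNuclearPair_of_approx`). The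
  approximation has to be uniform in the `x j`, for which see
  `exists_almostMorphism_maxSeminorm_sum_le`.

The supporting facts are the Gelfand–Naimark theorem (`exists_faithful_representation`) and
descriptions of the norm of matrices over a C⋆-algebra (`norm_amplify_eq`) and of the minimal norm
(`norm_tensorRep_le_of_compress`) through representations and finite compressions.
-/

/-! ### C⋆-seminorms on tensor products -/

section PowerTrick

/-- Two functions with the C⋆-identity on a ⋆-semigroup that satisfy `p ≤ K p'` satisfy `p ≤ p'`:
apply the inequality to `x, x⋆x, (x⋆x)⋆(x⋆x), …` and take roots. -/
lemma le_of_le_const_mul_of_star_mul_self {R : Type*} [Mul R] [Star R] {p p' : R → ℝ}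
    (hp0' : ∀ x, 0 ≤ p' x)
    (hp : ∀ x, p (star x * x) = p x ^ 2) (hp' : ∀ x, p' (star x * x) = p' x ^ 2)
    {K : ℝ} (h : ∀ x, p x ≤ K * p' x) (x : R) : p x ≤ p' x := by
  have key : ∀ (n : ℕ) (x : R), p x ^ (2 ^ n) ≤ K * p' x ^ (2 ^ n) := by
    intro n
    induction n with
    | zero => intro x; simpa using h x
    | succ n ih =>
      intro x
      have := ih (star x * x)
      rw [hp, hp', ← pow_mul, ← pow_mul] at this
      rwa [pow_succ, mul_comm]
  by_contra! hlt
  have hpos : 0 < p' x := by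
    refine lt_of_le_of_ne (hp0' x) fun h0 => ?_
    have := h x
    rw [← h0, mul_zero] at this
    linarith [hp0' x]
  have hr : 1 < p x / p' x := (one_lt_div hpos).2 hlt
  obtain ⟨n, hn⟩ := ((tendsto_pow_atTop_atTop_of_one_lt hr).eventually_gt_atTop K).exists
  have h1 : (p x / p' x) ^ n ≤ (p x / p' x) ^ (2 ^ n) :=
    pow_le_pow_right₀ hr.le Nat.lt_two_pow_self.le
  have h2 : (p x / p' x) ^ (2 ^ n) ≤ K := by
    rw [div_pow, div_le_iff₀ (by positivity)]
    exact key n x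
  linarith

end PowerTrick

section LeftMul

variable {A B : Type*} [NonUnitalCStarAlgebra A] [NonUnitalCStarAlgebra B]

/-- Left multiplication by an element of the unitization, as a linear map on `A`. -/
noncomputable def unitizationMulLeft (A : Type*) [NonUnitalCStarAlgebra A] :
    Unitization ℂ A →ₗ[ℂ] A →ₗ[ℂ] A :=
  LinearMap.mk₂ ℂ (fun u x => u.fst • x + u.snd * x)
    (fun u u' x => by simp only [Unitization.fst_add, Unitization.snd_add, add_smul, add_mul]; abel)
    (fun c u x => by simp [mul_smul, smul_mul_assoc])
    (fun u x x' => by simp only [smul_add, mul_add]; abel)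
    (fun c u x => by rw [smul_add, smul_comm, mul_smul_comm])

lemma inr_unitizationMulLeft (u : Unitization ℂ A) (x : A) :
    (unitizationMulLeft A u x : Unitization ℂ A) = u * x := by
  ext <;> simp [unitizationMulLeft]

lemma unitizationMulLeft_inr (a x : A) :
    unitizationMulLeft A (a : Unitization ℂ A) x = a * x := by
  simp [unitizationMulLeft]

lemma star_unitizationMulLeft_mul (u : Unitization ℂ A) (a a' : A) :
    star (unitizationMulLeft A u a) * unitizationMulLeft A u a'
      = star a * unitizationMulLeft A (star u * u) a' := by
  apply Unitization.inr_injective (R := ℂ)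
  simp only [Unitization.inr_mul, Unitization.inr_star, inr_unitizationMulLeft, star_mul, mul_assoc]

lemma star_map_unitizationMulLeft_mul (u : Unitization ℂ A) (s t : A ⊗[ℂ] B) :
    star (TensorProduct.map (unitizationMulLeft A u) LinearMap.id s) *
      TensorProduct.map (unitizationMulLeft A u) LinearMap.id t
      = star s * TensorProduct.map (unitizationMulLeft A (star u * u)) LinearMap.id t := by
  induction s using TensorProduct.induction_on with
  | zero => simp
  | add s s' hs hs' => simp only [map_add, star_add, add_mul, hs, hs']
  | tmul a b =>
    induction t using TensorProduct.induction_on with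
    | zero => simp
    | add t t' ht ht' => simp only [map_add, mul_add, ht, ht']
    | tmul a' b' =>
      simp [TensorProduct.star_tmul, star_unitizationMulLeft_mul]

lemma unitizationMulLeft_one : unitizationMulLeft A 1 = LinearMap.id := by
  ext x
  simp [unitizationMulLeft]

end LeftMul

namespace IsCStarSeminorm

variable {A B : Type*} [NonUnitalCStarAlgebra A] [NonUnitalCStarAlgebra B]
  {p : Seminorm ℂ (A ⊗[ℂ] B)}

lemma star_eq (hp : IsCStarSeminorm p) (t : A ⊗[ℂ] B) : p (star t) = p t := by
  have key : ∀ t, p t ≤ p (star t) := by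
    intro t
    by_contra! h
    have h1 := hp.mul_le (star t) t
    rw [hp.star_mul_self] at h1
    nlinarith [apply_nonneg p (star t)]
  refine le_antisymm ?_ (key t)
  simpa using key (star t)

lemma map_unitary (hp : IsCStarSeminorm p) {u : Unitization ℂ A} (hu : star u * u = 1)
    (t : A ⊗[ℂ] B) :
    p (TensorProduct.map (unitizationMulLeft A u) LinearMap.id t) = p t := by
  have h := hp.star_mul_self (TensorProduct.map (unitizationMulLeft A u) LinearMap.id t)
  rw [star_map_unitizationMulLeft_mul, hu, unitizationMulLeft_one, TensorProduct.map_id,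
    LinearMap.id_apply, hp.star_mul_self] at h
  nlinarith [apply_nonneg p t,
    apply_nonneg p (TensorProduct.map (unitizationMulLeft A u) LinearMap.id t)]

/-- A self-adjoint contraction is the average of two unitaries of the unitization, and unitaries
act isometrically. -/
lemma map_selfAdjoint_le (hp : IsCStarSeminorm p) {a : A} (ha : IsSelfAdjoint a) (ha1 : ‖a‖ ≤ 1)
    (t : A ⊗[ℂ] B) :
    p (TensorProduct.map (unitizationMulLeft A (a : Unitization ℂ A)) LinearMap.id t) ≤ p t := by
  let : PartialOrder (Unitization ℂ A) := CStarAlgebra.spectralOrder _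
  have : StarOrderedRing (Unitization ℂ A) := CStarAlgebra.spectralOrderedRing _
  let x : selfAdjoint (Unitization ℂ A) := ⟨(a : Unitization ℂ A), ha.inr (R := ℂ)⟩
  have hx : ‖x‖ ≤ 1 := by
    change ‖(a : Unitization ℂ A)‖ ≤ 1
    rwa [Unitization.norm_inr]
  let U := selfAdjoint.unitarySelfAddISMul x hx
  have hre := selfAdjoint.realPart_unitarySelfAddISMul x hx
  have hre' : (a : Unitization ℂ A) = (2⁻¹ : ℂ) • ((U : Unitization ℂ A) + star (U : _)) := by
    have := congrArg (fun z : selfAdjoint (Unitization ℂ A) => (z : Unitization ℂ A)) hre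
    simp only [realPart_apply_coe] at this
    change _ = (a : Unitization ℂ A) at this
    rw [← this, ← Complex.coe_smul]
    simp [U]
  have h1 : TensorProduct.map (unitizationMulLeft A (a : Unitization ℂ A)) LinearMap.id t =
      (2⁻¹ : ℂ) • (TensorProduct.map (unitizationMulLeft A (U : Unitization ℂ A)) LinearMap.id t +
        TensorProduct.map (unitizationMulLeft A (star (U : Unitization ℂ A))) LinearMap.id t) := by
    rw [hre', map_smul, map_add, TensorProduct.map_smul_left, TensorProduct.map_add_left]
    simp
  rw [h1, map_smul_eq_mul]
  have h2 := hp.map_unitary (Unitary.star_mul_self_of_mem U.2) t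
  have h3 := hp.map_unitary (u := star (U : Unitization ℂ A))
    (by rw [star_star]; exact Unitary.mul_star_self_of_mem U.2) t
  have h4 := map_add_le_add p
    (TensorProduct.map (unitizationMulLeft A (U : Unitization ℂ A)) LinearMap.id t)
    (TensorProduct.map (unitizationMulLeft A (star (U : Unitization ℂ A))) LinearMap.id t)
  rw [h2, h3] at h4
  have : ‖(2⁻¹ : ℂ)‖ = 2⁻¹ := by simp
  rw [this]
  linarith

lemma map_selfAdjoint_le_norm (hp : IsCStarSeminorm p) {a : A} (ha : IsSelfAdjoint a)
    (t : A ⊗[ℂ] B) :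
    p (TensorProduct.map (unitizationMulLeft A (a : Unitization ℂ A)) LinearMap.id t)
      ≤ ‖a‖ * p t := by
  by_cases h0 : a = 0
  · simp [h0]
  have hn : ‖a‖ ≠ 0 := norm_ne_zero_iff.2 h0
  have hb : IsSelfAdjoint (((‖a‖⁻¹ : ℝ) : ℂ) • a) := by
    rw [Complex.coe_smul]
    exact (IsSelfAdjoint.all _).smul ha
  have h1 := hp.map_selfAdjoint_le hb
    (by rw [norm_smul, Complex.norm_real, norm_inv, norm_norm, inv_mul_cancel₀ hn]) t
  rw [Unitization.inr_smul, map_smul, TensorProduct.map_smul_left, LinearMap.smul_apply,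
    map_smul_eq_mul, Complex.norm_real, norm_inv, norm_norm] at h1
  rwa [inv_mul_le_iff₀ (by positivity)] at h1

lemma mul_tmul_le (hp : IsCStarSeminorm p) (a a' : A) (b : B) :
    p ((a * a') ⊗ₜ[ℂ] b) ≤ ‖a‖ * p (a' ⊗ₜ[ℂ] b) := by
  have hL : ∀ (c x : A), TensorProduct.map (unitizationMulLeft A (c : Unitization ℂ A))
      LinearMap.id (x ⊗ₜ[ℂ] b) = (c * x) ⊗ₜ[ℂ] b := by
    intro c x
    rw [TensorProduct.map_tmul, unitizationMulLeft_inr, LinearMap.id_apply]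
  have h1 := hp.star_mul_self ((a * a') ⊗ₜ[ℂ] b)
  have h2 : star ((a * a') ⊗ₜ[ℂ] b) * ((a * a') ⊗ₜ[ℂ] b) =
      star (a' ⊗ₜ[ℂ] b) * ((star a * a * a') ⊗ₜ[ℂ] b) := by
    simp [TensorProduct.star_tmul, mul_assoc]
  have h3 := hp.mul_le (star (a' ⊗ₜ[ℂ] b)) ((star a * a * a') ⊗ₜ[ℂ] b)
  have h4 := hp.map_selfAdjoint_le_norm (IsSelfAdjoint.star_mul_self a) (a' ⊗ₜ[ℂ] b)
  rw [hL, CStarRing.norm_star_mul_self] at h4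
  rw [h2] at h1
  rw [h1, hp.star_eq] at h3
  refine le_of_sq_le_sq ?_ (by positivity)
  calc _ ≤ _ := h3
    _ ≤ p (a' ⊗ₜ[ℂ] b) * (‖a‖ * ‖a‖ * p (a' ⊗ₜ[ℂ] b)) := by gcongr
    _ = _ := by ring

lemma comm (hp : IsCStarSeminorm p) :
    IsCStarSeminorm (p.comp (TensorProduct.comm ℂ B A : B ⊗[ℂ] A →ₗ[ℂ] A ⊗[ℂ] B)) := by
  have hmul : ∀ s t : B ⊗[ℂ] A, TensorProduct.comm ℂ B A (s * t) =
      TensorProduct.comm ℂ B A s * TensorProduct.comm ℂ B A t := by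
    intro s t
    induction s using TensorProduct.induction_on with
    | zero => simp
    | add s s' hs hs' => simp only [map_add, add_mul, hs, hs']
    | tmul a b =>
      induction t using TensorProduct.induction_on with
      | zero => simp
      | add t t' ht ht' => simp only [map_add, mul_add, ht, ht']
      | tmul a' b' => simp
  have hstar : ∀ s : B ⊗[ℂ] A, TensorProduct.comm ℂ B A (star s) =
      star (TensorProduct.comm ℂ B A s) := by
    intro s
    induction s using TensorProduct.induction_on with
    | zero => simp
    | add s s' hs hs' => simp only [map_add, star_add, hs, hs']
    | tmul a b => simp [TensorProduct.star_tmul]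
  refine ⟨fun s t => ?_, fun t => ?_⟩
  · simpa [hmul] using hp.mul_le _ _
  · simpa [hmul, hstar] using hp.star_mul_self _

lemma tmul_mul_le (hp : IsCStarSeminorm p) (a : A) (b b' : B) :
    p (a ⊗ₜ[ℂ] (b * b')) ≤ ‖b‖ * p (a ⊗ₜ[ℂ] b') := by
  simpa using hp.comm.mul_tmul_le b b' a

/-- Every C⋆-seminorm on `A ⊗ B` is a subcross seminorm. -/
lemma tmul_le (hp : IsCStarSeminorm p) (a : A) (b : B) : p (a ⊗ₜ[ℂ] b) ≤ ‖a‖ * ‖b‖ := by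
  have h1 := hp.star_mul_self (a ⊗ₜ[ℂ] b)
  rw [TensorProduct.star_tmul, Algebra.TensorProduct.tmul_mul_tmul] at h1
  have h2 := hp.mul_tmul_le (star a) a (star b * b)
  have h3 := hp.tmul_mul_le a (star b) b
  rw [norm_star] at h2 h3
  by_contra! h
  have h0 : 0 ≤ ‖a‖ * ‖b‖ := by positivity
  have h4 : p (a ⊗ₜ[ℂ] b) ^ 2 ≤ ‖a‖ * (‖b‖ * p (a ⊗ₜ[ℂ] b)) := by
    rw [← h1]
    exact h2.trans (by gcongr)
  nlinarith

end IsCStarSeminorm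

section MaxNorm

variable {A B : Type*} [NonUnitalCStarAlgebra A] [NonUnitalCStarAlgebra B]

lemma exists_bound_isCStarSeminorm (t : A ⊗[ℂ] B) :
    ∃ K : ℝ, 0 ≤ K ∧ ∀ p : Seminorm ℂ (A ⊗[ℂ] B), IsCStarSeminorm p → p t ≤ K := by
  induction t using TensorProduct.induction_on with
  | zero => exact ⟨0, le_rfl, fun p _ => by simp⟩
  | tmul a b => exact ⟨‖a‖ * ‖b‖, by positivity, fun p hp => hp.tmul_le a b⟩
  | add s t hs ht =>
    obtain ⟨K, hK0, hK⟩ := hs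
    obtain ⟨L, hL0, hL⟩ := ht
    exact ⟨K + L, by positivity, fun p hp =>
      (map_add_le_add p s t).trans (add_le_add (hK p hp) (hL p hp))⟩

lemma maxNorm_le_ofReal {t : A ⊗[ℂ] B} {c : ℝ}
    (h : ∀ p : Seminorm ℂ (A ⊗[ℂ] B), IsCStarSeminorm p → p t ≤ c) :
    maxNorm t ≤ ENNReal.ofReal c :=
  iSup₂_le fun p hp => ENNReal.ofReal_le_ofReal (h p hp)

lemma maxNorm_ne_top (t : A ⊗[ℂ] B) : maxNorm t ≠ ⊤ := by
  obtain ⟨K, -, hK⟩ := exists_bound_isCStarSeminorm t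
  exact ((maxNorm_le_ofReal hK).trans_lt ENNReal.ofReal_lt_top).ne

lemma IsCStarSeminorm.le_maxNorm {p : Seminorm ℂ (A ⊗[ℂ] B)} (hp : IsCStarSeminorm p)
    (t : A ⊗[ℂ] B) : p t ≤ (maxNorm t).toReal := by
  rw [← ENNReal.ofReal_le_iff_le_toReal (maxNorm_ne_top t)]
  exact le_iSup₂_of_le p hp le_rfl

lemma toReal_maxNorm_le {t : A ⊗[ℂ] B} {c : ℝ} (hc : 0 ≤ c)
    (h : ∀ p : Seminorm ℂ (A ⊗[ℂ] B), IsCStarSeminorm p → p t ≤ c) :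
    (maxNorm t).toReal ≤ c :=
  ENNReal.toReal_le_of_le_ofReal hc (maxNorm_le_ofReal h)

variable (A B) in
/-- The maximal norm as a real-valued seminorm. -/
noncomputable def maxSeminorm : Seminorm ℂ (A ⊗[ℂ] B) :=
  Seminorm.of (fun t => (maxNorm t).toReal)
    (fun s t => toReal_maxNorm_le (by positivity) fun p hp =>
      (map_add_le_add p s t).trans (add_le_add (hp.le_maxNorm s) (hp.le_maxNorm t)))
    (fun c t => by
      have key : ∀ (c : ℂ) (t : A ⊗[ℂ] B),
          (maxNorm (c • t)).toReal ≤ ‖c‖ * (maxNorm t).toReal := fun c t =>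
        toReal_maxNorm_le (by positivity) fun p hp => by
          rw [map_smul_eq_mul]
          gcongr
          exact hp.le_maxNorm t
      refine le_antisymm (key c t) ?_
      by_cases hc : c = 0
      · simp [hc]
      have h := key c⁻¹ (c • t)
      rw [inv_smul_smul₀ hc, norm_inv, ← div_eq_inv_mul, le_div_iff₀ (norm_pos_iff.2 hc)] at h
      rwa [mul_comm])

lemma ofReal_maxSeminorm (t : A ⊗[ℂ] B) : ENNReal.ofReal (maxSeminorm A B t) = maxNorm t :=
  ENNReal.ofReal_toReal (maxNorm_ne_top t)

lemma IsCStarSeminorm.le_maxSeminorm {p : Seminorm ℂ (A ⊗[ℂ] B)} (hp : IsCStarSeminorm p)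
    (t : A ⊗[ℂ] B) : p t ≤ maxSeminorm A B t :=
  hp.le_maxNorm t

lemma maxSeminorm_le {t : A ⊗[ℂ] B} {c : ℝ} (hc : 0 ≤ c)
    (h : ∀ p : Seminorm ℂ (A ⊗[ℂ] B), IsCStarSeminorm p → p t ≤ c) :
    maxSeminorm A B t ≤ c :=
  toReal_maxNorm_le hc h

variable (A B) in
lemma isCStarSeminorm_maxSeminorm : IsCStarSeminorm (maxSeminorm A B) := by
  refine ⟨fun s t => maxSeminorm_le (by positivity) fun p hp => (hp.mul_le s t).trans ?_,
    fun t => le_antisymm (maxSeminorm_le (by positivity) fun p hp => ?_) ?_⟩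
  · gcongr
    · exact hp.le_maxSeminorm s
    · exact hp.le_maxSeminorm t
  · rw [hp.star_mul_self]
    gcongr
    exact hp.le_maxSeminorm t
  · have h : maxSeminorm A B t ≤ √(maxSeminorm A B (star t * t)) :=
      maxSeminorm_le (Real.sqrt_nonneg _) fun p hp => Real.le_sqrt_of_sq_le <| by
        rw [← hp.star_mul_self]
        exact hp.le_maxSeminorm _
    exact (Real.le_sqrt (apply_nonneg _ _) (apply_nonneg _ _)).1 h

lemma maxSeminorm_tmul_le (a : A) (b : B) : maxSeminorm A B (a ⊗ₜ[ℂ] b) ≤ ‖a‖ * ‖b‖ :=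
  (isCStarSeminorm_maxSeminorm A B).tmul_le a b

end MaxNorm

section MinNorm

variable {A : Type u} {B : Type v} [NonUnitalCStarAlgebra A] [NonUnitalCStarAlgebra B]
  {H K : Type*}
  [NormedAddCommGroup H] [InnerProductSpace ℂ H] [CompleteSpace H]
  [NormedAddCommGroup K] [InnerProductSpace ℂ K] [CompleteSpace K]

lemma tensorRep_tmul (π : A →⋆ₙₐ[ℂ] (H →L[ℂ] H)) (σ : B →⋆ₙₐ[ℂ] (K →L[ℂ] K)) (a : A) (b : B) :
    tensorRep π σ (a ⊗ₜ[ℂ] b) = TensorProduct.mapL (π a) (σ b) := by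
  simp [tensorRep]

lemma tensorRep_mul (π : A →⋆ₙₐ[ℂ] (H →L[ℂ] H)) (σ : B →⋆ₙₐ[ℂ] (K →L[ℂ] K))
    (s t : A ⊗[ℂ] B) : tensorRep π σ (s * t) = tensorRep π σ s * tensorRep π σ t := by
  induction s using TensorProduct.induction_on with
  | zero => simp
  | add s s' hs hs' => simp only [map_add, add_mul, hs, hs']
  | tmul a b =>
    induction t using TensorProduct.induction_on with
    | zero => simp
    | add t t' ht ht' => simp only [map_add, mul_add, ht, ht']
    | tmul a' b' => exact clm_tensor_ext fun h k => by simp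

lemma inner_tensorRep_star (π : A →⋆ₙₐ[ℂ] (H →L[ℂ] H)) (σ : B →⋆ₙₐ[ℂ] (K →L[ℂ] K))
    (t : A ⊗[ℂ] B) (x y : H ⊗[ℂ] K) :
    inner ℂ (tensorRep π σ (star t) x) y = inner ℂ x (tensorRep π σ t y) := by
  induction t using TensorProduct.induction_on with
  | zero => simp
  | add s s' hs hs' => simp only [star_add, map_add, add_apply, inner_add_left,
      inner_add_right, hs, hs']
  | tmul a b =>
    induction x using TensorProduct.induction_on with
    | zero => simp
    | add x x' hx hx' => simp only [map_add, inner_add_left, hx, hx']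
    | tmul h k =>
      induction y using TensorProduct.induction_on with
      | zero => simp
      | add y y' hy hy' => simp only [map_add, inner_add_right, hy, hy']
      | tmul h' k' =>
        simp only [TensorProduct.star_tmul, tensorRep_tmul_apply_tmul, TensorProduct.inner_tmul,
          map_star, ContinuousLinearMap.star_eq_adjoint, ContinuousLinearMap.adjoint_inner_left]

lemma norm_tensorRep_star_mul_self (π : A →⋆ₙₐ[ℂ] (H →L[ℂ] H)) (σ : B →⋆ₙₐ[ℂ] (K →L[ℂ] K))
    (t : A ⊗[ℂ] B) : ‖tensorRep π σ (star t * t)‖ = ‖tensorRep π σ t‖ ^ 2 := by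
  have key : ∀ t, ‖tensorRep π σ t‖ ^ 2 ≤ ‖tensorRep π σ (star t * t)‖ := by
    intro t
    suffices h : ‖tensorRep π σ t‖ ≤ √‖tensorRep π σ (star t * t)‖ from
      (Real.le_sqrt (norm_nonneg (tensorRep π σ t))
        (norm_nonneg (tensorRep π σ (star t * t)))).1 h
    refine ContinuousLinearMap.opNorm_le_bound _ (Real.sqrt_nonneg _) fun x => ?_
    refine le_of_sq_le_sq ?_ (by positivity)
    rw [mul_pow, Real.sq_sqrt (norm_nonneg (tensorRep π σ (star t * t))), ← inner_self_eq_norm_sq (𝕜 := ℂ),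
      ← inner_tensorRep_star, ← mul_apply_eq_comp, ← tensorRep_mul]
    refine (Complex.re_le_norm _).trans ((norm_inner_le_norm
      (tensorRep π σ (star t * t) x) x).trans ?_)
    rw [sq, ← mul_assoc]
    gcongr
    exact ContinuousLinearMap.le_opNorm _ _
  have hstar : ∀ t, ‖tensorRep π σ t‖ ≤ ‖tensorRep π σ (star t)‖ := by
    intro t
    have h1 := key t
    rw [tensorRep_mul] at h1
    have h2 := ContinuousLinearMap.opNorm_comp_le (tensorRep π σ (star t)) (tensorRep π σ t)
    rw [← ContinuousLinearMap.mul_def] at h2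
    by_contra! h
    nlinarith [norm_nonneg (tensorRep π σ (star t))]
  refine le_antisymm ?_ (key t)
  rw [tensorRep_mul, sq]
  refine (ContinuousLinearMap.opNorm_comp_le _ _).trans ?_
  gcongr
  simpa using hstar (star t)

/-- The C⋆-seminorm on `A ⊗ B` given by a pair of representations. -/
noncomputable def repSeminorm (π : A →⋆ₙₐ[ℂ] (H →L[ℂ] H)) (σ : B →⋆ₙₐ[ℂ] (K →L[ℂ] K)) :
    Seminorm ℂ (A ⊗[ℂ] B) :=
  Seminorm.ofSMulLE (fun t => ‖tensorRep π σ t‖) (by rw [map_zero]; exact ContinuousLinearMap.opNorm_zero)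
    (fun s t => by rw [map_add]; exact ContinuousLinearMap.opNorm_add_le _ _)
    (fun c t => by rw [map_smul]; exact ContinuousLinearMap.opNorm_smul_le _ _)

lemma repSeminorm_apply (π : A →⋆ₙₐ[ℂ] (H →L[ℂ] H)) (σ : B →⋆ₙₐ[ℂ] (K →L[ℂ] K))
    (t : A ⊗[ℂ] B) : repSeminorm π σ t = ‖tensorRep π σ t‖ := rfl

lemma isCStarSeminorm_repSeminorm (π : A →⋆ₙₐ[ℂ] (H →L[ℂ] H)) (σ : B →⋆ₙₐ[ℂ] (K →L[ℂ] K)) :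
    IsCStarSeminorm (repSeminorm π σ) := by
  refine ⟨fun s t => ?_, fun t => norm_tensorRep_star_mul_self π σ t⟩
  simp only [repSeminorm_apply, tensorRep_mul]
  exact ContinuousLinearMap.opNorm_comp_le _ _

/-- Bounding the minimal norm amounts to bounding all tensor product representations. -/
lemma minNorm_le_iff {t : A ⊗[ℂ] B} {c : ℝ≥0∞} :
    minNorm t ≤ c ↔ ∀ (H : Type u) [NormedAddCommGroup H] [InnerProductSpace ℂ H] [CompleteSpace H]
      (K : Type v) [NormedAddCommGroup K] [InnerProductSpace ℂ K] [CompleteSpace K]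
      (π : A →⋆ₙₐ[ℂ] (H →L[ℂ] H)) (σ : B →⋆ₙₐ[ℂ] (K →L[ℂ] K)), ‖tensorRep π σ t‖ₑ ≤ c := by
  simp only [minNorm, iSup_le_iff]

lemma minNorm_le_maxNorm (t : A ⊗[ℂ] B) : minNorm t ≤ maxNorm t := by
  rw [minNorm_le_iff]
  intro H _ _ _ K _ _ _ π σ
  rw [← ofReal_norm (tensorRep π σ t), ← repSeminorm_apply, ← ofReal_maxSeminorm]
  exact ENNReal.ofReal_le_ofReal ((isCStarSeminorm_repSeminorm π σ).le_maxSeminorm t)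

lemma minNorm_ne_top (t : A ⊗[ℂ] B) : minNorm t ≠ ⊤ :=
  ((minNorm_le_maxNorm t).trans_lt (maxNorm_ne_top t).lt_top).ne

lemma toReal_minNorm_le {t : A ⊗[ℂ] B} {c : ℝ} (hc : 0 ≤ c)
    (h : ∀ (H : Type u) [NormedAddCommGroup H] [InnerProductSpace ℂ H] [CompleteSpace H]
      (K : Type v) [NormedAddCommGroup K] [InnerProductSpace ℂ K] [CompleteSpace K]
      (π : A →⋆ₙₐ[ℂ] (H →L[ℂ] H)) (σ : B →⋆ₙₐ[ℂ] (K →L[ℂ] K)), ‖tensorRep π σ t‖ ≤ c) :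
    (minNorm t).toReal ≤ c := by
  refine ENNReal.toReal_le_of_le_ofReal hc (minNorm_le_iff.2 ?_)
  intro H _ _ _ K _ _ _ π σ
  rw [← ofReal_norm]
  exact ENNReal.ofReal_le_ofReal (h H K π σ)

lemma norm_tensorRep_le_minNorm {H : Type u} {K : Type v}
    [NormedAddCommGroup H] [InnerProductSpace ℂ H] [CompleteSpace H]
    [NormedAddCommGroup K] [InnerProductSpace ℂ K] [CompleteSpace K]
    (π : A →⋆ₙₐ[ℂ] (H →L[ℂ] H)) (σ : B →⋆ₙₐ[ℂ] (K →L[ℂ] K)) (t : A ⊗[ℂ] B) :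
    ‖tensorRep π σ t‖ ≤ (minNorm t).toReal := by
  rw [← ENNReal.ofReal_le_iff_le_toReal (minNorm_ne_top t), ofReal_norm (tensorRep π σ t)]
  exact minNorm_le_iff.1 le_rfl H K π σ

variable (A B) in
/-- The minimal norm as a real-valued seminorm. -/
noncomputable def minSeminorm : Seminorm ℂ (A ⊗[ℂ] B) :=
  Seminorm.of (fun t => (minNorm t).toReal)
    (fun s t => toReal_minNorm_le (by positivity) fun H _ _ _ K _ _ _ π σ => by
      rw [map_add]
      exact (norm_add_le (tensorRep π σ s) (tensorRep π σ t)).trans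
        (add_le_add (norm_tensorRep_le_minNorm π σ s)
        (norm_tensorRep_le_minNorm π σ t)))
    (fun c t => by
      have key : ∀ (c : ℂ) (t : A ⊗[ℂ] B),
          (minNorm (c • t)).toReal ≤ ‖c‖ * (minNorm t).toReal := fun c t =>
        toReal_minNorm_le (by positivity) fun H _ _ _ K _ _ _ π σ => by
          rw [map_smul]
          refine (ContinuousLinearMap.opNorm_smul_le _ _).trans ?_
          gcongr
          exact norm_tensorRep_le_minNorm π σ t
      refine le_antisymm (key c t) ?_
      by_cases hc : c = 0
      · simp [hc]
      have h := key c⁻¹ (c • t)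
      rw [inv_smul_smul₀ hc, norm_inv, ← div_eq_inv_mul, le_div_iff₀ (norm_pos_iff.2 hc)] at h
      rwa [mul_comm])

lemma ofReal_minSeminorm (t : A ⊗[ℂ] B) : ENNReal.ofReal (minSeminorm A B t) = minNorm t :=
  ENNReal.ofReal_toReal (minNorm_ne_top t)

lemma norm_tensorRep_le_minSeminorm {H : Type u} {K : Type v}
    [NormedAddCommGroup H] [InnerProductSpace ℂ H] [CompleteSpace H]
    [NormedAddCommGroup K] [InnerProductSpace ℂ K] [CompleteSpace K]
    (π : A →⋆ₙₐ[ℂ] (H →L[ℂ] H)) (σ : B →⋆ₙₐ[ℂ] (K →L[ℂ] K)) (t : A ⊗[ℂ] B) :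
    ‖tensorRep π σ t‖ ≤ minSeminorm A B t :=
  norm_tensorRep_le_minNorm π σ t

lemma minSeminorm_le {t : A ⊗[ℂ] B} {c : ℝ} (hc : 0 ≤ c)
    (h : ∀ (H : Type u) [NormedAddCommGroup H] [InnerProductSpace ℂ H] [CompleteSpace H]
      (K : Type v) [NormedAddCommGroup K] [InnerProductSpace ℂ K] [CompleteSpace K]
      (π : A →⋆ₙₐ[ℂ] (H →L[ℂ] H)) (σ : B →⋆ₙₐ[ℂ] (K →L[ℂ] K)), ‖tensorRep π σ t‖ ≤ c) :
    minSeminorm A B t ≤ c :=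
  toReal_minNorm_le hc h

lemma minSeminorm_star_mul_self (t : A ⊗[ℂ] B) :
    minSeminorm A B (star t * t) = minSeminorm A B t ^ 2 := by
  refine le_antisymm (minSeminorm_le (by positivity) fun H _ _ _ K _ _ _ π σ => ?_) ?_
  · rw [norm_tensorRep_star_mul_self]
    gcongr
    exact norm_tensorRep_le_minSeminorm π σ t
  · have h : minSeminorm A B t ≤ √(minSeminorm A B (star t * t)) :=
      minSeminorm_le (Real.sqrt_nonneg _) fun H _ _ _ K _ _ _ π σ => Real.le_sqrt_of_sq_le <| by
        rw [← norm_tensorRep_star_mul_self]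
        exact norm_tensorRep_le_minSeminorm π σ _
    exact (Real.le_sqrt (apply_nonneg _ _) (apply_nonneg _ _)).1 h

lemma minSeminorm_le_maxSeminorm (t : A ⊗[ℂ] B) : minSeminorm A B t ≤ maxSeminorm A B t :=
  ENNReal.toReal_mono (maxNorm_ne_top t) (minNorm_le_maxNorm t)

end MinNorm

section MinMax

variable {C : Type u} {B : Type v} {D : Type w} [NonUnitalCStarAlgebra C]
  [NonUnitalCStarAlgebra B] [NonUnitalCStarAlgebra D]

lemma tensorId_tmul (i : C →⋆ₙₐ[ℂ] B) (c : C) (d : D) :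
    tensorId i D (c ⊗ₜ[ℂ] d) = i c ⊗ₜ[ℂ] d := rfl

lemma tensorId_star_mul_self (i : C →⋆ₙₐ[ℂ] B) (s t : C ⊗[ℂ] D) :
    tensorId i D (star s * t) = star (tensorId i D s) * tensorId i D t := by
  induction s using TensorProduct.induction_on with
  | zero => simp
  | add s s' hs hs' => simp only [map_add, star_add, add_mul, hs, hs']
  | tmul a b =>
    induction t using TensorProduct.induction_on with
    | zero => simp
    | add t t' ht ht' => simp only [map_add, mul_add, ht, ht']
    | tmul a' b' => simp [TensorProduct.star_tmul, tensorId_tmul, map_star]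

/-- If `i ⊗ Id` is bounded from the minimal to the maximal norm, it is contractive. -/
lemma IsMinMaxContinuous.maxNorm_le {i : C →⋆ₙₐ[ℂ] B} (h : IsMinMaxContinuous i D)
    (t : C ⊗[ℂ] D) : maxNorm (tensorId i D t) ≤ minNorm t := by
  obtain ⟨c, hc⟩ := h
  have key := le_of_le_const_mul_of_star_mul_self
    (p := fun t : C ⊗[ℂ] D => maxSeminorm B D (tensorId i D t)) (p' := minSeminorm C D)
    (fun x => apply_nonneg _ _)
    (fun x => by rw [tensorId_star_mul_self, (isCStarSeminorm_maxSeminorm B D).star_mul_self])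
    minSeminorm_star_mul_self (K := c) (fun x => by
      have := ENNReal.toReal_mono (ENNReal.mul_ne_top ENNReal.coe_ne_top (minNorm_ne_top x)) (hc x)
      rwa [ENNReal.toReal_mul, ENNReal.coe_toReal] at this) t
  rw [← ofReal_maxSeminorm, ← ofReal_minSeminorm]
  exact ENNReal.ofReal_le_ofReal key

end MinMax

/-! ### Direct sums of representations and the Gelfand–Naimark theorem -/

section Diagonal

variable {ι : Type*} {G : ι → Type*} [∀ i, NormedAddCommGroup (G i)]
  [∀ i, InnerProductSpace ℂ (G i)]

/-- The diagonal operator `f ↦ (x i (f i))` on a Hilbert sum. -/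
noncomputable def lpDiagCLM (x : lp (fun i => G i →L[ℂ] G i) ∞) : lp G 2 →L[ℂ] lp G 2 := by
  have hb : ∀ (f : lp G 2) i, ‖x i (f i)‖ ≤ ‖((‖x‖ : ℂ) • f) i‖ := fun f i => by
    rw [lp.coeFn_smul, Pi.smul_apply, norm_smul, Complex.norm_real, norm_norm]
    exact ((x i).le_opNorm _).trans (by gcongr; exact lp.norm_apply_le_norm (by simp) x i)
  exact LinearMap.mkContinuous
    { toFun := fun f => ⟨fun i => x i (f i), (lp.memℓp ((‖x‖ : ℂ) • f)).mono' (hb f)⟩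
      map_add' := fun f g => by ext i; exact map_add (x i) (f i) (g i)
      map_smul' := fun c f => by ext i; exact map_smul (x i) c (f i) } ‖x‖ fun f => by
    have h := lp.norm_mono (p := 2) (by simp)
      (x := ⟨fun i => x i (f i), (lp.memℓp ((‖x‖ : ℂ) • f)).mono' (hb f)⟩)
      (y := (‖x‖ : ℂ) • f) (hb f)
    rw [norm_smul, Complex.norm_real, norm_norm] at h
    exact h

@[simp] lemma lpDiagCLM_apply (x : lp (fun i => G i →L[ℂ] G i) ∞) (f : lp G 2) (i : ι) :
    lpDiagCLM x f i = x i (f i) := rfl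

variable [∀ i, CompleteSpace (G i)]

/-- Bounded families of operators act diagonally on the Hilbert sum. -/
noncomputable def lpDiag :
    lp (fun i => G i →L[ℂ] G i) ∞ →⋆ₙₐ[ℂ] (lp G 2 →L[ℂ] lp G 2) where
  toFun := lpDiagCLM
  map_smul' c x := by ext f i; simp
  map_zero' := by ext f i; simp
  map_add' x y := by ext f i; simp
  map_mul' x y := by ext f i; simp
  map_star' x := by
    rw [ContinuousLinearMap.star_eq_adjoint]
    refine (ContinuousLinearMap.eq_adjoint_iff _ _).2 fun f g => ?_
    simp [lp.inner_eq_tsum, ContinuousLinearMap.star_eq_adjoint,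
      ContinuousLinearMap.adjoint_inner_left]

@[simp] lemma lpDiag_apply (x : lp (fun i => G i →L[ℂ] G i) ∞) (f : lp G 2) (i : ι) :
    lpDiag x f i = x i (f i) := rfl

variable {A : Type*} [NonUnitalCStarAlgebra A]

/-- The direct sum of a family of representations. -/
noncomputable def directSumRep (π : ∀ i, A →⋆ₙₐ[ℂ] (G i →L[ℂ] G i)) :
    A →⋆ₙₐ[ℂ] (lp G 2 →L[ℂ] lp G 2) :=
  (lpDiag (G := G)).comp
    { toFun := fun a => ⟨fun i => π i a, memℓp_infty ⟨‖a‖, by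
        rintro _ ⟨i, rfl⟩
        exact NonUnitalStarAlgHom.norm_apply_le (π i) a⟩⟩
      map_smul' := fun c x => by ext i : 2; exact map_smul (π i) c x
      map_zero' := by ext i : 2; exact map_zero (π i)
      map_add' := fun x y => by ext i : 2; exact map_add (π i) x y
      map_mul' := fun x y => by ext i : 2; exact map_mul (π i) x y
      map_star' := fun x => by ext i : 2; exact map_star (π i) x }

@[simp] lemma directSumRep_apply (π : ∀ i, A →⋆ₙₐ[ℂ] (G i →L[ℂ] G i)) (a : A) (f : lp G 2)
    (i : ι) : directSumRep π a f i = π i a (f i) := rfl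

end Diagonal

section GelfandNaimark

open scoped ComplexOrder ComplexStarModule

/-- A nonzero positive element is not annihilated by some positive functional: separate its
negative from the closed cone of positive elements. -/
lemma exists_positiveLinearMap_ne_zero {A : Type*} [NonUnitalCStarAlgebra A] [PartialOrder A]
    [StarOrderedRing A] {h : A} (h0 : 0 ≤ h) (hne : h ≠ 0) :
    ∃ f : A →ₚ[ℂ] ℂ, f h ≠ 0 := by
  have hconv : Convex ℝ {a : A | 0 ≤ a} := convex_Ici 0
  have hnot : -h ∉ {a : A | 0 ≤ a} := fun hn =>
    hne (le_antisymm (neg_nonneg.1 hn) h0)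
  obtain ⟨g, c, hg, hc⟩ := geometric_hahn_banach_point_closed hconv
    CStarAlgebra.isClosed_nonneg hnot
  have hc0 : c < 0 := by simpa using hc 0 le_rfl
  have hpos : ∀ a : A, 0 ≤ a → 0 ≤ g a := by
    intro a ha
    by_contra! hlt
    obtain ⟨n, hn⟩ := exists_nat_gt (c / g a)
    have h1 := hc ((n : ℝ) • a) (smul_nonneg (Nat.cast_nonneg n) ha)
    rw [map_smul, smul_eq_mul] at h1
    rw [div_lt_iff_of_neg hlt] at hn
    linarith
  let f : A →ₗ[ℂ] ℂ :=
    { toFun := fun a => (g (ℜ a : A) : ℂ) + Complex.I * (g (ℑ a : A) : ℂ)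
      map_add' := fun a b => by
        simp only [map_add, AddSubgroup.coe_add, Complex.ofReal_add]
        ring
      map_smul' := fun z a => by
        have h1 : ((ℜ (z • a) : selfAdjoint A) : A) = z.re • (ℜ a : A) - z.im • (ℑ a : A) := by
          rw [realPart_smul]; rfl
        have h2 : ((ℑ (z • a) : selfAdjoint A) : A) = z.re • (ℑ a : A) + z.im • (ℜ a : A) := by
          rw [imaginaryPart_smul]; rfl
        rw [h1, h2]
        simp only [map_sub, map_add, map_smul, smul_eq_mul, Complex.ofReal_sub, Complex.ofReal_add,
          Complex.ofReal_mul, RingHom.id_apply]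
        conv_rhs => rw [← Complex.re_add_im z]
        linear_combination (-(z.im : ℂ) * (g (ℑ a : A) : ℂ)) * Complex.I_sq }
  have hf : ∀ a : A, 0 ≤ a → f a = (g a : ℂ) := by
    intro a ha
    have hsa := IsSelfAdjoint.of_nonneg ha
    simp [f, hsa.coe_realPart, hsa.imaginaryPart]
  refine ⟨PositiveLinearMap.mk₀ f fun a ha => ?_, ?_⟩
  · rw [hf a ha]
    exact_mod_cast hpos a ha
  · change f h ≠ 0
    rw [hf h h0]
    have : 0 < g h := by
      have : g (-h) < 0 := hg.trans hc0
      rw [map_neg] at this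
      linarith
    exact_mod_cast this.ne'

/-- The Gelfand–Naimark theorem: the direct sum of all GNS representations is faithful. -/
theorem exists_faithful_representation (A : Type u) [NonUnitalCStarAlgebra A] :
    ∃ (H : Type u) (_ : NormedAddCommGroup H) (_ : InnerProductSpace ℂ H) (_ : CompleteSpace H)
      (π : A →⋆ₙₐ[ℂ] (H →L[ℂ] H)), Function.Injective π := by
  let : PartialOrder A := CStarAlgebra.spectralOrder A
  have : StarOrderedRing A := CStarAlgebra.spectralOrderedRing A
  refine ⟨lp (fun f : A →ₚ[ℂ] ℂ => f.GNS) 2, inferInstance, inferInstance, inferInstance,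
    directSumRep fun f => f.gnsNonUnitalStarAlgHom, ?_⟩
  rw [injective_iff_map_eq_zero]
  intro a ha
  by_contra hne
  have h1 : star (a * star a) * (a * star a) ≠ 0 := by
    rw [CStarRing.star_mul_self_ne_zero_iff, CStarRing.mul_star_self_ne_zero_iff]
    exact hne
  obtain ⟨f, hf⟩ := exists_positiveLinearMap_ne_zero (star_mul_self_nonneg (a * star a)) h1
  have h2 : f.gnsNonUnitalStarAlgHom a = 0 := by
    classical
    ext x
    have := congrArg (fun T => T (lp.single 2 f x) f) ha
    simpa using this
  have h3 : f.gnsNonUnitalStarAlgHom a (f.toPreGNS (star a)) = 0 := by rw [h2]; rfl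
  rw [PositiveLinearMap.gnsNonUnitalStarAlgHom_apply_coe] at h3
  have h4 : ‖f.leftMulMapPreGNS a (f.toPreGNS (star a))‖ = 0 := by
    rw [← UniformSpace.Completion.norm_coe, h3, norm_zero]
  have h5 := f.preGNS_norm_sq (f.leftMulMapPreGNS a (f.toPreGNS (star a)))
  rw [h4] at h5
  apply hf
  rw [PositiveLinearMap.leftMulMapPreGNS_apply] at h5
  simpa using h5.symm

end GelfandNaimark

/-! ### Matrix norms and compressions -/

lemma seminorm_sum_le {E : Type*} [AddCommGroup E] [Module ℂ E] (p : Seminorm ℂ E) {ι : Type*}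
    (s : Finset ι) (x : ι → E) : p (∑ j ∈ s, x j) ≤ ∑ j ∈ s, p (x j) :=
  Finset.le_sum_of_subadditive p (map_zero p).le (map_add_le_add p) s x

section MatrixNorm

variable {A : Type*} [NonUnitalCStarAlgebra A] {n : ℕ}

lemma matrixNorm_nonneg (X : Matrix (Fin n) (Fin n) A) : 0 ≤ matrixNorm n X := by
  let : PartialOrder A := CStarAlgebra.spectralOrder A
  have : StarOrderedRing A := CStarAlgebra.spectralOrderedRing A
  exact norm_nonneg (CStarMatrix.ofMatrix X)

lemma matrixNorm_zero : matrixNorm n (0 : Matrix (Fin n) (Fin n) A) = 0 := by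
  let : PartialOrder A := CStarAlgebra.spectralOrder A
  have : StarOrderedRing A := CStarAlgebra.spectralOrderedRing A
  exact norm_zero (E := CStarMatrix (Fin n) (Fin n) A)

lemma matrixNorm_add_le (X Y : Matrix (Fin n) (Fin n) A) :
    matrixNorm n (X + Y) ≤ matrixNorm n X + matrixNorm n Y := by
  let : PartialOrder A := CStarAlgebra.spectralOrder A
  have : StarOrderedRing A := CStarAlgebra.spectralOrderedRing A
  exact norm_add_le (CStarMatrix.ofMatrix X) (CStarMatrix.ofMatrix Y)

lemma matrixNorm_smul (c : ℂ) (X : Matrix (Fin n) (Fin n) A) :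
    matrixNorm n (c • X) = ‖c‖ * matrixNorm n X := by
  let : PartialOrder A := CStarAlgebra.spectralOrder A
  have : StarOrderedRing A := CStarAlgebra.spectralOrderedRing A
  exact norm_smul c (CStarMatrix.ofMatrix X)

lemma matrixNorm_neg (X : Matrix (Fin n) (Fin n) A) : matrixNorm n (-X) = matrixNorm n X := by
  have := matrixNorm_smul (-1) X
  simpa using this

lemma matrixNorm_le_add_sub (X Y : Matrix (Fin n) (Fin n) A) :
    matrixNorm n X ≤ matrixNorm n Y + matrixNorm n (X - Y) := by
  have := matrixNorm_add_le Y (X - Y)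
  rwa [add_sub_cancel] at this

lemma matrixNorm_sum_le {ι : Type*} (s : Finset ι) (X : ι → Matrix (Fin n) (Fin n) A) :
    matrixNorm n (∑ j ∈ s, X j) ≤ ∑ j ∈ s, matrixNorm n (X j) := by
  classical
  induction s using Finset.induction_on with
  | empty => simp [matrixNorm_zero]
  | insert a s ha ih =>
    rw [Finset.sum_insert ha, Finset.sum_insert ha]
    exact (matrixNorm_add_le _ _).trans (by gcongr)

lemma matrixNorm_star_mul_self (X : Matrix (Fin n) (Fin n) A) :
    matrixNorm n (star X * X) = matrixNorm n X ^ 2 := by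
  let : PartialOrder A := CStarAlgebra.spectralOrder A
  have : StarOrderedRing A := CStarAlgebra.spectralOrderedRing A
  rw [sq]
  exact CStarRing.norm_star_mul_self (x := CStarMatrix.ofMatrix X)

lemma norm_entry_le_matrixNorm (X : Matrix (Fin n) (Fin n) A) (k l : Fin n) :
    ‖X k l‖ ≤ matrixNorm n X := by
  let : PartialOrder A := CStarAlgebra.spectralOrder A
  have : StarOrderedRing A := CStarAlgebra.spectralOrderedRing A
  exact CStarMatrix.norm_entry_le_norm (M := CStarMatrix.ofMatrix X)

lemma matrixNorm_single_le (k l : Fin n) (a : A) :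
    matrixNorm n (Matrix.single k l a) ≤ ‖a‖ := by
  let : PartialOrder A := CStarAlgebra.spectralOrder A
  have : StarOrderedRing A := CStarAlgebra.spectralOrderedRing A
  -- The diagonal corner is a ⋆-homomorphism, hence contractive.
  have hdiag : ∀ b : A, matrixNorm n (Matrix.single l l b) ≤ ‖b‖ := by
    intro b
    let φ : A →⋆ₙₐ[ℂ] CStarMatrix (Fin n) (Fin n) A :=
      { toFun := fun b => CStarMatrix.ofMatrix (Matrix.single l l b)
        map_smul' := fun c x => congrArg _ (Matrix.smul_single c l l x).symm
        map_zero' := congrArg CStarMatrix.ofMatrix (Matrix.single_zero l l)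
        map_add' := fun x y => congrArg CStarMatrix.ofMatrix (Matrix.single_add l l x y)
        map_mul' := fun x y =>
          congrArg CStarMatrix.ofMatrix (Matrix.single_mul_single_same (i := l) (j := l) (k := l) x y).symm
        map_star' := fun x =>
          congrArg CStarMatrix.ofMatrix (Matrix.conjTranspose_single l l x).symm }
    exact NonUnitalStarAlgHom.norm_apply_le φ b
  have h := matrixNorm_star_mul_self (Matrix.single k l a)
  rw [Matrix.star_eq_conjTranspose, Matrix.conjTranspose_single,
    Matrix.single_mul_single_same] at h
  have h2 := hdiag (star a * a)
  rw [h, CStarRing.norm_star_mul_self, ← sq] at h2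
  exact le_of_sq_le_sq h2 (norm_nonneg a)

lemma matrixNorm_le_sum (X : Matrix (Fin n) (Fin n) A) :
    matrixNorm n X ≤ ∑ k, ∑ l, ‖X k l‖ := by
  conv_lhs => rw [Matrix.matrix_eq_sum_single X]
  refine (matrixNorm_sum_le _ _).trans (Finset.sum_le_sum fun k _ => ?_)
  exact (matrixNorm_sum_le _ _).trans (Finset.sum_le_sum fun l _ => matrixNorm_single_le k l _)

end MatrixNorm

section Amplification

/-- The matrix units, as operators on `ℂⁿ`. -/
noncomputable def matrixUnit {n : ℕ} (k l : Fin n) :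
    EuclideanSpace ℂ (Fin n) →L[ℂ] EuclideanSpace ℂ (Fin n) :=
  InnerProductSpace.rankOne ℂ (EuclideanSpace.basisFun (Fin n) ℂ k)
    (EuclideanSpace.basisFun (Fin n) ℂ l)

lemma matrixUnit_apply {n : ℕ} (k l : Fin n) (x : EuclideanSpace ℂ (Fin n)) :
    matrixUnit k l x = x l • EuclideanSpace.basisFun (Fin n) ℂ k := by
  rw [matrixUnit, InnerProductSpace.rankOne_apply, EuclideanSpace.basisFun_inner]

lemma matrixUnit_mul {n : ℕ} (k l k' l' : Fin n) :
    matrixUnit k l * matrixUnit k' l' = if l = k' then matrixUnit k l' else 0 := by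
  have h := InnerProductSpace.rankOne_comp_rankOne (𝕜 := ℂ) (EuclideanSpace.basisFun (Fin n) ℂ k)
    (EuclideanSpace.basisFun (Fin n) ℂ l) (EuclideanSpace.basisFun (Fin n) ℂ k')
    (EuclideanSpace.basisFun (Fin n) ℂ l')
  rw [orthonormal_iff_ite.1 (EuclideanSpace.basisFun (Fin n) ℂ).orthonormal] at h
  rw [matrixUnit, matrixUnit, ContinuousLinearMap.mul_def, h]
  split_ifs <;> simp [matrixUnit]

lemma star_matrixUnit {n : ℕ} (k l : Fin n) : star (matrixUnit k l) = matrixUnit l k := by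
  rw [ContinuousLinearMap.star_eq_adjoint, matrixUnit, InnerProductSpace.adjoint_rankOne,
    matrixUnit]

lemma eq_sum_matrixUnit {n : ℕ} (T : EuclideanSpace ℂ (Fin n) →L[ℂ] EuclideanSpace ℂ (Fin n)) :
    T = ∑ k, ∑ l, inner ℂ (EuclideanSpace.basisFun (Fin n) ℂ k)
      (T (EuclideanSpace.basisFun (Fin n) ℂ l)) • matrixUnit k l := by
  refine ContinuousLinearMap.coe_injective
    ((EuclideanSpace.basisFun (Fin n) ℂ).toBasis.ext fun m => ?_)
  conv_lhs =>
    rw [ContinuousLinearMap.coe_coe, OrthonormalBasis.coe_toBasis,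
      ← (EuclideanSpace.basisFun (Fin n) ℂ).sum_repr' (T _)]
  simp [matrixUnit_apply]

variable {A : Type*} [NonUnitalCStarAlgebra A] {n : ℕ}

section UnitTensor

variable {B : Type*} [NonUnitalCStarAlgebra B]

/-- The element `∑ X k l ⊗ u k l` of `A ⊗ B` given by a matrix `X` over `A` and a family `u` in
`B`, typically a system of matrix units. -/
noncomputable def unitTensor (u : Fin n → Fin n → B) (X : Matrix (Fin n) (Fin n) A) : A ⊗[ℂ] B :=
  ∑ k, ∑ l, X k l ⊗ₜ[ℂ] u k l

lemma unitTensor_star {u : Fin n → Fin n → B} (hu : ∀ k l, star (u k l) = u l k)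
    (X : Matrix (Fin n) (Fin n) A) : unitTensor u (star X) = star (unitTensor u X) := by
  simp only [unitTensor, star_sum, TensorProduct.star_tmul, hu, Matrix.star_apply]
  exact Finset.sum_comm

lemma unitTensor_mul {u : Fin n → Fin n → B}
    (hu : ∀ k l k' l', u k l * u k' l' = if l = k' then u k l' else 0)
    (X Y : Matrix (Fin n) (Fin n) A) :
    unitTensor u (X * Y) = unitTensor u X * unitTensor u Y := by
  have h : ∀ k l, (X k l ⊗ₜ[ℂ] u k l) * unitTensor u Y = ∑ m, (X k l * Y l m) ⊗ₜ[ℂ] u k m := by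
    intro k l
    rw [unitTensor, Finset.mul_sum, Finset.sum_eq_single l]
    · simp [Finset.mul_sum, hu]
    · intro j _ hj
      simp [Finset.mul_sum, hu, hj.symm]
    · simp
  conv_rhs => rw [unitTensor]
  simp only [Finset.sum_mul, h]
  rw [unitTensor]
  refine Finset.sum_congr rfl fun k _ => ?_
  simp only [Matrix.mul_apply, TensorProduct.sum_tmul]
  exact Finset.sum_comm

end UnitTensor

variable {H : Type*} [NormedAddCommGroup H] [InnerProductSpace ℂ H] [CompleteSpace H]

/-- The amplification `π ⊗ Id` of a representation to matrices, acting on `H ⊗ ℂⁿ`. -/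
noncomputable def amplify (π : A →⋆ₙₐ[ℂ] (H →L[ℂ] H)) (X : Matrix (Fin n) (Fin n) A) :
    (H ⊗[ℂ] EuclideanSpace ℂ (Fin n)) →L[ℂ] (H ⊗[ℂ] EuclideanSpace ℂ (Fin n)) :=
  tensorRep π (NonUnitalStarAlgHom.id ℂ _) (unitTensor matrixUnit X)

lemma amplify_apply_tmul (π : A →⋆ₙₐ[ℂ] (H →L[ℂ] H)) (X : Matrix (Fin n) (Fin n) A) (h : H)
    (x : EuclideanSpace ℂ (Fin n)) :
    amplify π X (h ⊗ₜ[ℂ] x) = ∑ k, ∑ l, π (X k l) h ⊗ₜ[ℂ] matrixUnit k l x := by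
  simp only [amplify, unitTensor, map_sum, sum_apply, tensorRep_tmul_apply_tmul]
  rfl

lemma norm_amplify_star_mul_self (π : A →⋆ₙₐ[ℂ] (H →L[ℂ] H)) (X : Matrix (Fin n) (Fin n) A) :
    ‖amplify π (star X * X)‖ = ‖amplify π X‖ ^ 2 := by
  rw [amplify, unitTensor_mul matrixUnit_mul, unitTensor_star star_matrixUnit,
    norm_tensorRep_star_mul_self, amplify]

/-- Scalar compressions of an amplification: `h ↦ ⟨α, amplify π X (h ⊗ β)⟩`. -/
lemma norm_rep_sum_le_amplify (π : A →⋆ₙₐ[ℂ] (H →L[ℂ] H)) (X : Matrix (Fin n) (Fin n) A)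
    (α β : EuclideanSpace ℂ (Fin n)) :
    ‖π (∑ k, ∑ l, (starRingEnd ℂ (α k) * β l) • X k l)‖ ≤ ‖amplify π X‖ * ‖α‖ * ‖β‖ := by
  refine ContinuousLinearMap.opNorm_le_bound _ (by positivity) fun h => ?_
  have h1 : TensorProduct.mapL (ContinuousLinearMap.id ℂ H) (innerSL ℂ α)
      (amplify π X (h ⊗ₜ[ℂ] β)) =
      π (∑ k, ∑ l, (starRingEnd ℂ (α k) * β l) • X k l) h ⊗ₜ[ℂ] (1 : ℂ) := by
    simp only [amplify_apply_tmul, map_sum, sum_apply, TensorProduct.sum_tmul,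
      TensorProduct.mapL_apply]
    refine Finset.sum_congr rfl fun k _ => Finset.sum_congr rfl fun l _ => ?_
    rw [TensorProduct.map_tmul, map_smul, smul_apply, TensorProduct.smul_tmul]
    simp only [ContinuousLinearMap.coe_id, LinearMap.id_apply, matrixUnit_apply,
      ContinuousLinearMap.coe_coe, map_smul, innerSL_apply_apply, smul_eq_mul, mul_one]
    rw [← inner_conj_symm, EuclideanSpace.basisFun_inner, mul_comm]
  have h5 : ∀ h' : H, ‖h'‖ = ‖h' ⊗ₜ[ℂ] (1 : ℂ)‖ := fun h' => by
    rw [TensorProduct.norm_tmul, norm_one, mul_one]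
  rw [h5, ← h1]
  have h2 := TensorProduct.norm_mapL_le (ContinuousLinearMap.id ℂ H) (innerSL ℂ α)
  rw [innerSL_apply_norm] at h2
  have h3 : ‖TensorProduct.mapL (ContinuousLinearMap.id ℂ H) (innerSL ℂ α)‖ ≤ ‖α‖ :=
    h2.trans (mul_le_of_le_one_left (norm_nonneg _) ContinuousLinearMap.norm_id_le)
  have h4 := (amplify π X).le_opNorm (h ⊗ₜ[ℂ] β)
  rw [TensorProduct.norm_tmul] at h4
  calc _ ≤ ‖TensorProduct.mapL (ContinuousLinearMap.id ℂ H) (innerSL ℂ α)‖ *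
        ‖amplify π X (h ⊗ₜ[ℂ] β)‖ := ContinuousLinearMap.le_opNorm _ _
    _ ≤ ‖α‖ * (‖amplify π X‖ * (‖h‖ * ‖β‖)) := by gcongr
    _ = _ := by ring

lemma norm_rep_entry_le_amplify (π : A →⋆ₙₐ[ℂ] (H →L[ℂ] H)) (X : Matrix (Fin n) (Fin n) A)
    (k l : Fin n) : ‖π (X k l)‖ ≤ ‖amplify π X‖ := by
  have h := norm_rep_sum_le_amplify π X (EuclideanSpace.basisFun (Fin n) ℂ k)
    (EuclideanSpace.basisFun (Fin n) ℂ l)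
  rw [OrthonormalBasis.norm_eq_one, OrthonormalBasis.norm_eq_one, mul_one, mul_one] at h
  convert h using 3
  rw [Finset.sum_eq_single k, Finset.sum_eq_single l]
  · simp
  · intro j _ hj; simp [hj]
  · simp
  · intro j _ hj; simp [hj]
  · simp

lemma amplify_map {A' : Type*} [NonUnitalCStarAlgebra A'] (π : A →⋆ₙₐ[ℂ] (H →L[ℂ] H))
    (q : A' →⋆ₙₐ[ℂ] A) (X : Matrix (Fin n) (Fin n) A') :
    amplify π (X.map q) = amplify (π.comp q) X := by
  simp only [amplify, unitTensor, map_sum, tensorRep_tmul]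
  rfl

/-- Amplifications are contractive for the C⋆-norm of `M_n(A)`. -/
lemma norm_amplify_le (π : A →⋆ₙₐ[ℂ] (H →L[ℂ] H)) (X : Matrix (Fin n) (Fin n) A) :
    ‖amplify π X‖ ≤ matrixNorm n X := by
  refine le_of_le_const_mul_of_star_mul_self (p := fun X => ‖amplify π X‖)
    (p' := fun X => matrixNorm n X)
    matrixNorm_nonneg (norm_amplify_star_mul_self π) matrixNorm_star_mul_self
    (K := ∑ k : Fin n, ∑ l : Fin n, ‖matrixUnit k l‖) (fun X => ?_) X
  rw [Finset.sum_mul]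
  simp only [Finset.sum_mul]
  change repSeminorm π (NonUnitalStarAlgHom.id ℂ _) (unitTensor matrixUnit X) ≤ _
  rw [unitTensor]
  refine (seminorm_sum_le _ _ _).trans (Finset.sum_le_sum fun k _ =>
    (seminorm_sum_le _ _ _).trans (Finset.sum_le_sum fun l _ => ?_))
  rw [repSeminorm_apply, tensorRep_tmul]
  refine (TensorProduct.norm_mapL_le _ _).trans ?_
  rw [mul_comm]
  gcongr
  · exact le_rfl
  · exact (NonUnitalStarAlgHom.norm_apply_le π _).trans (norm_entry_le_matrixNorm X k l)

lemma norm_amplify_eq {π : A →⋆ₙₐ[ℂ] (H →L[ℂ] H)} (hπ : Function.Injective π)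
    (X : Matrix (Fin n) (Fin n) A) : ‖amplify π X‖ = matrixNorm n X := by
  refine le_antisymm (norm_amplify_le π X) ?_
  refine le_of_le_const_mul_of_star_mul_self (p := fun X => matrixNorm n X)
    (p' := fun X => ‖amplify π X‖)
    (fun X => norm_nonneg (amplify π X)) matrixNorm_star_mul_self (norm_amplify_star_mul_self π)
    (K := n * n) (fun X => ?_) X
  refine (matrixNorm_le_sum X).trans ?_
  calc ∑ k, ∑ l, ‖X k l‖ ≤ ∑ k : Fin n, ∑ l : Fin n, ‖amplify π X‖ := by
        gcongr with k _ l _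
        rw [← NonUnitalStarAlgHom.norm_map π hπ]
        exact norm_rep_entry_le_amplify π X k l
    _ = n * n * ‖amplify π X‖ := by simp [mul_assoc]

lemma norm_sum_le_matrixNorm (X : Matrix (Fin n) (Fin n) A) (α β : EuclideanSpace ℂ (Fin n)) :
    ‖∑ k, ∑ l, (starRingEnd ℂ (α k) * β l) • X k l‖ ≤ matrixNorm n X * ‖α‖ * ‖β‖ := by
  obtain ⟨H, _, _, _, π, hπ⟩ := exists_faithful_representation A
  rw [← NonUnitalStarAlgHom.norm_map π hπ, ← norm_amplify_eq hπ]
  exact norm_rep_sum_le_amplify π X α β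

lemma matrixNorm_smul_const_le (c : Matrix (Fin n) (Fin n) ℂ) (a : A) :
    matrixNorm n (Matrix.of fun k l => c k l • a) ≤ ‖∑ k, ∑ l, c k l • matrixUnit k l‖ * ‖a‖ := by
  obtain ⟨H, _, _, _, π, hπ⟩ := exists_faithful_representation A
  rw [← norm_amplify_eq hπ, mul_comm, ← NonUnitalStarAlgHom.norm_map π hπ a]
  have : amplify π (Matrix.of fun k l => c k l • a) =
      TensorProduct.mapL (π a) (∑ k, ∑ l, c k l • matrixUnit k l) := by
    rw [amplify, unitTensor]
    simp only [Matrix.of_apply, TensorProduct.smul_tmul, ← TensorProduct.tmul_sum, tensorRep_tmul]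
    rfl
  rw [this]
  exact TensorProduct.norm_mapL_le _ _

/-- A bounded functional is completely bounded with the same norm. -/
lemma norm_functional_matrix_le {Z : Submodule ℂ A} (f : Z →L[ℂ] ℂ)
    (X : Matrix (Fin n) (Fin n) Z) :
    ‖∑ k, ∑ l, f (X k l) • matrixUnit k l‖ ≤ ‖f‖ * matrixNorm n (X.map fun z => (z : A)) := by
  refine ContinuousLinearMap.opNorm_le_of_re_inner_le
    (mul_nonneg (norm_nonneg f) (matrixNorm_nonneg _)) fun β α hβ hα => ?_
  refine (Complex.re_le_norm _).trans ?_
  have h1 : inner ℂ ((∑ k, ∑ l, f (X k l) • matrixUnit k l) β) α =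
      starRingEnd ℂ (f (∑ k, ∑ l, (starRingEnd ℂ (α k) * β l) • X k l)) := by
    simp only [sum_apply, smul_apply, matrixUnit_apply, sum_inner, inner_smul_left, map_sum,
      map_smul, smul_eq_mul, map_mul, EuclideanSpace.basisFun_inner, RingHomCompTriple.comp_apply,
      RingHom.id_apply]
    refine Finset.sum_congr rfl fun k _ => Finset.sum_congr rfl fun l _ => ?_
    ring
  rw [h1, RCLike.norm_conj]
  refine (f.le_opNorm _).trans ?_
  gcongr
  have h2 := norm_sum_le_matrixNorm (X.map fun z => (z : A)) α β
  rw [hα, hβ, mul_one, mul_one] at h2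
  change ‖((∑ k, ∑ l, (starRingEnd ℂ (α k) * β l) • X k l : Z) : A)‖ ≤ _
  simpa using h2

/-- On a finite-dimensional space the completely bounded norm is controlled by the norm. -/
lemma exists_matrixNorm_map_le (Z : Submodule ℂ A) [FiniteDimensional ℂ Z] :
    ∃ K : ℝ, 0 < K ∧ ∀ {A' : Type v} [NonUnitalCStarAlgebra A'] (w : Z →ₗ[ℂ] A') (η : ℝ),
      (∀ z, ‖w z‖ ≤ η * ‖z‖) → ∀ (n : ℕ) (X : Matrix (Fin n) (Fin n) Z),
        matrixNorm n (X.map w) ≤ K * η * matrixNorm n (X.map fun z => (z : A)) := by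
  let b := Module.finBasis ℂ Z
  let f : Fin (Module.finrank ℂ Z) → Z →L[ℂ] ℂ := fun j => (b.coord j).toContinuousLinearMap
  refine ⟨1 + ∑ j, ‖b j‖ * ‖f j‖, by positivity, fun {A'} _ w η hw n X => ?_⟩
  have h0 : ∀ z, 0 ≤ η * ‖z‖ := fun z => (norm_nonneg _).trans (hw z)
  have hX : X.map w = ∑ j, Matrix.of fun k l => f j (X k l) • w (b j) := by
    ext k l
    rw [Matrix.map_apply, Matrix.sum_apply]
    simp only [Matrix.of_apply, ← map_smul, ← map_sum]
    exact congrArg w (b.sum_repr (X k l)).symm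
  rw [hX]
  have h1 : ∀ j, matrixNorm n (Matrix.of fun k l => f j (X k l) • w (b j)) ≤
      (‖b j‖ * ‖f j‖) * (η * matrixNorm n (X.map fun z => (z : A))) := fun j => by
    refine (matrixNorm_smul_const_le (Matrix.of fun k l => f j (X k l)) (w (b j))).trans ?_
    calc _ ≤ (‖f j‖ * matrixNorm n (X.map fun z => (z : A))) * (η * ‖b j‖) := by
          gcongr
          · exact mul_nonneg (norm_nonneg (f j)) (matrixNorm_nonneg _)
          · exact norm_functional_matrix_le (f j) X
          · exact hw _
      _ = _ := by ring
  refine (matrixNorm_sum_le _ _).trans ((Finset.sum_le_sum fun j _ => h1 j).trans ?_)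
  rw [← Finset.sum_mul, mul_assoc]
  by_cases hZ : ∃ z : Z, z ≠ 0
  · obtain ⟨z, hz⟩ := hZ
    have hη : 0 ≤ η := nonneg_of_mul_nonneg_left (h0 z) (norm_pos_iff.2 hz)
    have := mul_nonneg hη (matrixNorm_nonneg (X.map fun z => (z : A)))
    nlinarith
  · push Not at hZ
    have : X.map (fun z => (z : A)) = 0 := by
      ext k l
      simp [hZ (X k l)]
    rw [this, matrixNorm_zero]
    simp

/-- An injective ⋆-homomorphism is completely isometric. -/
lemma matrixNorm_map_eq {A' : Type*} [NonUnitalCStarAlgebra A'] {i : A →⋆ₙₐ[ℂ] A'}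
    (hi : Function.Injective i) (X : Matrix (Fin n) (Fin n) A) :
    matrixNorm n (X.map i) = matrixNorm n X := by
  obtain ⟨H, _, _, _, π, hπ⟩ := exists_faithful_representation A'
  rw [← norm_amplify_eq hπ, ← norm_amplify_eq (π := π.comp i) (hπ.comp hi),
    amplify_map]

/-- ⋆-homomorphisms are completely contractive. -/
lemma matrixNorm_map_le {A' : Type*} [NonUnitalCStarAlgebra A'] (q : A →⋆ₙₐ[ℂ] A')
    (X : Matrix (Fin n) (Fin n) A) :
    matrixNorm n (X.map q) ≤ matrixNorm n X := by
  obtain ⟨H, _, _, _, π, hπ⟩ := exists_faithful_representation A'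
  rw [← norm_amplify_eq hπ, amplify_map]
  exact norm_amplify_le (π.comp q) X

end Amplification

/-! ### The minimal norm through compressions -/

section Compression

lemma norm_mapL_id_isometry {H K L : Type*} [NormedAddCommGroup H] [InnerProductSpace ℂ H]
    [NormedAddCommGroup K] [InnerProductSpace ℂ K] [NormedAddCommGroup L] [InnerProductSpace ℂ L]
    (V : L →ₗᵢ[ℂ] K) (x : H ⊗[ℂ] L) :
    ‖TensorProduct.mapL (ContinuousLinearMap.id ℂ H) V.toContinuousLinearMap x‖ = ‖x‖ := by
  rw [TensorProduct.mapL_apply]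
  exact TensorProduct.norm_map (LinearIsometry.id (R := ℂ) (E := H)) V x

variable {A B : Type*} [NonUnitalCStarAlgebra A] [NonUnitalCStarAlgebra B] {n : ℕ}
  {H K : Type*} [NormedAddCommGroup H] [InnerProductSpace ℂ H] [CompleteSpace H]
  [NormedAddCommGroup K] [InnerProductSpace ℂ K] [CompleteSpace K]

/-- The compression of `t ∈ A ⊗ B` to a matrix over `A`, for a representation `σ` of `B` on `K` and
an isometry `V : ℂⁿ → K`: the slice maps `Id ⊗ ω` of the matrix coefficients `ω` of `V⋆ σ V`. -/
noncomputable def compress (σ : B →⋆ₙₐ[ℂ] (K →L[ℂ] K)) (V : EuclideanSpace ℂ (Fin n) →ₗᵢ[ℂ] K) :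
    A ⊗[ℂ] B →ₗ[ℂ] Matrix (Fin n) (Fin n) A :=
  TensorProduct.lift <| LinearMap.mk₂ ℂ
    (fun a b => Matrix.of fun k l => inner ℂ (V (EuclideanSpace.basisFun (Fin n) ℂ k))
      (σ b (V (EuclideanSpace.basisFun (Fin n) ℂ l))) • a)
    (fun a a' b => by ext k l; simp)
    (fun c a b => by ext k l; simp [smul_comm c])
    (fun a b b' => by ext k l; simp [add_smul])
    (fun c a b => by ext k l; simp [mul_smul])

lemma compress_tmul (σ : B →⋆ₙₐ[ℂ] (K →L[ℂ] K)) (V : EuclideanSpace ℂ (Fin n) →ₗᵢ[ℂ] K) (a : A)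
    (b : B) (k l : Fin n) : compress σ V (a ⊗ₜ[ℂ] b) k l =
      inner ℂ (V (EuclideanSpace.basisFun (Fin n) ℂ k))
        (σ b (V (EuclideanSpace.basisFun (Fin n) ℂ l))) • a := rfl

lemma compress_map {A' : Type*} [NonUnitalCStarAlgebra A'] (σ : B →⋆ₙₐ[ℂ] (K →L[ℂ] K))
    (V : EuclideanSpace ℂ (Fin n) →ₗᵢ[ℂ] K) (φ : A →ₗ[ℂ] A') (t : A ⊗[ℂ] B) :
    compress σ V (TensorProduct.map φ LinearMap.id t) = (compress σ V t).map φ := by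
  induction t using TensorProduct.induction_on with
  | zero => ext; simp
  | add s t hs ht => rw [map_add, map_add, hs, ht, map_add]; ext; simp
  | tmul a b =>
    ext k l
    rw [TensorProduct.map_tmul, Matrix.map_apply, compress_tmul, compress_tmul, map_smul]
    rfl

/-- A compression is `(1 ⊗ V⋆) (π ⊗ σ)(t) (1 ⊗ V)`. -/
lemma amplify_compress (π : A →⋆ₙₐ[ℂ] (H →L[ℂ] H)) (σ : B →⋆ₙₐ[ℂ] (K →L[ℂ] K))
    (V : EuclideanSpace ℂ (Fin n) →ₗᵢ[ℂ] K) (t : A ⊗[ℂ] B) :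
    amplify π (compress σ V t) =
      (TensorProduct.mapL (ContinuousLinearMap.id ℂ H)
        (ContinuousLinearMap.adjoint V.toContinuousLinearMap)).comp ((tensorRep π σ t).comp
          (TensorProduct.mapL (ContinuousLinearMap.id ℂ H) V.toContinuousLinearMap)) := by
  refine clm_tensor_ext fun h x => ?_
  induction t using TensorProduct.induction_on with
  | zero => simp [amplify, unitTensor]
  | add s t hs ht =>
    simp only [amplify_apply_tmul, map_add, Matrix.add_apply, add_apply, TensorProduct.add_tmul,
      Finset.sum_add_distrib, ContinuousLinearMap.comp_apply] at hs ht ⊢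
    rw [hs, ht]
  | tmul a b =>
    rw [amplify_apply_tmul]
    have hT := eq_sum_matrixUnit ((ContinuousLinearMap.adjoint V.toContinuousLinearMap).comp
      ((σ b).comp V.toContinuousLinearMap))
    have hx := congrArg (fun T => π a h ⊗ₜ[ℂ] T x) hT
    simp only [ContinuousLinearMap.comp_apply, sum_apply, smul_apply,
      ContinuousLinearMap.adjoint_inner_right, TensorProduct.tmul_sum] at hx
    simp only [compress_tmul, map_smul, smul_apply, ContinuousLinearMap.comp_apply,
      TensorProduct.mapL_apply, TensorProduct.map_tmul, ContinuousLinearMap.coe_coe,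
      tensorRep_tmul_apply_tmul, ContinuousLinearMap.coe_id, LinearMap.id_apply,
      TensorProduct.smul_tmul]
    exact hx.symm

lemma norm_amplify_compress_le (π : A →⋆ₙₐ[ℂ] (H →L[ℂ] H)) (σ : B →⋆ₙₐ[ℂ] (K →L[ℂ] K))
    (V : EuclideanSpace ℂ (Fin n) →ₗᵢ[ℂ] K) (t : A ⊗[ℂ] B) :
    ‖amplify π (compress σ V t)‖ ≤ ‖tensorRep π σ t‖ := by
  rw [amplify_compress]
  refine ContinuousLinearMap.opNorm_le_bound _ (ContinuousLinearMap.opNorm_nonneg _) fun x => ?_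
  have h1 := TensorProduct.norm_mapL_le (ContinuousLinearMap.id ℂ H)
    (ContinuousLinearMap.adjoint V.toContinuousLinearMap)
  have h2 : ‖ContinuousLinearMap.adjoint V.toContinuousLinearMap‖ ≤ 1 := by
    rw [LinearIsometryEquiv.norm_map]
    exact V.norm_toContinuousLinearMap_le
  have h3 := h1.trans (mul_le_one₀ ContinuousLinearMap.norm_id_le (norm_nonneg _) h2)
  rw [ContinuousLinearMap.comp_apply, ContinuousLinearMap.comp_apply]
  refine (ContinuousLinearMap.le_opNorm _ _).trans ((mul_le_of_le_one_left (norm_nonneg _) h3).trans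
    ((ContinuousLinearMap.le_opNorm _ _).trans ?_))
  rw [norm_mapL_id_isometry]

/-- The norm of `(π ⊗ σ)(t)` is the supremum of the norms of its finite compressions. -/
lemma norm_tensorRep_le_of_compress (π : A →⋆ₙₐ[ℂ] (H →L[ℂ] H)) (σ : B →⋆ₙₐ[ℂ] (K →L[ℂ] K))
    (t : A ⊗[ℂ] B) {c : ℝ} (hc : 0 ≤ c)
    (h : ∀ (n : ℕ) (V : EuclideanSpace ℂ (Fin n) →ₗᵢ[ℂ] K), ‖amplify π (compress σ V t)‖ ≤ c) :
    ‖tensorRep π σ t‖ ≤ c := by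
  refine ContinuousLinearMap.opNorm_le_bound _ hc fun x => ?_
  obtain ⟨F, hF, hx⟩ := TensorProduct.exists_finite_submodule_right_of_setFinite
    {x, tensorRep π σ t x} (Set.toFinite _)
  let b := stdOrthonormalBasis ℂ F
  let V : EuclideanSpace ℂ (Fin (Module.finrank ℂ F)) →ₗᵢ[ℂ] K :=
    F.subtypeₗᵢ.comp b.repr.symm.toLinearIsometry
  have hV : ∀ z ∈ (LinearMap.lTensor H F.subtype).range, ∃ z',
      TensorProduct.mapL (ContinuousLinearMap.id ℂ H) V.toContinuousLinearMap z' = z := by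
    rintro _ ⟨y, rfl⟩
    refine ⟨TensorProduct.map LinearMap.id (b.repr : F →ₗ[ℂ] _) y, ?_⟩
    induction y using TensorProduct.induction_on with
    | zero => simp
    | add y y' hy hy' => simp only [map_add, hy, hy']
    | tmul h k => simp [V]
  obtain ⟨x', hx'⟩ := hV x (hx (by simp))
  obtain ⟨y', hy'⟩ := hV _ (hx (show tensorRep π σ t x ∈ _ by simp))
  have hVV : ∀ z, TensorProduct.mapL (ContinuousLinearMap.id ℂ H)
      (ContinuousLinearMap.adjoint V.toContinuousLinearMap)
      (TensorProduct.mapL (ContinuousLinearMap.id ℂ H) V.toContinuousLinearMap z) = z := by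
    intro z
    have h1 := TensorProduct.mapL_comp (ContinuousLinearMap.id ℂ H) (ContinuousLinearMap.id ℂ H)
      (ContinuousLinearMap.adjoint V.toContinuousLinearMap) V.toContinuousLinearMap
    rw [LinearIsometry.adjoint_comp_self, ContinuousLinearMap.comp_id] at h1
    rw [← ContinuousLinearMap.comp_apply, ← h1]
    exact congrArg (fun T => T z) (TensorProduct.mapL_id_id (𝕜 := ℂ) (E := H)
      (G := EuclideanSpace ℂ (Fin (Module.finrank ℂ F))))
  have hy : y' = amplify π (compress σ V t) x' := by
    rw [amplify_compress, ContinuousLinearMap.comp_apply, ContinuousLinearMap.comp_apply, hx', ← hy',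
      hVV]
  rw [← hy', ← hx', norm_mapL_id_isometry, norm_mapL_id_isometry, hy]
  exact ContinuousLinearMap.le_of_opNorm_le _ (h _ V) x'

/-- Faithful representations of the left factor compute the spatial norm. -/
lemma norm_tensorRep_le_of_injective_left {H₀ : Type*} [NormedAddCommGroup H₀]
    [InnerProductSpace ℂ H₀] [CompleteSpace H₀] {π₀ : A →⋆ₙₐ[ℂ] (H₀ →L[ℂ] H₀)}
    (h₀ : Function.Injective π₀) (π : A →⋆ₙₐ[ℂ] (H →L[ℂ] H)) (σ : B →⋆ₙₐ[ℂ] (K →L[ℂ] K))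
    (t : A ⊗[ℂ] B) : ‖tensorRep π σ t‖ ≤ ‖tensorRep π₀ σ t‖ := by
  refine norm_tensorRep_le_of_compress π σ t (ContinuousLinearMap.opNorm_nonneg _) fun n V => ?_
  refine (norm_amplify_le π _).trans ?_
  rw [← norm_amplify_eq h₀]
  exact norm_amplify_compress_le π₀ σ V t

lemma norm_tensorRep_comm_le (π : A →⋆ₙₐ[ℂ] (H →L[ℂ] H)) (σ : B →⋆ₙₐ[ℂ] (K →L[ℂ] K))
    (t : A ⊗[ℂ] B) :
    ‖tensorRep σ π (TensorProduct.comm ℂ A B t)‖ ≤ ‖tensorRep π σ t‖ := by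
  refine ContinuousLinearMap.opNorm_le_bound _ (ContinuousLinearMap.opNorm_nonneg _) fun x => ?_
  have h1 : tensorRep σ π (TensorProduct.comm ℂ A B t) x =
      TensorProduct.comm ℂ H K (tensorRep π σ t (TensorProduct.comm ℂ K H x)) := by
    induction t using TensorProduct.induction_on with
    | zero => simp
    | add s t hs ht => simp only [map_add, add_apply, hs, ht]
    | tmul a b =>
      induction x using TensorProduct.induction_on with
      | zero => simp
      | add x y hx hy => simp only [map_add, hx, hy]
      | tmul k h => simp
  rw [h1, TensorProduct.norm_comm, ← TensorProduct.norm_comm (𝕜 := ℂ) x]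
  exact ContinuousLinearMap.le_opNorm _ _

/-- Faithful representations of the right factor compute the spatial norm. -/
lemma norm_tensorRep_le_of_injective_right {K₀ : Type*} [NormedAddCommGroup K₀]
    [InnerProductSpace ℂ K₀] [CompleteSpace K₀] {σ₀ : B →⋆ₙₐ[ℂ] (K₀ →L[ℂ] K₀)}
    (h₀ : Function.Injective σ₀) (π : A →⋆ₙₐ[ℂ] (H →L[ℂ] H)) (σ : B →⋆ₙₐ[ℂ] (K →L[ℂ] K))
    (t : A ⊗[ℂ] B) : ‖tensorRep π σ t‖ ≤ ‖tensorRep π σ₀ t‖ := by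
  have h1 := norm_tensorRep_comm_le σ π (TensorProduct.comm ℂ A B t)
  rw [TensorProduct.comm_comm] at h1
  exact h1.trans ((norm_tensorRep_le_of_injective_left h₀ σ π _).trans
    (norm_tensorRep_comm_le π σ₀ t))

end Compression

section MinimalNorm

variable {A : Type u} {A' : Type v} {D : Type w} [NonUnitalCStarAlgebra A]
  [NonUnitalCStarAlgebra A'] [NonUnitalCStarAlgebra D]

/-- Minimal norms can be compared through the compressions. -/
lemma minSeminorm_le_mul_of_compress {t : A ⊗[ℂ] D} {t' : A' ⊗[ℂ] D} {c : ℝ} (hc : 0 ≤ c)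
    (h : ∀ (K : Type w) [NormedAddCommGroup K] [InnerProductSpace ℂ K] [CompleteSpace K]
      (σ : D →⋆ₙₐ[ℂ] (K →L[ℂ] K)) (n : ℕ) (V : EuclideanSpace ℂ (Fin n) →ₗᵢ[ℂ] K),
      matrixNorm n (compress σ V t) ≤ c * matrixNorm n (compress σ V t')) :
    minSeminorm A D t ≤ c * minSeminorm A' D t' := by
  obtain ⟨H₀, _, _, _, π₀, h₀⟩ := exists_faithful_representation A'
  refine minSeminorm_le (mul_nonneg hc (apply_nonneg _ _)) fun H _ _ _ K _ _ _ π σ => ?_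
  refine norm_tensorRep_le_of_compress π σ t (mul_nonneg hc (apply_nonneg _ _)) fun n V => ?_
  refine (norm_amplify_le π _).trans ((h K σ n V).trans ?_)
  gcongr
  rw [← norm_amplify_eq h₀]
  exact (norm_amplify_compress_le π₀ σ V t').trans (norm_tensorRep_le_minSeminorm π₀ σ t')

lemma matrixNorm_compress_le_minSeminorm {K : Type w} [NormedAddCommGroup K]
    [InnerProductSpace ℂ K] [CompleteSpace K] (σ : D →⋆ₙₐ[ℂ] (K →L[ℂ] K)) {n : ℕ}
    (V : EuclideanSpace ℂ (Fin n) →ₗᵢ[ℂ] K) (t : A ⊗[ℂ] D) :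
    matrixNorm n (compress σ V t) ≤ minSeminorm A D t := by
  obtain ⟨H₀, _, _, _, π₀, h₀⟩ := exists_faithful_representation A
  rw [← norm_amplify_eq h₀]
  exact (norm_amplify_compress_le π₀ σ V t).trans (norm_tensorRep_le_minSeminorm π₀ σ t)

/-- The minimal tensor product is injective. -/
lemma minSeminorm_le_tensorId {i : A →⋆ₙₐ[ℂ] A'} (hi : Function.Injective i) (t : A ⊗[ℂ] D) :
    minSeminorm A D t ≤ minSeminorm A' D (tensorId i D t) := by
  have := minSeminorm_le_mul_of_compress (t := t) (t' := tensorId i D t) zero_le_one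
    fun K _ _ _ σ n V => by
      rw [one_mul, tensorId, compress_map]
      exact (matrixNorm_map_eq hi _).ge
  rwa [one_mul] at this

/-- A map that is bounded below on matrices over `E` is bounded below for the minimal norm. -/
lemma minSeminorm_sum_le_of_matrixNorm_le {E : Submodule ℂ A} (φ : A →ₗ[ℂ] A') {c : ℝ}
    (hc : 0 ≤ c)
    (hφ : ∀ (n : ℕ) (X : Matrix (Fin n) (Fin n) A), (∀ k l, X k l ∈ E) →
      matrixNorm n X ≤ c * matrixNorm n (X.map φ))
    {ι : Type*} (s : Finset ι) (x : ι → A) (hx : ∀ j ∈ s, x j ∈ E) (d : ι → D) :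
    minSeminorm A D (∑ j ∈ s, x j ⊗ₜ[ℂ] d j) ≤
      c * minSeminorm A' D (∑ j ∈ s, φ (x j) ⊗ₜ[ℂ] d j) := by
  refine minSeminorm_le_mul_of_compress hc fun K _ _ _ σ n V => ?_
  have h1 : ∑ j ∈ s, φ (x j) ⊗ₜ[ℂ] d j =
      TensorProduct.map φ LinearMap.id (∑ j ∈ s, x j ⊗ₜ[ℂ] d j) := by
    simp [map_sum]
  rw [h1, compress_map]
  refine hφ n _ fun k l => ?_
  rw [map_sum, Matrix.sum_apply]
  refine Submodule.sum_mem _ fun j hj => ?_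
  rw [compress_tmul]
  exact Submodule.smul_mem _ _ (hx j hj)

end MinimalNorm

/-! ### Almost multiplicative maps and the maximal norm -/

section Ultralimit

open Filter Topology

variable {ι : Type*} (U : Ultrafilter ι)

/-- The limit of a real function along an ultrafilter (meaningful for bounded functions). -/
noncomputable def ultraLim (f : ι → ℝ) : ℝ := limUnder (U : Filter ι) f

variable {U}

lemma tendsto_ultraLim {f : ι → ℝ} (hf : ∃ K, ∀ᶠ k in (U : Filter ι), |f k| ≤ K) :
    Tendsto f U (𝓝 (ultraLim U f)) := by
  obtain ⟨K, hK⟩ := hf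
  apply tendsto_nhds_limUnder
  obtain ⟨x, -, hx⟩ := (isCompact_Icc (a := -K) (b := K)).ultrafilter_le_nhds (U.map f)
    (by
      rw [Ultrafilter.coe_map, le_principal_iff, mem_map]
      filter_upwards [hK] with k hk using abs_le.1 hk)
  exact ⟨x, hx⟩

end Ultralimit

section AlmostMorphism

/-- A linear map that is an `ε`-morphism on the subspace `E`. Working with maps defined everywhere
avoids restrictions; no condition is imposed outside `E`. -/
structure AlmostMorphismOn {B A : Type*} [NonUnitalCStarAlgebra B] [NonUnitalCStarAlgebra A]
    (δ : ℝ) (E : Submodule ℂ B) (φ : B →ₗ[ℂ] A) : Prop where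
  norm_le : ∀ x ∈ E, ‖φ x‖ ≤ (1 + δ) * ‖x‖
  mul_approx : ∀ x ∈ E, ∀ y ∈ E, x * y ∈ E → ‖φ (x * y) - φ x * φ y‖ ≤ δ * ‖x‖ * ‖y‖
  map_star : ∀ x ∈ E, star x ∈ E → φ (star x) = star (φ x)

lemma AlmostMorphismOn.mono {B A : Type*} [NonUnitalCStarAlgebra B] [NonUnitalCStarAlgebra A]
    {δ δ' : ℝ} {E E' : Submodule ℂ B} {φ : B →ₗ[ℂ] A} (h : AlmostMorphismOn δ E φ) (hδ : δ ≤ δ')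
    (hE : E' ≤ E) : AlmostMorphismOn δ' E' φ where
  norm_le x hx := (h.norm_le x (hE hx)).trans (by gcongr)
  mul_approx x hx y hy hxy := (h.mul_approx x (hE hx) y (hE hy) (hE hxy)).trans (by gcongr)
  map_star x hx hx' := h.map_star x (hE hx) (hE hx')

open Filter Topology

variable {B : Type u} {D : Type w} [NonUnitalCStarAlgebra B] [NonUnitalCStarAlgebra D]

/-- The limit of maximal norms along an asymptotic morphism is a C⋆-seminorm, hence at most the
maximal norm. -/
lemma eventually_maxSeminorm_map_le {ι : Type*} (U : Ultrafilter ι) {A : ι → Type v}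
    [∀ k, NonUnitalCStarAlgebra (A k)] (φ : ∀ k, B →ₗ[ℂ] A k)
    (hnorm : ∀ x, ∀ᶠ k in (U : Filter ι), ‖φ k x‖ ≤ 2 * ‖x‖)
    (hmul : ∀ x y, Tendsto (fun k => ‖φ k (x * y) - φ k x * φ k y‖) U (𝓝 0))
    (hstar : ∀ x, ∀ᶠ k in (U : Filter ι), φ k (star x) = star (φ k x))
    (t : B ⊗[ℂ] D) {ε : ℝ} (hε : 0 < ε) :
    ∀ᶠ k in (U : Filter ι), maxSeminorm (A k) D (TensorProduct.map (φ k) LinearMap.id t) ≤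
      maxSeminorm B D t + ε := by
  let Φ : ∀ k, B ⊗[ℂ] D →ₗ[ℂ] A k ⊗[ℂ] D := fun k => TensorProduct.map (φ k) LinearMap.id
  let f : B ⊗[ℂ] D → ι → ℝ := fun t k => maxSeminorm (A k) D (Φ k t)
  have hf0 : ∀ t k, 0 ≤ f t k := fun t k => apply_nonneg _ _
  have hbd : ∀ t, ∃ K, ∀ᶠ k in (U : Filter ι), |f t k| ≤ K := by
    intro t
    induction t using TensorProduct.induction_on with
    | zero => exact ⟨0, by simp [f, Φ]⟩
    | tmul b d =>
      refine ⟨2 * ‖b‖ * ‖d‖, ?_⟩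
      filter_upwards [hnorm b] with k hk
      rw [abs_of_nonneg (hf0 _ _)]
      exact (maxSeminorm_tmul_le _ _).trans (by gcongr; rfl)
    | add s t hs ht =>
      obtain ⟨K, hK⟩ := hs
      obtain ⟨L, hL⟩ := ht
      refine ⟨K + L, ?_⟩
      filter_upwards [hK, hL] with k hk hl
      rw [abs_of_nonneg (hf0 _ _)] at hk hl ⊢
      simp only [f, map_add] at hk hl ⊢
      exact (map_add_le_add _ _ _).trans (add_le_add hk hl)
  have hlim : ∀ t, Tendsto (f t) U (𝓝 (ultraLim U (f t))) := fun t => tendsto_ultraLim (hbd t)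
  have hΦstar : ∀ t, ∀ᶠ k in (U : Filter ι), Φ k (star t) = star (Φ k t) := by
    intro t
    induction t using TensorProduct.induction_on with
    | zero => simp
    | tmul b d =>
      filter_upwards [hstar b] with k hk
      simp [Φ, TensorProduct.star_tmul, hk]
    | add s t hs ht =>
      filter_upwards [hs, ht] with k hk hl
      rw [star_add, map_add, hk, hl, map_add, star_add]
  have hΦmul : ∀ s t, Tendsto (fun k => maxSeminorm (A k) D (Φ k (s * t) - Φ k s * Φ k t)) U
      (𝓝 0) := by
    intro s t
    have hsum : ∀ {x y z : ∀ k, A k ⊗[ℂ] D},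
        Tendsto (fun k => maxSeminorm (A k) D (x k)) U (𝓝 0) →
        Tendsto (fun k => maxSeminorm (A k) D (y k)) U (𝓝 0) → (∀ k, z k = x k + y k) →
        Tendsto (fun k => maxSeminorm (A k) D (z k)) U (𝓝 0) := by
      intro x y z hx hy hz
      refine squeeze_zero (fun k => apply_nonneg _ _) (fun k => ?_) (by simpa using hx.add hy)
      rw [hz]
      exact map_add_le_add _ _ _
    induction s using TensorProduct.induction_on with
    | zero => simp
    | add s s' hs hs' =>
      refine hsum hs hs' fun k => ?_
      simp only [add_mul, map_add]
      abel
    | tmul b d =>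
      induction t using TensorProduct.induction_on with
      | zero => simp
      | add t t' ht ht' =>
        refine hsum ht ht' fun k => ?_
        simp only [mul_add, map_add]
        abel
      | tmul b' d' =>
        refine squeeze_zero (fun k => apply_nonneg _ _) (fun k => ?_)
          (by simpa using (hmul b b').mul_const ‖d * d'‖)
        simp only [Φ, Algebra.TensorProduct.tmul_mul_tmul, TensorProduct.map_tmul,
          LinearMap.id_apply, ← TensorProduct.sub_tmul]
        exact maxSeminorm_tmul_le _ _
  have hprod : ∀ s t, Tendsto (fun k => maxSeminorm (A k) D (Φ k s * Φ k t)) U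
      (𝓝 (ultraLim U (f (s * t)))) := by
    intro s t
    have h1 : Tendsto (fun k => maxSeminorm (A k) D (Φ k s * Φ k t) - f (s * t) k) U (𝓝 0) := by
      refine squeeze_zero_norm (fun k => ?_) (hΦmul s t)
      rw [Real.norm_eq_abs, map_sub_rev]
      exact abs_sub_map_le_sub _ _ _
    simpa using h1.add (hlim (s * t))
  let p : Seminorm ℂ (B ⊗[ℂ] D) := Seminorm.of (fun t => ultraLim U (f t))
    (fun s t => le_of_tendsto_of_tendsto' (hlim (s + t)) ((hlim s).add (hlim t)) fun k => by
      simp only [f, map_add]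
      exact map_add_le_add _ _ _)
    (fun c t => tendsto_nhds_unique (hlim (c • t)) (by
      simpa [f, map_smul_eq_mul] using (hlim t).const_mul ‖c‖))
  have hp : IsCStarSeminorm p := by
    refine ⟨fun s t => ?_, fun t => ?_⟩
    · exact le_of_tendsto_of_tendsto' (hprod s t) ((hlim s).mul (hlim t)) fun k =>
        (isCStarSeminorm_maxSeminorm (A k) D).mul_le _ _
    · refine tendsto_nhds_unique (hprod (star t) t) (((hlim t).pow 2).congr' ?_)
      filter_upwards [hΦstar t] with k hk
      rw [hk, (isCStarSeminorm_maxSeminorm (A k) D).star_mul_self]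
  have hlt : ultraLim U (f t) < maxSeminorm B D t + ε :=
    lt_of_le_of_lt (hp.le_maxSeminorm t) (by linarith)
  filter_upwards [(hlim t).eventually_lt_const hlt] with k hk using hk.le

/-- A sufficiently good almost morphism does not increase the maximal norm of a given tensor by
more than `ε`. -/
lemma exists_almostMorphism_maxSeminorm_le (t : B ⊗[ℂ] D) {ε : ℝ} (hε : 0 < ε) :
    ∃ (F : Finset B) (m : ℕ), ∀ (A : Type v) [NonUnitalCStarAlgebra A] (φ : B →ₗ[ℂ] A),
      AlmostMorphismOn (1 / (m + 1)) (Submodule.span ℂ (F : Set B)) φ →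
      maxSeminorm A D (TensorProduct.map φ LinearMap.id t) ≤ maxSeminorm B D t + ε := by
  classical
  by_contra! hcon
  choose A hA φ hφ hlt using fun i : Finset B × ℕ => hcon i.1 i.2
  let U : Ultrafilter (Finset B × ℕ) := Ultrafilter.of atTop
  have hU : (U : Filter (Finset B × ℕ)) ≤ atTop := Ultrafilter.of_le atTop
  have hδ1 : ∀ i : Finset B × ℕ, (1 : ℝ) / (i.2 + 1) ≤ 1 := fun i => by
    rw [div_le_one (by positivity)]
    linarith [Nat.cast_nonneg (α := ℝ) i.2]
  have hmem : ∀ x : B, ∀ᶠ i in (U : Filter (Finset B × ℕ)),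
      x ∈ Submodule.span ℂ (i.1 : Set B) := by
    intro x
    filter_upwards [hU (eventually_ge_atTop ({x}, 0))] with i hi
    exact Submodule.subset_span (hi.1 (Finset.mem_singleton_self x))
  have hδ0 : Tendsto (fun i : Finset B × ℕ => (1 : ℝ) / (i.2 + 1)) U (𝓝 0) := by
    refine Tendsto.mono_left ?_ hU
    rw [← prod_atTop_atTop_eq]
    exact tendsto_one_div_add_atTop_nhds_zero_nat.comp tendsto_snd
  have h := eventually_maxSeminorm_map_le U φ (fun x => ?_) (fun x y => ?_) (fun x => ?_) t hε
  · obtain ⟨k, hk⟩ := h.exists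
    exact absurd hk (not_le.2 (hlt k))
  · filter_upwards [hmem x] with i hi
    refine ((hφ i).norm_le x hi).trans ?_
    gcongr
    linarith [hδ1 i]
  · refine squeeze_zero' (Eventually.of_forall fun i => norm_nonneg _) ?_
      (by simpa only [zero_mul] using (hδ0.mul_const ‖x‖).mul_const ‖y‖)
    filter_upwards [hmem x, hmem y, hmem (x * y)] with i h1 h2 h3
    exact (hφ i).mul_approx x h1 y h2 h3
  · filter_upwards [hmem x, hmem (star x)] with i h1 h2
    exact (hφ i).map_star x h1 h2

lemma eventually_almostMorphism_maxSeminorm_le (t : B ⊗[ℂ] D) {ε : ℝ} (hε : 0 < ε) :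
    ∀ᶠ i : Finset B × ℕ in atTop, ∀ (A : Type v) [NonUnitalCStarAlgebra A] (φ : B →ₗ[ℂ] A),
      AlmostMorphismOn (1 / (i.2 + 1)) (Submodule.span ℂ (i.1 : Set B)) φ →
      maxSeminorm A D (TensorProduct.map φ LinearMap.id t) ≤ maxSeminorm B D t + ε := by
  obtain ⟨F, m, h⟩ := exists_almostMorphism_maxSeminorm_le.{u, v, w} t hε
  filter_upwards [eventually_ge_atTop (F, m)] with i hi A _ φ hφ
  have hm : (m : ℝ) ≤ i.2 := by exact_mod_cast hi.2
  refine h A φ (hφ.mono ?_ (Submodule.span_mono (by exact_mod_cast hi.1)))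
  gcongr

lemma eventually_le_span (E : Submodule ℂ B) [FiniteDimensional ℂ E] :
    ∀ᶠ i : Finset B × ℕ in atTop, E ≤ Submodule.span ℂ (i.1 : Set B) := by
  obtain ⟨F, hF⟩ := (Submodule.fg_iff_finiteDimensional E).2 inferInstance
  filter_upwards [eventually_ge_atTop (F, 0)] with i hi
  rw [← hF]
  exact Submodule.span_mono (by exact_mod_cast hi.1)

lemma exists_sum_smul_eq {E : Type*} [NormedAddCommGroup E] [NormedSpace ℂ E] {m : ℕ}
    (x : ℕ → E) (hx : ∑ j ∈ Finset.range m, ‖x j‖ ≠ 0) :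
    ∃ y : ℕ → E, (∀ j < m, ‖y j‖ ≤ 1) ∧
      ∀ j, x j = ((∑ j ∈ Finset.range m, ‖x j‖ : ℝ) : ℂ) • y j := by
  refine ⟨fun j => ((∑ j ∈ Finset.range m, ‖x j‖ : ℝ) : ℂ)⁻¹ • x j, fun j hj => ?_, fun j => ?_⟩
  · have hpos : 0 < ∑ j ∈ Finset.range m, ‖x j‖ :=
      lt_of_le_of_ne (by positivity) hx.symm
    rw [norm_smul, norm_inv, Complex.norm_real, Real.norm_of_nonneg hpos.le,
      inv_mul_le_one₀ hpos]
    exact Finset.single_le_sum (f := fun j => ‖x j‖) (fun _ _ => norm_nonneg _)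
      (Finset.mem_range.2 hj)
  · rw [smul_inv_smul₀ (by exact_mod_cast hx)]

/-- The uniform version: for tensors `∑ x j ⊗ d j` with fixed `d` and with `x j` in a
finite-dimensional space, a sufficiently good almost morphism increases the maximal norm by at most
`ε ∑ ‖x j‖`. This is a compactness argument. -/
lemma exists_almostMorphism_maxSeminorm_sum_le (E : Submodule ℂ B) [FiniteDimensional ℂ E]
    (d : ℕ → D) (m : ℕ) {ε : ℝ} (hε : 0 < ε) :
    ∃ (E' : Submodule ℂ B) (δ : ℝ), FiniteDimensional ℂ E' ∧ 0 < δ ∧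
      ∀ (A : Type v) [NonUnitalCStarAlgebra A] (φ : B →ₗ[ℂ] A), AlmostMorphismOn δ E' φ →
      ∀ x : ℕ → B, (∀ j, x j ∈ E) →
        maxSeminorm A D (∑ j ∈ Finset.range m, φ (x j) ⊗ₜ[ℂ] d j) ≤
          maxSeminorm B D (∑ j ∈ Finset.range m, x j ⊗ₜ[ℂ] d j) +
            ε * ∑ j ∈ Finset.range m, ‖x j‖ := by
  classical
  let S : (Fin m → E) → B ⊗[ℂ] D := fun y => ∑ j : Fin m, (y j : B) ⊗ₜ[ℂ] d j
  let L : ℝ := ∑ j : Fin m, ‖d j‖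
  have hL : 0 ≤ L := by positivity
  obtain ⟨r, hr0, hr⟩ : ∃ r : ℝ, 0 < r ∧ 3 * r * L ≤ ε / 2 := by
    refine ⟨ε / (6 * (L + 1)), by positivity, ?_⟩
    rw [show 3 * (ε / (6 * (L + 1))) * L = ε / 2 * (L / (L + 1)) by field_simp; ring]
    exact mul_le_of_le_one_right (by positivity) ((div_le_one (by positivity)).2 (by linarith))
  obtain ⟨T, hTfin, hT⟩ := Metric.totallyBounded_iff.1
    (isCompact_closedBall (0 : Fin m → E) 1).totallyBounded r hr0
  have hev : ∀ᶠ i : Finset B × ℕ in atTop, ∀ y ∈ T,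
      ∀ (A : Type v) [NonUnitalCStarAlgebra A] (φ : B →ₗ[ℂ] A),
      AlmostMorphismOn (1 / (i.2 + 1)) (Submodule.span ℂ (i.1 : Set B)) φ →
      maxSeminorm A D (TensorProduct.map φ LinearMap.id (S y)) ≤
        maxSeminorm B D (S y) + ε / 2 :=
    (eventually_all_finite hTfin).2 fun y _ =>
      eventually_almostMorphism_maxSeminorm_le (S y) (half_pos hε)
  obtain ⟨i, hi1, hi2⟩ := (hev.and (eventually_le_span E)).exists
  refine ⟨Submodule.span ℂ (i.1 : Set B), 1 / (i.2 + 1), inferInstance, by positivity,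
    fun A _ φ hφ => ?_⟩
  have hδ1 : (1 : ℝ) / (i.2 + 1) ≤ 1 := by
    rw [div_le_one (by positivity)]
    linarith [Nat.cast_nonneg (α := ℝ) i.2]
  have hφn : ∀ x : E, ‖φ x‖ ≤ 2 * ‖x‖ := fun x => by
    refine (hφ.norm_le x (hi2 x.2)).trans ?_
    rw [Submodule.coe_norm]
    gcongr
    linarith
  have hSφ : ∀ y : Fin m → E, TensorProduct.map φ LinearMap.id (S y) =
      ∑ j : Fin m, φ (y j) ⊗ₜ[ℂ] d j := fun y => by simp [S, map_sum]
  -- the estimate on the unit ball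
  have hball : ∀ y : Fin m → E, ‖y‖ ≤ 1 →
      maxSeminorm A D (TensorProduct.map φ LinearMap.id (S y)) ≤ maxSeminorm B D (S y) + ε := by
    intro y hy
    obtain ⟨z, hzT, hz⟩ : ∃ z ∈ T, y ∈ Metric.ball z r := by
      simpa using hT (by simpa using hy)
    have hyz : ∀ j, ‖y j - z j‖ ≤ r := fun j => by
      rw [Metric.mem_ball, dist_eq_norm] at hz
      exact (norm_le_pi_norm (y - z) j).trans hz.le
    have h1 : maxSeminorm B D (S z - S y) ≤ r * L := by
      simp only [S, ← Finset.sum_sub_distrib, ← TensorProduct.sub_tmul, L, Finset.mul_sum]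
      refine (seminorm_sum_le _ _ _).trans (Finset.sum_le_sum fun j _ => ?_)
      refine (maxSeminorm_tmul_le _ _).trans ?_
      gcongr
      rw [norm_sub_rev]
      exact hyz j
    have h2 : maxSeminorm A D (TensorProduct.map φ LinearMap.id (S y) -
        TensorProduct.map φ LinearMap.id (S z)) ≤ 2 * r * L := by
      simp only [hSφ, ← Finset.sum_sub_distrib, ← TensorProduct.sub_tmul, L, Finset.mul_sum,
        ← map_sub]
      refine (seminorm_sum_le _ _ _).trans (Finset.sum_le_sum fun j _ => ?_)
      refine (maxSeminorm_tmul_le _ _).trans ?_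
      gcongr
      exact (hφn (y j - z j)).trans (by gcongr; exact hyz j)
    have h3 := hi1 z hzT A φ hφ
    have h4 := map_add_le_add (maxSeminorm A D) (TensorProduct.map φ LinearMap.id (S z))
      (TensorProduct.map φ LinearMap.id (S y) - TensorProduct.map φ LinearMap.id (S z))
    have h5 := map_add_le_add (maxSeminorm B D) (S y) (S z - S y)
    rw [add_sub_cancel] at h4 h5
    linarith
  intro x hx
  by_cases h0 : ∑ j ∈ Finset.range m, ‖x j‖ = 0
  · have hz : ∀ j ∈ Finset.range m, x j = 0 := fun j hj =>
      norm_eq_zero.1 ((Finset.sum_eq_zero_iff_of_nonneg fun _ _ => norm_nonneg _).1 h0 j hj)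
    rw [h0, Finset.sum_eq_zero fun j hj => by rw [hz j hj, map_zero, TensorProduct.zero_tmul],
      map_zero]
    simp [apply_nonneg]
  · obtain ⟨y, hy1, hy⟩ := exists_sum_smul_eq (fun j => (⟨x j, hx j⟩ : E)) (m := m) (by simpa using h0)
    set c : ℝ := ∑ j ∈ Finset.range m, ‖(⟨x j, hx j⟩ : E)‖ with hc
    have hc0 : 0 ≤ c := by positivity
    have hcx : c = ∑ j ∈ Finset.range m, ‖x j‖ := by simp [hc]
    have hxy : ∀ j, x j = (c : ℂ) • (y j : B) := fun j => congrArg Subtype.val (hy j)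
    have h1 := hball (fun j => y j) ((pi_norm_le_iff_of_nonneg zero_le_one).2 fun j => hy1 j j.2)
    have h2 : ∑ j ∈ Finset.range m, x j ⊗ₜ[ℂ] d j = (c : ℂ) • S (fun j => y j) := by
      simp only [S, Finset.smul_sum, TensorProduct.smul_tmul', ← hxy]
      exact Finset.sum_range _
    have h3 : ∑ j ∈ Finset.range m, φ (x j) ⊗ₜ[ℂ] d j =
        (c : ℂ) • TensorProduct.map φ LinearMap.id (S (fun j => y j)) := by
      rw [← map_smul, ← h2]
      simp [map_sum]
    rw [h2, h3, map_smul_eq_mul, map_smul_eq_mul, Complex.norm_real, Real.norm_of_nonneg hc0,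
      ← hcx]
    nlinarith
end AlmostMorphism

/-! ### The local lifting property and complete boundedness of almost morphisms -/

section BlockDiagonal

variable {ι : Type*} {G : ι → Type*} [∀ T, NormedAddCommGroup (G T)]
  [∀ T, InnerProductSpace ℂ (G T)] {H : Type*} [NormedAddCommGroup H] [InnerProductSpace ℂ H]

/-- The projection of `H ⊗ (⨁ G T)` to a summand `H ⊗ G T`. -/
noncomputable def blockProj (H : Type*) [NormedAddCommGroup H] [InnerProductSpace ℂ H]
    (G : ι → Type*) [∀ T, NormedAddCommGroup (G T)] [∀ T, InnerProductSpace ℂ (G T)] (T : ι) :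
    (H ⊗[ℂ] lp G 2) →L[ℂ] (H ⊗[ℂ] G T) :=
  TensorProduct.mapL (ContinuousLinearMap.id ℂ H) (lp.evalCLM ℂ G 2 T)

lemma blockProj_tmul (T : ι) (h : H) (f : lp G 2) :
    blockProj H G T (h ⊗ₜ[ℂ] f) = h ⊗ₜ[ℂ] f T := rfl

lemma hasSum_inner_blockProj (w w' : H ⊗[ℂ] lp G 2) :
    HasSum (fun T => inner ℂ (blockProj H G T w) (blockProj H G T w')) (inner ℂ w w') := by
  induction w using TensorProduct.induction_on with
  | zero => simp
  | add x y hx hy => simpa only [map_add, inner_add_left] using hx.add hy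
  | tmul h f =>
    induction w' using TensorProduct.induction_on with
    | zero => simp
    | add x y hx hy => simpa only [map_add, inner_add_right] using hx.add hy
    | tmul h' f' =>
      simp only [blockProj_tmul, TensorProduct.inner_tmul]
      exact (lp.hasSum_inner f f').mul_left (inner ℂ h h')

lemma hasSum_norm_blockProj_sq (w : H ⊗[ℂ] lp G 2) :
    HasSum (fun T => ‖blockProj H G T w‖ ^ 2) (‖w‖ ^ 2) := by
  have h := (hasSum_inner_blockProj w w).mapL (RCLike.reCLM (K := ℂ))
  simp only [RCLike.reCLM_apply] at h
  rw [← inner_self_eq_norm_sq (𝕜 := ℂ) w]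
  refine h.congr_fun ?_
  intro T
  exact (inner_self_eq_norm_sq (𝕜 := ℂ) (blockProj H G T w)).symm

/-- An operator on `H ⊗ (⨁ G T)` that is diagonal with contractive blocks is contractive. -/
lemma norm_le_one_of_blockProj (S : (H ⊗[ℂ] lp G 2) →L[ℂ] (H ⊗[ℂ] lp G 2))
    (R : ∀ T, (H ⊗[ℂ] G T) →L[ℂ] (H ⊗[ℂ] G T)) (hR : ∀ T, ‖R T‖ ≤ 1)
    (h : ∀ T z, blockProj H G T (S z) = R T (blockProj H G T z)) : ‖S‖ ≤ 1 := by
  refine ContinuousLinearMap.opNorm_le_bound _ zero_le_one fun z => ?_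
  rw [one_mul]
  refine le_of_sq_le_sq ?_ (norm_nonneg z)
  refine hasSum_le (fun T => ?_) (hasSum_norm_blockProj_sq _) (hasSum_norm_blockProj_sq z)
  rw [h]
  gcongr
  exact (ContinuousLinearMap.le_opNorm _ _).trans (mul_le_of_le_one_left (norm_nonneg _) (hR T))

variable [CompleteSpace H] [∀ T, CompleteSpace (G T)] {C : Type*} [NonUnitalCStarAlgebra C]

lemma blockProj_tensorRep_tmul (π : C →⋆ₙₐ[ℂ] (H →L[ℂ] H)) (T : ι) (c : C)
    (x : lp (fun T => G T →L[ℂ] G T) ∞) (z : H ⊗[ℂ] lp G 2) :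
    blockProj H G T (tensorRep π (NonUnitalStarAlgHom.id ℂ (lp G 2 →L[ℂ] lp G 2))
      (c ⊗ₜ[ℂ] lpDiag x) z) =
      tensorRep π (NonUnitalStarAlgHom.id ℂ (G T →L[ℂ] G T)) (c ⊗ₜ[ℂ] x T)
        (blockProj H G T z) := by
  induction z using TensorProduct.induction_on with
  | zero => simp only [map_zero]
  | add y z hy hz => simp only [map_add, hy, hz]
  | tmul h f =>
    rw [tensorRep_tmul_apply_tmul, blockProj_tmul, blockProj_tmul, tensorRep_tmul_apply_tmul]
    rfl

lemma blockProj_tensorRep (π : C →⋆ₙₐ[ℂ] (H →L[ℂ] H)) (T : ι) {J : Type*} (s : Finset J)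
    (e : J → C) (x : J → lp (fun T => G T →L[ℂ] G T) ∞) (z : H ⊗[ℂ] lp G 2) :
    blockProj H G T (tensorRep π (NonUnitalStarAlgHom.id ℂ (lp G 2 →L[ℂ] lp G 2))
      (∑ j ∈ s, e j ⊗ₜ[ℂ] lpDiag (x j)) z) =
      tensorRep π (NonUnitalStarAlgHom.id ℂ (G T →L[ℂ] G T)) (∑ j ∈ s, e j ⊗ₜ[ℂ] x j T)
        (blockProj H G T z) := by
  rw [map_sum, map_sum, sum_apply, sum_apply, map_sum]
  exact Finset.sum_congr rfl fun j _ => blockProj_tensorRep_tmul π T (e j) (x j) z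

/-- Conjugation by an isometry, as a ⋆-homomorphism. -/
noncomputable def conjIsometry {K L : Type*} [NormedAddCommGroup K] [InnerProductSpace ℂ K]
    [CompleteSpace K] [NormedAddCommGroup L] [InnerProductSpace ℂ L] [CompleteSpace L]
    (W : K →ₗᵢ[ℂ] L) : (K →L[ℂ] K) →⋆ₙₐ[ℂ] (L →L[ℂ] L) where
  toFun x := W.toContinuousLinearMap ∘L x ∘L ContinuousLinearMap.adjoint W.toContinuousLinearMap
  map_smul' c x := by ext; simp
  map_zero' := by ext; simp
  map_add' x y := by ext; simp
  map_mul' x y := by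
    ext f
    have h := congrArg (fun T => T (y (ContinuousLinearMap.adjoint W.toContinuousLinearMap f)))
      (LinearIsometry.adjoint_comp_self W)
    simp only [ContinuousLinearMap.comp_apply, LinearIsometry.coe_toContinuousLinearMap,
      one_apply_eq_self] at h
    simp [h]
  map_star' x := by
    simp only [ContinuousLinearMap.star_eq_adjoint, ContinuousLinearMap.adjoint_comp,
      ContinuousLinearMap.adjoint_adjoint, ContinuousLinearMap.comp_assoc]

lemma conjIsometry_inner {K L : Type*} [NormedAddCommGroup K] [InnerProductSpace ℂ K]
    [CompleteSpace K] [NormedAddCommGroup L] [InnerProductSpace ℂ L] [CompleteSpace L]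
    (W : K →ₗᵢ[ℂ] L) (x : K →L[ℂ] K) (f g : K) :
    inner ℂ (W f) (conjIsometry W x (W g)) = inner ℂ f (x g) := by
  have h := congrArg (fun T => T g) (LinearIsometry.adjoint_comp_self W)
  simp only [ContinuousLinearMap.comp_apply, LinearIsometry.coe_toContinuousLinearMap,
    one_apply_eq_self] at h
  change inner ℂ (W f) (W (x _)) = _
  rw [LinearIsometry.inner_map_map]
  exact congrArg (fun y => inner ℂ f (x y)) h

/-- Orthogonal copies of the spaces `ℂ^(n T)` inside `ℓ₂`. -/
lemma exists_orthogonalFamily_euclidean (n : ℕ → ℕ) :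
    ∃ V : ∀ T, EuclideanSpace ℂ (Fin (n T)) →ₗᵢ[ℂ] lp (fun _ : ℕ => ℂ) 2,
      OrthogonalFamily ℂ (fun T => EuclideanSpace ℂ (Fin (n T))) V := by
  let b : HilbertBasis ℕ ℂ (lp (fun _ : ℕ => ℂ) 2) :=
    HilbertBasis.ofRepr (LinearIsometryEquiv.refl ℂ _)
  have hb := b.orthonormal
  let e := fun T => (EuclideanSpace.basisFun (Fin (n T)) ℂ)
  let L : ∀ T, EuclideanSpace ℂ (Fin (n T)) →ₗ[ℂ] lp (fun _ : ℕ => ℂ) 2 := fun T =>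
    (e T).toBasis.constr ℂ fun k => b (Nat.pair T k)
  have hL : ∀ T k, L T (e T k) = b (Nat.pair T k) := fun T k => by
    have := (e T).toBasis.constr_basis ℂ (fun k : Fin (n T) => b (Nat.pair T k)) k
    rwa [OrthonormalBasis.coe_toBasis] at this
  refine ⟨fun T => (L T).isometryOfOrthonormal (v := (e T).toBasis)
    (by simp [(e T).orthonormal]) ?_, ?_⟩
  · have : ⇑(L T) ∘ ⇑(e T).toBasis = b ∘ fun k : Fin (n T) => Nat.pair T k := by
      ext1 k
      simp [hL]
    rw [this]
    refine hb.comp _ fun k l hkl => ?_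
    have := (Nat.pair_eq_pair.1 hkl).2
    exact Fin.ext this
  · intro T T' hTT x y
    change inner ℂ (L T x) (L T' y) = 0
    rw [← (e T).sum_repr x, ← (e T').sum_repr y]
    simp only [map_sum, map_smul, hL, sum_inner, inner_sum, inner_smul_left, inner_smul_right]
    have h0 : ∀ (k : Fin (n T)) (l : Fin (n T')),
        inner ℂ (b (Nat.pair T k)) (b (Nat.pair T' l)) = 0 := fun k l => by
      rw [orthonormal_iff_ite.1 hb, if_neg]
      exact fun h => hTT (Nat.pair_eq_pair.1 h).1
    simp [h0]

end BlockDiagonal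

section LLP

variable {C : Type u} [NonUnitalCStarAlgebra C]

/-- A sequence of contractive matrices over a finite-dimensional space is the sequence of diagonal
blocks of a single element of the unit ball of `C ⊗_min B(ℓ₂)`. -/
lemma exists_tensor_compress_eq (E : Submodule ℂ C) [FiniteDimensional ℂ E] (n : ℕ → ℕ)
    (X : ∀ T, Matrix (Fin (n T)) (Fin (n T)) E)
    (hX : ∀ T, matrixNorm (n T) ((X T).map fun z => (z : C)) ≤ 1) :
    ∃ (t : C ⊗[ℂ] (lp (fun _ : ℕ => ℂ) 2 →L[ℂ] lp (fun _ : ℕ => ℂ) 2)),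
      minSeminorm C _ t ≤ 1 ∧
      ∀ T, ∃ V : EuclideanSpace ℂ (Fin (n T)) →ₗᵢ[ℂ] lp (fun _ : ℕ => ℂ) 2,
        compress (NonUnitalStarAlgHom.id ℂ _) V t = (X T).map fun z => (z : C) := by
  obtain ⟨V, hV⟩ := exists_orthogonalFamily_euclidean n
  let W : lp (fun T => EuclideanSpace ℂ (Fin (n T))) 2 →ₗᵢ[ℂ] lp (fun _ : ℕ => ℂ) 2 := hV.linearIsometry
  let b := Module.finBasis ℂ E
  let f : Fin (Module.finrank ℂ E) → E →L[ℂ] ℂ := fun j => (b.coord j).toContinuousLinearMap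
  let x : Fin (Module.finrank ℂ E) →
      lp (fun T => EuclideanSpace ℂ (Fin (n T)) →L[ℂ] EuclideanSpace ℂ (Fin (n T))) ∞ := fun j =>
    ⟨fun T => ∑ k, ∑ l, f j (X T k l) • matrixUnit k l, memℓp_infty ⟨‖f j‖, by
      rintro _ ⟨T, rfl⟩
      exact (norm_functional_matrix_le (f j) (X T)).trans
        (mul_le_of_le_one_right (norm_nonneg (f j)) (hX T))⟩⟩
  have hcoord : ∀ z : E, (z : C) = ∑ j, f j z • (b j : C) := fun z => by
    have h := congrArg E.subtype (b.sum_repr z)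
    rw [map_sum] at h
    exact h.symm
  have hxX : ∀ T, unitTensor matrixUnit ((X T).map fun z => (z : C)) =
      ∑ j, (b j : C) ⊗ₜ[ℂ] x j T := fun T => by
    simp only [unitTensor, Matrix.map_apply, x, TensorProduct.tmul_sum]
    have h1 : ∀ k l, (X T k l : C) ⊗ₜ[ℂ] matrixUnit k l =
        ∑ j, (b j : C) ⊗ₜ[ℂ] (f j (X T k l) • matrixUnit k l) := fun k l => by
      conv_lhs => rw [hcoord (X T k l)]
      simp only [TensorProduct.sum_tmul, TensorProduct.smul_tmul]
    simp only [h1]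
    conv_rhs => rw [Finset.sum_comm]
    exact Finset.sum_congr rfl fun k _ => Finset.sum_comm
  refine ⟨∑ j, (b j : C) ⊗ₜ[ℂ] conjIsometry W (lpDiag (x j)), ?_, fun T => ⟨V T, ?_⟩⟩
  · refine minSeminorm_le zero_le_one fun H _ _ _ K _ _ _ π σ => ?_
    have h1 := norm_tensorRep_le_of_injective_right
      (σ₀ := NonUnitalStarAlgHom.id ℂ
        (lp (fun T => EuclideanSpace ℂ (Fin (n T))) 2 →L[ℂ]
          lp (fun T => EuclideanSpace ℂ (Fin (n T))) 2)) Function.injective_id π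
      (σ.comp (conjIsometry W)) (∑ j, (b j : C) ⊗ₜ[ℂ] lpDiag (x j))
    have h2 := norm_le_one_of_blockProj _ _ (fun T => by
      refine le_trans (le_of_eq ?_) ((norm_amplify_le π _).trans (hX T))
      rw [amplify, hxX]) fun T => blockProj_tensorRep π T Finset.univ (fun j => (b j : C)) x
    refine le_trans (le_of_eq ?_) (h1.trans h2)
    · simp only [map_sum, tensorRep_tmul]
      rfl
  · ext k l
    have hVT : ∀ y, V T y = W (lp.single 2 T y) := fun y =>
      (hV.linearIsometry_apply_single y).symm
    rw [map_sum, Matrix.sum_apply, Matrix.map_apply, hcoord]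
    refine Finset.sum_congr rfl fun j _ => ?_
    rw [compress_tmul, hVT, hVT]
    congr 1
    change inner ℂ _ (conjIsometry W _ _) = _
    rw [conjIsometry_inner, lp.inner_single_left, lpDiag_apply, lp.single_apply_self]
    simp only [x, sum_apply, smul_apply, matrixUnit_apply, inner_sum, inner_smul_right,
      orthonormal_iff_ite.1 (EuclideanSpace.basisFun (Fin (n T)) ℂ).orthonormal]
    simp

lemma abs_matrixNorm_sub_le {A : Type*} [NonUnitalCStarAlgebra A] {n : ℕ}
    (X Y : Matrix (Fin n) (Fin n) A) :
    |matrixNorm n X - matrixNorm n Y| ≤ matrixNorm n (X - Y) := by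
  have h1 := matrixNorm_le_add_sub X Y
  have h2 := matrixNorm_le_add_sub Y X
  rw [← neg_sub X Y, matrixNorm_neg] at h2
  exact abs_sub_le_iff.2 ⟨by linarith, by linarith⟩

lemma continuous_matrixNorm {A : Type*} [NonUnitalCStarAlgebra A] (n : ℕ) :
    Continuous (matrixNorm (A := A) n) := by
  refine continuous_iff_continuousAt.2 fun Y => ?_
  refine tendsto_iff_dist_tendsto_zero.2 ?_
  have h : Filter.Tendsto (fun X : Matrix (Fin n) (Fin n) A => ∑ k, ∑ l, ‖X k l - Y k l‖)
      (nhds Y) (nhds 0) := by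
    have hc : Continuous fun X : Matrix (Fin n) (Fin n) A => ∑ k, ∑ l, ‖X k l - Y k l‖ := by
      fun_prop
    simpa using hc.tendsto Y
  refine squeeze_zero (fun X => dist_nonneg) (fun X => ?_) h
  rw [Real.dist_eq]
  exact (abs_matrixNorm_sub_le X Y).trans (matrixNorm_le_sum _)

/-- There is a sequence of matrices, of varying sizes, that is dense in the unit balls of all spaces
of matrices over `E`. -/
lemma exists_dense_matrices (E : Submodule ℂ C) [FiniteDimensional ℂ E] :
    ∃ (n : ℕ → ℕ) (X : ∀ T, Matrix (Fin (n T)) (Fin (n T)) E),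
      (∀ T, matrixNorm (n T) ((X T).map fun z => (z : C)) ≤ 1) ∧
      ∀ p : ∀ m, Matrix (Fin m) (Fin m) E → Prop, (∀ m, IsClosed {Y | p m Y}) →
        (∀ T, p (n T) (X T)) → ∀ m Y, matrixNorm m (Y.map fun z => (z : C)) ≤ 1 → p m Y := by
  let S : ∀ n : ℕ, Set (Matrix (Fin n) (Fin n) E) := fun n =>
    {X | matrixNorm n (X.map fun z => (z : C)) ≤ 1}
  have hS0 : ∀ n, Nonempty (S n) := fun n => ⟨0, by
    change matrixNorm n (Matrix.map 0 _) ≤ 1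
    rw [Matrix.map_zero _ rfl, matrixNorm_zero]
    exact zero_le_one⟩
  have hsep : ∀ n, TopologicalSpace.SeparableSpace (S n) := fun n => by
    have : SecondCountableTopology (Matrix (Fin n) (Fin n) E) :=
      inferInstanceAs (SecondCountableTopology (Fin n → Fin n → E))
    infer_instance
  let s : ∀ n, ℕ → S n := fun n => TopologicalSpace.denseSeq (S n)
  have hs : ∀ n, DenseRange (s n) := fun n => TopologicalSpace.denseRange_denseSeq (S n)
  refine ⟨fun T => T.unpair.1, fun T => (s T.unpair.1 T.unpair.2).1,
    fun T => (s T.unpair.1 T.unpair.2).2, fun p hp hpT m Y hY => ?_⟩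
  refine (hs m).induction_on (p := fun Y : S m => p m Y) ⟨Y, hY⟩
    ((hp m).preimage continuous_subtype_val) fun k => ?_
  have h := hpT (Nat.pair m k)
  have h2 : ∀ q : ℕ × ℕ, q = (m, k) → p q.1 (s q.1 q.2).1 → p m (s m k).1 := by
    rintro _ rfl h
    exact h
  exact h2 _ (Nat.unpair_pair m k) h

/-- In an algebra with the local lifting property, sufficiently good almost morphisms are almost
completely contractive on a given finite-dimensional subspace. -/
lemma HasLLP.exists_matrixNorm_map_le (hC : HasLLP C) (E : Submodule ℂ C) [FiniteDimensional ℂ E]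
    {ε : ℝ} (hε : 0 < ε) :
    ∃ (E' : Submodule ℂ C) (δ : ℝ), FiniteDimensional ℂ E' ∧ 0 < δ ∧
      ∀ (A : Type v) [NonUnitalCStarAlgebra A] (φ : C →ₗ[ℂ] A), AlmostMorphismOn δ E' φ →
      ∀ (n : ℕ) (X : Matrix (Fin n) (Fin n) C), (∀ k l, X k l ∈ E) →
        matrixNorm n (X.map φ) ≤ (1 + ε) * matrixNorm n X := by
  classical
  obtain ⟨nT, XT, hXT, hdense⟩ := exists_dense_matrices E
  obtain ⟨t, ht, htV⟩ := exists_tensor_compress_eq E nT XT hXT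
  have htmax : maxSeminorm C _ t ≤ 1 := by
    have h1 := hC t
    rw [← ofReal_minSeminorm, ← ofReal_maxSeminorm,
      ENNReal.ofReal_eq_ofReal_iff (apply_nonneg _ _) (apply_nonneg _ _)] at h1
    rwa [← h1]
  obtain ⟨i, hi1, hi2⟩ := ((eventually_almostMorphism_maxSeminorm_le.{u, v, 0} t hε).and
    (eventually_le_span E)).exists
  refine ⟨Submodule.span ℂ (i.1 : Set C), 1 / (i.2 + 1), inferInstance, by positivity,
    fun A _ φ hφ n X hX => ?_⟩
  have hφt : minSeminorm A _ (TensorProduct.map φ LinearMap.id t) ≤ 1 + ε :=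
    (minSeminorm_le_maxSeminorm _).trans ((hi1 A φ hφ).trans (by linarith))
  have hcont : Continuous fun z : E => φ z :=
    (φ.comp E.subtype).continuous_of_finiteDimensional
  -- the estimate on the unit ball, by density
  have hball : ∀ Y : Matrix (Fin n) (Fin n) E, matrixNorm n (Y.map fun z => (z : C)) ≤ 1 →
      matrixNorm n (Y.map fun z => φ z) ≤ 1 + ε := by
    refine hdense (fun n Y => matrixNorm n (Y.map fun z => φ z) ≤ 1 + ε) (fun m => ?_)
      (fun T => ?_) n
    · exact isClosed_le ((continuous_matrixNorm m).comp (continuous_id.matrix_map hcont))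
        continuous_const
    · obtain ⟨V, hV⟩ := htV T
      have h1 := (matrixNorm_compress_le_minSeminorm (NonUnitalStarAlgHom.id ℂ _) V
        (TensorProduct.map φ LinearMap.id t)).trans hφt
      rwa [compress_map, hV, Matrix.map_map] at h1
  rcases (matrixNorm_nonneg X).eq_or_lt with h0 | h0
  · have hX0 : X = 0 := by
      ext k l
      exact norm_le_zero_iff.1 ((norm_entry_le_matrixNorm X k l).trans h0.ge)
    rw [hX0, Matrix.map_zero _ (map_zero φ), matrixNorm_zero, matrixNorm_zero, mul_zero]
  · let Y : Matrix (Fin n) (Fin n) E := Matrix.of fun k l =>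
      ((matrixNorm n X : ℂ)⁻¹ • ⟨X k l, hX k l⟩ : E)
    have hc : ‖(matrixNorm n X : ℂ)⁻¹‖ = (matrixNorm n X)⁻¹ := by
      rw [norm_inv, Complex.norm_real, Real.norm_of_nonneg h0.le]
    have hY : Y.map (fun z => (z : C)) = (matrixNorm n X : ℂ)⁻¹ • X := by
      ext k l
      rfl
    have h1 := hball Y (by rw [hY, matrixNorm_smul, hc, inv_mul_cancel₀ h0.ne'])
    have hYφ : Y.map (fun z => φ z) = (matrixNorm n X : ℂ)⁻¹ • X.map φ := by
      ext k l
      simp [Y]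
    rw [hYφ, matrixNorm_smul, hc, inv_mul_le_iff₀ h0] at h1
    rwa [mul_comm]

end LLP

/-! ### Ultrapowers of C⋆-algebras -/

section Ultrapower

open Filter Topology

section UltraState

open scoped ComplexOrder

variable {H : Type*} [NormedAddCommGroup H] [InnerProductSpace ℂ H] [CompleteSpace H]
  {E : Type*} [NonUnitalCStarAlgebra E] (π : E →⋆ₙₐ[ℂ] (H →L[ℂ] H)) (U : Ultrafilter ℕ)

/-- Along an ultrafilter, the vector functionals of a bounded sequence of operators at a bounded
sequence of vectors converge. -/
lemma exists_tendsto_inner (ξ : lp (fun _ : ℕ => H) ∞) (x : lp (fun _ : ℕ => E) ∞) :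
    ∃ z : ℂ, Tendsto (fun k => inner ℂ (ξ k) (π (x k) (ξ k))) U (𝓝 z) := by
  obtain ⟨z, -, hz⟩ := (isCompact_closedBall (0 : ℂ) (‖ξ‖ * (‖x‖ * ‖ξ‖))).ultrafilter_le_nhds
    (U.map fun k => inner ℂ (ξ k) (π (x k) (ξ k))) (by
      rw [Ultrafilter.coe_map, le_principal_iff, mem_map]
      refine Eventually.of_forall fun k => ?_
      have h1 : ‖ξ k‖ ≤ ‖ξ‖ := lp.norm_apply_le_norm (by simp) ξ k
      have h2 : ‖π (x k)‖ ≤ ‖x‖ :=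
        (NonUnitalStarAlgHom.norm_apply_le π _).trans (lp.norm_apply_le_norm (by simp) x k)
      simp only [Metric.mem_closedBall, dist_zero_right]
      exact (norm_inner_le_norm (ξ k) (π (x k) (ξ k))).trans
        (mul_le_mul h1 (((π (x k)).le_opNorm _).trans (by gcongr)) (norm_nonneg _) (norm_nonneg _)))
  exact ⟨z, hz⟩

/-- The limit of the vector functionals at `ξ k`, on bounded sequences of operators. -/
noncomputable def ultraFunctional (ξ : lp (fun _ : ℕ => H) ∞) :
    lp (fun _ : ℕ => E) ∞ →ₗ[ℂ] ℂ where
  toFun x := (exists_tendsto_inner π U ξ x).choose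
  map_add' x y := tendsto_nhds_unique (exists_tendsto_inner π U ξ (x + y)).choose_spec (by
    simpa [inner_add_right] using
      (exists_tendsto_inner π U ξ x).choose_spec.add (exists_tendsto_inner π U ξ y).choose_spec)
  map_smul' c x := tendsto_nhds_unique (exists_tendsto_inner π U ξ (c • x)).choose_spec (by
    simpa [inner_smul_right] using (exists_tendsto_inner π U ξ x).choose_spec.const_mul c)

variable {U}

lemma tendsto_ultraFunctional (ξ : lp (fun _ : ℕ => H) ∞) (x : lp (fun _ : ℕ => E) ∞) :
    Tendsto (fun k => inner ℂ (ξ k) (π (x k) (ξ k))) U (𝓝 (ultraFunctional π U ξ x)) :=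
  (exists_tendsto_inner π U ξ x).choose_spec

lemma tendsto_ultraFunctional_star_mul_self (ξ : lp (fun _ : ℕ => H) ∞)
    (x : lp (fun _ : ℕ => E) ∞) :
    Tendsto (fun k => ((‖π (x k) (ξ k)‖ ^ 2 : ℝ) : ℂ)) U (𝓝 (ultraFunctional π U ξ (star x * x))) := by
  refine (tendsto_ultraFunctional π ξ (star x * x)).congr fun k => ?_
  have h : π ((star x * x) k) (ξ k) = ContinuousLinearMap.adjoint (π (x k)) (π (x k) (ξ k)) := by
    have h1 : (star x * x) k = star (x k) * x k := rfl
    rw [h1, map_mul, map_star]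
    rfl
  rw [h, ContinuousLinearMap.adjoint_inner_right, inner_self_eq_norm_sq_to_K]
  norm_cast

lemma ultraFunctional_nonneg (ξ : lp (fun _ : ℕ => H) ∞) (x : lp (fun _ : ℕ => E) ∞) :
    0 ≤ ultraFunctional π U ξ (star x * x) :=
  ge_of_tendsto' (tendsto_ultraFunctional_star_mul_self π ξ x) fun k => by
    exact_mod_cast sq_nonneg ‖π (x k) (ξ k)‖

end UltraState

open scoped ComplexOrder in
/-- The GNS construction for a positive functional on a C⋆-algebra without a fixed order. -/
lemma exists_gns_representation {M : Type u} [NonUnitalCStarAlgebra M] (f : M →ₗ[ℂ] ℂ)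
    (hf : ∀ x, 0 ≤ f (star x * x)) :
    ∃ (K : Type u) (_ : NormedAddCommGroup K) (_ : InnerProductSpace ℂ K) (_ : CompleteSpace K)
      (ρ : M →⋆ₙₐ[ℂ] (K →L[ℂ] K)) (Λ : M → K), DenseRange Λ ∧
      (∀ x, ((‖Λ x‖ ^ 2 : ℝ) : ℂ) = f (star x * x)) ∧ ∀ x y, ρ x (Λ y) = Λ (x * y) := by
  let : PartialOrder M := CStarAlgebra.spectralOrder M
  have : StarOrderedRing M := CStarAlgebra.spectralOrderedRing M
  let g : M →ₚ[ℂ] ℂ := PositiveLinearMap.mk₀ f fun x hx => by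
    obtain ⟨y, rfl⟩ := CStarAlgebra.nonneg_iff_eq_star_mul_self.1 hx
    exact hf y
  refine ⟨g.GNS, inferInstance, inferInstance, inferInstance, g.gnsNonUnitalStarAlgHom,
    fun x => g.toPreGNS x, ?_, fun x => ?_, fun x y => ?_⟩
  · exact UniformSpace.Completion.denseRange_coe.comp g.toPreGNS.surjective.denseRange
      (UniformSpace.Completion.continuous_coe _)
  · rw [UniformSpace.Completion.norm_coe]
    push_cast
    exact g.preGNS_norm_sq (g.toPreGNS x)
  · rw [PositiveLinearMap.gnsNonUnitalStarAlgHom_apply_coe,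
      PositiveLinearMap.leftMulMapPreGNS_apply]
    rfl

lemma norm_le_norm_directSumRep {A : Type*} [NonUnitalCStarAlgebra A] {ι : Type*} {G : ι → Type*}
    [∀ i, NormedAddCommGroup (G i)] [∀ i, InnerProductSpace ℂ (G i)] [∀ i, CompleteSpace (G i)]
    (π : ∀ i, A →⋆ₙₐ[ℂ] (G i →L[ℂ] G i)) (a : A) (i : ι) : ‖π i a‖ ≤ ‖directSumRep π a‖ := by
  classical
  refine ContinuousLinearMap.opNorm_le_bound _ (norm_nonneg _) fun z => ?_
  have h5 := (directSumRep π a).le_opNorm (lp.single 2 i z)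
  rw [lp.norm_single (by simp)] at h5
  refine le_trans (le_trans (le_of_eq ?_) (lp.norm_apply_le_norm (by simp) _ i)) h5
  rw [directSumRep_apply, lp.single_apply_self]

lemma norm_directSumRep_le {A : Type*} [NonUnitalCStarAlgebra A] {ι : Type*} {G : ι → Type*}
    [∀ i, NormedAddCommGroup (G i)] [∀ i, InnerProductSpace ℂ (G i)] [∀ i, CompleteSpace (G i)]
    (π : ∀ i, A →⋆ₙₐ[ℂ] (G i →L[ℂ] G i)) (a : A) {L : ℝ} (hL : 0 ≤ L) (h : ∀ i, ‖π i a‖ ≤ L) :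
    ‖directSumRep π a‖ ≤ L :=
  ContinuousLinearMap.opNorm_le_bound _ hL fun f => by
    have h1 := lp.norm_mono (p := 2) (by simp) (x := directSumRep π a f) (y := (L : ℂ) • f)
      fun i => by
        rw [directSumRep_apply, lp.coeFn_smul, Pi.smul_apply, norm_smul, Complex.norm_real,
          Real.norm_of_nonneg hL]
        exact ((π i a).le_opNorm _).trans (by gcongr; exact h i)
    rwa [norm_smul, Complex.norm_real, Real.norm_of_nonneg hL] at h1

/-- The ultraproduct of the bounded operators on a Hilbert space: a representation of the bounded
sequences whose norm is the limit of the norms. It is the direct sum of the GNS representations of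
all limits of vector functionals. -/
lemma exists_rep_tendsto_norm {H : Type u} [NormedAddCommGroup H] [InnerProductSpace ℂ H]
    [CompleteSpace H] {E : Type u} [NonUnitalCStarAlgebra E] (π : E →⋆ₙₐ[ℂ] (H →L[ℂ] H))
    (hπ : Function.Injective π) {e : E} (he1 : π e = ContinuousLinearMap.id ℂ H)
    (U : Ultrafilter ℕ) :
    ∃ (K : Type u) (_ : NormedAddCommGroup K) (_ : InnerProductSpace ℂ K) (_ : CompleteSpace K)
      (ρ : lp (fun _ : ℕ => E) ∞ →⋆ₙₐ[ℂ] (K →L[ℂ] K)),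
      ∀ x, Tendsto (fun k => ‖x k‖) U (𝓝 ‖ρ x‖) := by
  choose K i1 i2 i3 ρ Λ hΛ hΛn hΛm using fun ξ : lp (fun _ : ℕ => H) ∞ =>
    exists_gns_representation (ultraFunctional π U ξ) (ultraFunctional_nonneg π ξ)
  have hnorm : ∀ ξ x, Tendsto (fun k => ‖π (x k) (ξ k)‖) U (𝓝 ‖Λ ξ x‖) := by
    intro ξ x
    have h1 := tendsto_ultraFunctional_star_mul_self π (U := U) ξ x
    rw [← hΛn] at h1
    have h3 := ((Complex.continuous_re.tendsto _).comp h1).sqrt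
    simp only [Function.comp_def, Complex.ofReal_re, Real.sqrt_sq (norm_nonneg _)] at h3
    exact h3
  refine ⟨lp K 2, inferInstance, inferInstance, inferInstance, directSumRep ρ, fun x => ?_⟩
  have hbd : ∀ k, ‖x k‖ ≤ ‖x‖ := lp.norm_apply_le_norm (by simp) x
  have hL := tendsto_ultraLim (U := U) (f := fun k => ‖x k‖)
    ⟨‖x‖, Eventually.of_forall fun k => by simpa using hbd k⟩
  have hL0 : 0 ≤ ultraLim U fun k => ‖x k‖ := ge_of_tendsto' hL fun k => norm_nonneg _
  convert hL using 2
  refine le_antisymm (norm_directSumRep_le ρ x hL0 fun ξ => ?_) ?_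
  · refine ContinuousLinearMap.opNorm_le_bound _ hL0 fun z => ?_
    refine (hΛ ξ).induction_on z (isClosed_le (by fun_prop) (by fun_prop)) fun y => ?_
    rw [hΛm]
    refine le_of_tendsto_of_tendsto' (hnorm ξ (x * y)) (hL.mul (hnorm ξ y)) fun k => ?_
    rw [← NonUnitalStarAlgHom.norm_map π hπ (x k)]
    refine le_trans (le_of_eq ?_) ((π (x k)).le_opNorm _)
    exact congrArg (fun T : H →L[ℂ] H => ‖T (ξ k)‖) (map_mul π _ _)
  · refine le_of_forall_pos_le_add fun ε hε => ?_
    choose ξ hξ1 hξ2 using fun k => (π (x k)).exists_lt_apply_of_lt_opNorm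
      (show ‖x k‖ - ε < ‖π (x k)‖ by
        rw [NonUnitalStarAlgHom.norm_map π hπ]
        linarith)
    let ξ' : lp (fun _ : ℕ => H) ∞ := ⟨ξ, memℓp_infty ⟨1, by
      rintro _ ⟨k, rfl⟩
      exact (hξ1 k).le⟩⟩
    let e' : lp (fun _ : ℕ => E) ∞ := ⟨fun _ => e, memℓp_infty ⟨‖e‖, by
      rintro _ ⟨k, rfl⟩
      exact le_rfl⟩⟩
    have he : ‖Λ ξ' e'‖ ≤ 1 := le_of_tendsto' (hnorm ξ' e') fun k => by
      change ‖π e (ξ k)‖ ≤ 1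
      rw [he1]
      exact (hξ1 k).le
    have h1 : (ultraLim U fun k => ‖x k‖) - ε ≤ ‖Λ ξ' (x * e')‖ :=
      le_of_tendsto_of_tendsto' (hL.sub_const ε) (hnorm ξ' (x * e')) fun k => by
        change _ ≤ ‖π (x k * e) (ξ k)‖
        rw [map_mul, he1]
        exact (hξ2 k).le
    have h2 : ‖Λ ξ' (x * e')‖ ≤ ‖ρ ξ' x‖ := by
      rw [← hΛm]
      exact ((ρ ξ' x).le_opNorm _).trans (mul_le_of_le_one_right (norm_nonneg _) he)
    have h4 := norm_le_norm_directSumRep ρ x ξ'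
    linarith

/-- Coordinatewise application of a ⋆-homomorphism to bounded sequences. -/
noncomputable def lpMapStar {A B : Type*} [NonUnitalCStarAlgebra A] [NonUnitalCStarAlgebra B]
    (π : A →⋆ₙₐ[ℂ] B) : lp (fun _ : ℕ => A) ∞ →⋆ₙₐ[ℂ] lp (fun _ : ℕ => B) ∞ where
  toFun x := ⟨fun k => π (x k), memℓp_infty ⟨‖x‖, by
    rintro _ ⟨k, rfl⟩
    exact (NonUnitalStarAlgHom.norm_apply_le π _).trans (lp.norm_apply_le_norm (by simp) x k)⟩⟩
  map_smul' c x := by ext k; exact map_smul π c (x k)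
  map_zero' := by ext k; exact map_zero π
  map_add' x y := by ext k; exact map_add π (x k) (y k)
  map_mul' x y := by ext k; exact map_mul π (x k) (y k)
  map_star' x := by ext k; exact map_star π (x k)

/-- The ultrapower of a C⋆-algebra, as the image of the bounded sequences under a ⋆-homomorphism
whose norm is the limit of the norms. -/
lemma exists_ultrapower (C : Type u) [NonUnitalCStarAlgebra C] (U : Ultrafilter ℕ) :
    ∃ (Q : Type u) (_ : NonUnitalCStarAlgebra Q) (ρ : lp (fun _ : ℕ => C) ∞ →⋆ₙₐ[ℂ] Q),
      ∀ x, Tendsto (fun k => ‖x k‖) U (𝓝 ‖ρ x‖) := by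
  obtain ⟨H, _, _, _, π, hπ⟩ := exists_faithful_representation C
  obtain ⟨K, _, _, _, ρ, hρ⟩ := exists_rep_tendsto_norm
    (NonUnitalStarAlgHom.id ℂ (H →L[ℂ] H)) Function.injective_id (e := 1) rfl U
  refine ⟨K →L[ℂ] K, inferInstance, ρ.comp (lpMapStar π), fun x => ?_⟩
  refine (hρ (lpMapStar π x)).congr fun k => ?_
  exact NonUnitalStarAlgHom.norm_map π hπ (x k)

/-- Evaluation of bounded sequences. -/
noncomputable def lpEval (C : Type*) [NonUnitalCStarAlgebra C] (k : ℕ) :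
    lp (fun _ : ℕ => C) ∞ →⋆ₙₐ[ℂ] C where
  toFun x := x k
  map_smul' _ _ := rfl
  map_zero' := rfl
  map_add' _ _ := rfl
  map_mul' _ _ := rfl
  map_star' _ := rfl

lemma matrix_map_star_mul_self {A B : Type*} [NonUnitalCStarAlgebra A] [NonUnitalCStarAlgebra B]
    (π : A →⋆ₙₐ[ℂ] B) {n : ℕ} (X : Matrix (Fin n) (Fin n) A) :
    (star X * X).map π = star (X.map π) * X.map π := by
  ext k l
  simp [Matrix.mul_apply, Matrix.star_apply, map_star]

/-- If the norms converge along ⋆-homomorphisms, then so do the norms of matrices. -/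
lemma tendsto_matrixNorm_map {M C Q : Type*} [NonUnitalCStarAlgebra M]
    [NonUnitalCStarAlgebra C] [NonUnitalCStarAlgebra Q] {U : Ultrafilter ℕ}
    {ev : ℕ → M →⋆ₙₐ[ℂ] C} {ρ : M →⋆ₙₐ[ℂ] Q}
    (hρ : ∀ x, Tendsto (fun k => ‖ev k x‖) U (𝓝 ‖ρ x‖)) {n : ℕ}
    (X : Matrix (Fin n) (Fin n) M) :
    Tendsto (fun k => matrixNorm n (X.map (ev k))) U (𝓝 (matrixNorm n (X.map ρ))) := by
  obtain ⟨p, hp⟩ : ∃ p : Matrix (Fin n) (Fin n) M → ℝ,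
      ∀ X, Tendsto (fun k => matrixNorm n (X.map (ev k))) U (𝓝 (p X)) := by
    refine ⟨_, fun X => tendsto_ultraLim ⟨∑ k, ∑ l, ‖X k l‖, Eventually.of_forall fun j => ?_⟩⟩
    rw [abs_of_nonneg (matrixNorm_nonneg _)]
    refine (matrixNorm_le_sum _).trans ?_
    gcongr with k _ l _
    exact NonUnitalStarAlgHom.norm_apply_le (ev j) (X k l)
  have hp0 : ∀ X, 0 ≤ p X := fun X => ge_of_tendsto' (hp X) fun k => matrixNorm_nonneg _
  have hpstar : ∀ X, p (star X * X) = p X ^ 2 := fun X => by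
    refine tendsto_nhds_unique (hp (star X * X)) (((hp X).pow 2).congr fun j => ?_)
    rw [← matrixNorm_star_mul_self, matrix_map_star_mul_self]
  have hp'star : ∀ X : Matrix (Fin n) (Fin n) M,
      matrixNorm n ((star X * X).map ρ) = matrixNorm n (X.map ρ) ^ 2 := fun X => by
    rw [← matrixNorm_star_mul_self, matrix_map_star_mul_self]
  have h1 : ∀ X, p X ≤ n * n * matrixNorm n (X.map ρ) := fun X => by
    have h : p X ≤ ∑ k, ∑ l, ‖ρ (X k l)‖ :=
      le_of_tendsto_of_tendsto' (hp X) (tendsto_finsetSum _ fun k _ =>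
        tendsto_finsetSum _ fun l _ => hρ (X k l)) fun j => matrixNorm_le_sum _
    refine h.trans ?_
    calc ∑ k, ∑ l, ‖ρ (X k l)‖ ≤ ∑ k : Fin n, ∑ l : Fin n, matrixNorm n (X.map ρ) := by
          gcongr with k _ l _
          exact norm_entry_le_matrixNorm (X.map ρ) k l
      _ = n * n * matrixNorm n (X.map ρ) := by simp [mul_assoc]
  have h2 : ∀ X : Matrix (Fin n) (Fin n) M,
      matrixNorm n (X.map ρ) ≤ n * n * p X := fun X => by
    refine (matrixNorm_le_sum _).trans ?_
    calc ∑ k, ∑ l, ‖ρ (X k l)‖ ≤ ∑ k : Fin n, ∑ l : Fin n, p X := by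
          gcongr with k _ l _
          exact le_of_tendsto_of_tendsto' (hρ (X k l)) (hp X) fun j =>
            norm_entry_le_matrixNorm (X.map (ev j)) k l
      _ = n * n * p X := by simp [mul_assoc]
  have h3 := le_of_le_const_mul_of_star_mul_self (R := Matrix (Fin n) (Fin n) M)
    (p := fun X => matrixNorm n (X.map ρ)) (p' := p) hp0 hp'star hpstar h2 X
  have h4 := le_of_le_const_mul_of_star_mul_self (R := Matrix (Fin n) (Fin n) M)
    (p := p) (p' := fun X => matrixNorm n (X.map ρ)) (fun X => matrixNorm_nonneg _) hpstar
    hp'star h1 X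
  rw [le_antisymm h3 h4]
  exact hp X

end Ultrapower

/-! ### Iterated approximate liftings -/

section Tower

variable {C : Type u} {B : Type v} [NonUnitalCStarAlgebra C] [NonUnitalCStarAlgebra B]

/-- A sequence of approximate liftings `Ψ m : B → C` of `q`, on finite-dimensional spaces `F m`
that capture the ⋆-algebraic structure of `i (E m)`, with `Ψ m (F m) ⊆ E (m + 1)`. The maps
`Ψ m ∘ i : E m → E (m + 1)` form an inductive system whose limit is the algebra of the theorem. -/
structure LiftingTower (i q : C →⋆ₙₐ[ℂ] B) where
  /-- The finite-dimensional subspaces of `C`. -/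
  E : ℕ → Submodule ℂ C
  /-- The finite-dimensional subspaces of `B`. -/
  F : ℕ → Submodule ℂ B
  /-- The approximate liftings. -/
  Ψ : ℕ → B →ₗ[ℂ] C
  /-- The quality of the approximation. -/
  η : ℕ → ℝ
  finE : ∀ m, FiniteDimensional ℂ (E m)
  star_mem : ∀ m, ∀ x ∈ E m, star x ∈ E m
  η_pos : ∀ m, 0 < η m
  η_le : ∀ m, η m ≤ 1 / 4
  η_succ : ∀ m, η (m + 1) ≤ η m / 2
  almost : ∀ m, AlmostMorphismOn (η m) (F m) (Ψ m)
  approx : ∀ m, ∀ b ∈ F m, ‖q (Ψ m b) - b‖ ≤ η m * ‖b‖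
  map_mem : ∀ m, ∀ x ∈ E m, i x ∈ F m
  map_mul_mem : ∀ m, ∀ x ∈ E m, ∀ y ∈ E m, i (x * y) ∈ F m
  E_le : ∀ m, E m ≤ E (m + 1)
  Ψ_mem : ∀ m, ∀ b ∈ F m, Ψ m b ∈ E (m + 1)
  dense : ∀ c : C, ∀ ε > 0, ∃ m, ∃ x ∈ E m, ‖x - c‖ ≤ ε

namespace LiftingTower

variable {i q : C →⋆ₙₐ[ℂ] B} (S : LiftingTower i q)

lemma E_mono : Monotone S.E := monotone_nat_of_le_succ S.E_le

/-- The connecting maps. -/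
noncomputable def θ (m : ℕ) : C →ₗ[ℂ] C := S.Ψ m ∘ₗ (i : C →ₗ[ℂ] B)

lemma θ_apply (m : ℕ) (x : C) : S.θ m x = S.Ψ m (i x) := rfl

/-- The composition of the connecting maps from `E n` to `E k`; it is the identity for `k ≤ n`. -/
noncomputable def iter (n : ℕ) : ℕ → C →ₗ[ℂ] C
  | 0 => LinearMap.id
  | k + 1 => if n ≤ k then S.θ k ∘ₗ iter n k else LinearMap.id

lemma iter_of_le {n k : ℕ} (h : k ≤ n) : S.iter n k = LinearMap.id := by
  cases k with
  | zero => rfl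
  | succ k => rw [iter, if_neg (by omega)]

lemma iter_succ {n k : ℕ} (h : n ≤ k) (x : C) : S.iter n (k + 1) x = S.θ k (S.iter n k x) := by
  rw [iter, if_pos h]
  rfl

lemma iter_mem {n k : ℕ} (h : n ≤ k) {x : C} (hx : x ∈ S.E n) : S.iter n k x ∈ S.E k := by
  induction k, h using Nat.le_induction with
  | base => rwa [iter_of_le _ le_rfl]
  | succ k hk ih =>
    rw [iter_succ _ hk]
    exact S.Ψ_mem k _ (S.map_mem k _ ih)

lemma iter_succ_left {n k : ℕ} (h : n + 1 ≤ k) (x : C) :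
    S.iter n k x = S.iter (n + 1) k (S.θ n x) := by
  induction k, h using Nat.le_induction with
  | base =>
    rw [iter_succ _ le_rfl, iter_of_le _ le_rfl, iter_of_le _ le_rfl]
    rfl
  | succ k hk ih => rw [iter_succ _ (by omega), iter_succ _ hk, ih]

lemma norm_Ψ_le (m : ℕ) {b : B} (hb : b ∈ S.F m) : ‖S.Ψ m b‖ ≤ (1 + S.η m) * ‖b‖ :=
  (S.almost m).norm_le b hb

lemma norm_iter_le {n k : ℕ} (h : n ≤ k) {x : C} (hx : x ∈ S.E n) :
    ‖S.iter n k x‖ ≤ (1 + 4 * S.η n - 4 * S.η k) * ‖x‖ := by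
  induction k, h using Nat.le_induction with
  | base => simp [iter_of_le]
  | succ k hk ih =>
    rw [iter_succ _ hk, θ_apply]
    have h1 := S.norm_Ψ_le k (S.map_mem k _ (S.iter_mem hk hx))
    have h2 := NonUnitalStarAlgHom.norm_apply_le i (S.iter n k x)
    have h3 := S.η_pos k
    have h4 := S.η_le n
    have h5 := S.η_succ k
    calc _ ≤ (1 + S.η k) * ((1 + 4 * S.η n - 4 * S.η k) * ‖x‖) :=
          h1.trans (by gcongr; exact h2.trans ih)
      _ = ((1 + S.η k) * (1 + 4 * S.η n - 4 * S.η k)) * ‖x‖ := by ring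
      _ ≤ _ := by
          gcongr
          nlinarith

lemma η_anti : Antitone S.η := antitone_nat_of_succ_le fun m => by
  linarith [S.η_succ m, S.η_pos m]

lemma norm_iter_le_two_mul (n k : ℕ) {x : C} (hx : x ∈ S.E n) : ‖S.iter n k x‖ ≤ 2 * ‖x‖ := by
  rcases le_total n k with h | h
  · refine (S.norm_iter_le h hx).trans ?_
    gcongr
    linarith [S.η_pos k, S.η_le n]
  · rw [iter_of_le _ h]
    simp only [LinearMap.id_apply]
    linarith [norm_nonneg x]

lemma iter_star {n k : ℕ} (h : n ≤ k) {x : C} (hx : x ∈ S.E n) :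
    S.iter n k (star x) = star (S.iter n k x) := by
  induction k, h using Nat.le_induction with
  | base => simp [iter_of_le]
  | succ k hk ih =>
    have h1 := S.iter_mem hk hx
    rw [iter_succ _ hk, iter_succ _ hk, ih, θ_apply, θ_apply, map_star i]
    refine (S.almost k).map_star _ (S.map_mem k _ h1) ?_
    rw [← map_star i]
    exact S.map_mem k _ (S.star_mem k _ h1)

/-- Approximate products are preserved with an error that stays small along the system. -/
lemma norm_iter_mul_sub_le {n k : ℕ} (h : n ≤ k) {x y z : C} (hx : x ∈ S.E n) (hy : y ∈ S.E n)
    (hz : z ∈ S.E n) : ‖S.iter n k x * S.iter n k y - S.iter n k z‖ ≤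
      (1 + 4 * S.η n - 4 * S.η k) * ‖x * y - z‖ + 16 * (S.η n - S.η k) * (‖x‖ * ‖y‖) := by
  induction k, h using Nat.le_induction with
  | base => simp [iter_of_le]
  | succ k hk ih =>
    have ha := S.iter_mem hk hx
    have hb := S.iter_mem hk hy
    have hc := S.iter_mem hk hz
    have hna := S.norm_iter_le_two_mul n k hx
    have hnb := S.norm_iter_le_two_mul n k hy
    simp only [iter_succ _ hk, θ_apply]
    set a := S.iter n k x
    set b := S.iter n k y
    set c := S.iter n k z
    have h1 := (S.almost k).mul_approx _ (S.map_mem k _ ha) _ (S.map_mem k _ hb)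
      (by rw [← map_mul]; exact S.map_mul_mem k _ ha _ hb)
    have h2 := S.norm_Ψ_le k (b := i (a * b - c)) (by
      rw [map_sub]
      exact Submodule.sub_mem _ (S.map_mul_mem k _ ha _ hb) (S.map_mem k _ hc))
    have h3 : S.Ψ k (i a) * S.Ψ k (i b) - S.Ψ k (i c) =
        -(S.Ψ k (i a * i b) - S.Ψ k (i a) * S.Ψ k (i b)) + S.Ψ k (i (a * b - c)) := by
      rw [map_sub i, map_sub, map_mul i]
      abel
    rw [h3]
    refine (norm_add_le _ _).trans ?_
    rw [norm_neg]
    have e0 := S.η_pos k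
    have e1 := S.η_le n
    have e2 := S.η_succ k
    have e3 := S.η_anti hk
    have h4 : S.η k * ‖i a‖ * ‖i b‖ ≤ 4 * S.η k * (‖x‖ * ‖y‖) := by
      calc S.η k * ‖i a‖ * ‖i b‖ ≤ S.η k * (2 * ‖x‖) * (2 * ‖y‖) := by
            gcongr
            · exact (NonUnitalStarAlgHom.norm_apply_le i a).trans hna
            · exact (NonUnitalStarAlgHom.norm_apply_le i b).trans hnb
        _ = _ := by ring
    have h5 : (1 + S.η k) * ‖i (a * b - c)‖ ≤ (1 + S.η k) *
        ((1 + 4 * S.η n - 4 * S.η k) * ‖x * y - z‖ + 16 * (S.η n - S.η k) * (‖x‖ * ‖y‖)) := by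
      gcongr
      exact (NonUnitalStarAlgHom.norm_apply_le i _).trans ih
    have h6 : (1 + S.η k) * (1 + 4 * S.η n - 4 * S.η k) * ‖x * y - z‖ ≤
        (1 + 4 * S.η n - 4 * S.η (k + 1)) * ‖x * y - z‖ := by
      gcongr
      nlinarith
    have h7 : ((1 + S.η k) * (16 * (S.η n - S.η k)) + 4 * S.η k) * (‖x‖ * ‖y‖) ≤
        16 * (S.η n - S.η (k + 1)) * (‖x‖ * ‖y‖) := by
      gcongr
      nlinarith
    linarith

/-- If the quality of the liftings beats the perturbation constants of the spaces `E m`, then the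
connecting maps are almost completely isometric from below, since `q` is completely contractive. -/
lemma matrixNorm_le_iter (hi : Function.Injective i) {ε : ℕ → ℝ} (hε0 : ∀ m, 0 ≤ ε m)
    (hε1 : ∀ m, ε m ≤ 1 / 2) (hε : ∀ m, ε (m + 1) ≤ ε m / 2)
    (hpert : ∀ m (w : (S.E m) →ₗ[ℂ] B), (∀ z, ‖w z‖ ≤ S.η m * ‖z‖) → ∀ (n : ℕ)
      (X : Matrix (Fin n) (Fin n) (S.E m)),
      matrixNorm n (X.map w) ≤ ε m * matrixNorm n (X.map fun z => (z : C)))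
    {m k : ℕ} (h : m ≤ k) {n : ℕ} (X : Matrix (Fin n) (Fin n) C) (hX : ∀ a b, X a b ∈ S.E m) :
    (1 - 2 * ε m + 2 * ε k) * matrixNorm n X ≤ matrixNorm n (X.map (S.iter m k)) := by
  induction k, h using Nat.le_induction with
  | base => simp [iter_of_le]
  | succ k hk ih =>
    set Y := X.map (S.iter m k) with hY
    have hYE : ∀ a b, Y a b ∈ S.E k := fun a b => S.iter_mem hk (hX a b)
    let Y' : Matrix (Fin n) (Fin n) (S.E k) := Matrix.of fun a b => ⟨Y a b, hYE a b⟩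
    let w : S.E k →ₗ[ℂ] B := (((q : C →ₗ[ℂ] B) ∘ₗ S.θ k) - (i : C →ₗ[ℂ] B)) ∘ₗ (S.E k).subtype
    have hw : ∀ z, ‖w z‖ ≤ S.η k * ‖z‖ := fun z => by
      refine (S.approx k _ (S.map_mem k _ z.2)).trans ?_
      have := S.η_pos k
      gcongr
      exact NonUnitalStarAlgHom.norm_apply_le i _
    have h1 := hpert k w hw n Y'
    have h2 : X.map (S.iter m (k + 1)) = Y.map (S.θ k) := by
      ext a b
      exact S.iter_succ hk _
    have h3 : Y.map i - (Y.map (S.θ k)).map q = -(Y'.map w) := by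
      ext a b
      simp [w, Y']
    have h4 := matrixNorm_le_add_sub (Y.map i) ((Y.map (S.θ k)).map q)
    rw [h3, matrixNorm_neg, matrixNorm_map_eq hi] at h4
    have h5 := matrixNorm_map_le q (Y.map (S.θ k))
    have h6 : Y'.map (fun z => (z : C)) = Y := rfl
    rw [h6] at h1
    rw [h2]
    have e1 : (1 - ε k) * matrixNorm n Y ≤ matrixNorm n (Y.map (S.θ k)) := by linarith
    have e2 := hε k
    have e3 := hε0 k
    have e4 := hε1 k
    have e5 : ε k ≤ ε m := antitone_nat_of_succ_le
      (fun j => (hε j).trans (by linarith [hε0 j])) hk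
    refine le_trans ?_ ((mul_le_mul_of_nonneg_left ih (by linarith)).trans e1)
    rw [← mul_assoc]
    gcongr
    · exact matrixNorm_nonneg X
    · nlinarith

end LiftingTower

end Tower

section TowerExistence

lemma exists_star_closed_submodule {B : Type*} [NonUnitalCStarAlgebra B] (F₀ : Submodule ℂ B)
    [hF : FiniteDimensional ℂ F₀] :
    ∃ F : Submodule ℂ B, FiniteDimensional ℂ F ∧ F₀ ≤ F ∧ ∀ x ∈ F, star x ∈ F := by
  obtain ⟨s, hs⟩ := (Submodule.fg_iff_finiteDimensional F₀).2 hF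
  have hfin : ((s : Set B) ∪ star '' (s : Set B)).Finite :=
    s.finite_toSet.union (s.finite_toSet.image _)
  refine ⟨Submodule.span ℂ ((s : Set B) ∪ star '' (s : Set B)),
    FiniteDimensional.span_of_finite ℂ hfin, ?_, fun x hx => ?_⟩
  · rw [← hs]
    exact Submodule.span_mono Set.subset_union_left
  · induction hx using Submodule.span_induction with
    | zero => simp
    | add x y _ _ hx hy => rw [star_add]; exact Submodule.add_mem _ hx hy
    | smul c x _ hx => rw [star_smul]; exact Submodule.smul_mem _ _ hx
    | mem x hx =>
      refine Submodule.subset_span ?_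
      rcases hx with hx | ⟨y, hy, rfl⟩
      · exact Or.inr ⟨x, hx, rfl⟩
      · rw [star_star]
        exact Or.inl hy

variable {C : Type u} {B : Type v} [NonUnitalCStarAlgebra C] [NonUnitalCStarAlgebra B]

lemma AlmostAllowsLiftings.exists_almostMorphismOn {q : C →⋆ₙₐ[ℂ] B} (hq : AlmostAllowsLiftings q)
    {ε : ℝ} (hε : 0 < ε) (F : Submodule ℂ B) (hF : FiniteDimensional ℂ F)
    (hstar : ∀ x ∈ F, star x ∈ F) :
    ∃ Ψ : B →ₗ[ℂ] C, AlmostMorphismOn ε F Ψ ∧ ∀ b ∈ F, ‖q (Ψ b) - b‖ ≤ ε * ‖b‖ := by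
  obtain ⟨ψ, hψ, hqψ⟩ := hq ε hε F hF hstar
  obtain ⟨Ψ, hΨ⟩ := LinearMap.exists_extend ψ
  have hval : ∀ x : F, Ψ x = ψ x := fun x => LinearMap.congr_fun hΨ x
  have hval' : ∀ (x : B) (hx : x ∈ F), Ψ x = ψ ⟨x, hx⟩ := fun x hx => hval ⟨x, hx⟩
  refine ⟨Ψ, ⟨fun x hx => ?_, fun x hx y hy hxy => ?_, fun x hx hx' => ?_⟩, fun b hb => ?_⟩
  · rw [hval' x hx]
    exact hψ.norm_le ⟨x, hx⟩
  · rw [hval' x hx, hval' y hy, hval' _ hxy]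
    exact hψ.mul_approx ⟨x, hx⟩ ⟨y, hy⟩ hxy
  · rw [hval' x hx, hval' _ hx']
    exact hψ.map_star ⟨x, hx⟩ hx'
  · rw [hval' b hb]
    exact hqψ ⟨b, hb⟩

/-- Lifting towers exist, and at every stage one may prescribe finitely many dimensions on which
the next lifting has to be good, and a bound for its quality. -/
lemma exists_liftingTower [TopologicalSpace.SeparableSpace C] (i q : C →⋆ₙₐ[ℂ] B)
    (hq : AlmostAllowsLiftings q) (P : ℕ → Submodule ℂ C → Submodule ℂ B → ℝ → Prop)
    (hP : ∀ m (E : Submodule ℂ C), FiniteDimensional ℂ E → ∃ (F₀ : Submodule ℂ B) (δ : ℝ),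
      FiniteDimensional ℂ F₀ ∧ 0 < δ ∧ ∀ F η, F₀ ≤ F → η ≤ δ → 0 < η → P m E F η) :
    ∃ S : LiftingTower i q, ∀ m, P m (S.E m) (S.F m) (S.η m) := by
  let State := {p : Submodule ℂ C × ℝ //
    FiniteDimensional ℂ p.1 ∧ (∀ x ∈ p.1, star x ∈ p.1) ∧ 0 < p.2}
  have hne : Nonempty C := ⟨0⟩
  have hstep : ∀ (m : ℕ) (s : State), ∃ (F : Submodule ℂ B) (Ψ : B →ₗ[ℂ] C) (η : ℝ) (s' : State),
      s'.1.2 = η / 2 ∧ 0 < η ∧ η ≤ s.1.2 ∧ AlmostMorphismOn η F Ψ ∧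
      (∀ b ∈ F, ‖q (Ψ b) - b‖ ≤ η * ‖b‖) ∧ (∀ x ∈ s.1.1, i x ∈ F) ∧
      (∀ x ∈ s.1.1, ∀ y ∈ s.1.1, i (x * y) ∈ F) ∧ s.1.1 ≤ s'.1.1 ∧ (∀ b ∈ F, Ψ b ∈ s'.1.1) ∧
      TopologicalSpace.denseSeq C m ∈ s'.1.1 ∧ P m s.1.1 F η := by
    rintro m ⟨⟨E, η₀⟩, hE, hEstar, hη₀⟩
    obtain ⟨F₀, δ, hF₀, hδ, hPF⟩ := hP m E hE
    have hEE : FiniteDimensional ℂ (Submodule.map₂ (LinearMap.mul ℂ C) E E) :=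
      (Submodule.fg_iff_finiteDimensional _).1
        (((Submodule.fg_iff_finiteDimensional E).2 hE).map₂ _
          ((Submodule.fg_iff_finiteDimensional E).2 hE))
    obtain ⟨F, hF, hle, hFstar⟩ := exists_star_closed_submodule
      (F₀ ⊔ E.map (i : C →ₗ[ℂ] B) ⊔
        (Submodule.map₂ (LinearMap.mul ℂ C) E E).map (i : C →ₗ[ℂ] B))
    obtain ⟨Ψ, hΨ, hΨq⟩ := hq.exists_almostMorphismOn (lt_min hδ hη₀) F hF hFstar
    obtain ⟨E', hE', hle', hE'star⟩ := exists_star_closed_submodule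
      (E ⊔ F.map Ψ ⊔ Submodule.span ℂ {TopologicalSpace.denseSeq C m})
    have hpos : 0 < min δ η₀ := lt_min hδ hη₀
    refine ⟨F, Ψ, min δ η₀, ⟨⟨E', min δ η₀ / 2⟩, hE', hE'star, half_pos hpos⟩, rfl, hpos,
      min_le_right _ _, hΨ, hΨq, fun x hx => hle ?_, fun x hx y hy => hle ?_,
      le_sup_left.trans (le_sup_left.trans hle'), fun b hb => hle' ?_, hle' ?_,
      hPF F _ (le_sup_left.trans (le_sup_left.trans hle)) (min_le_left _ _) hpos⟩
    · exact Submodule.mem_sup_left (Submodule.mem_sup_right (Submodule.mem_map_of_mem hx))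
    · exact Submodule.mem_sup_right
        (Submodule.mem_map_of_mem (f := (i : C →ₗ[ℂ] B))
          (Submodule.apply_mem_map₂ (LinearMap.mul ℂ C) hx hy))
    · exact Submodule.mem_sup_left (Submodule.mem_sup_right (Submodule.mem_map_of_mem hb))
    · exact Submodule.mem_sup_right (Submodule.mem_span_singleton_self _)
  choose F Ψ η s' hs'η hηpos hηle halm happ hmem hmul hle hΨmem hdense hPm using hstep
  let s₀ : State := ⟨⟨⊥, 1 / 4⟩, inferInstance, by simp, by norm_num⟩
  let st : ℕ → State := fun m => Nat.rec s₀ (fun m s => s' m s) m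
  have hst : ∀ m, st (m + 1) = s' m (st m) := fun m => rfl
  have hst4 : ∀ m, (st m).1.2 ≤ 1 / 4 := fun m => by
    induction m with
    | zero => exact le_rfl
    | succ m ih =>
      rw [hst, hs'η]
      linarith [hηle m (st m), hηpos m (st m)]
  refine ⟨{ E := fun m => (st m).1.1
            F := fun m => F m (st m)
            Ψ := fun m => Ψ m (st m)
            η := fun m => η m (st m)
            finE := fun m => (st m).2.1
            star_mem := fun m => (st m).2.2.1
            η_pos := fun m => hηpos m _
            η_le := fun m => (hηle m _).trans (hst4 m)
            η_succ := fun m => (hηle (m + 1) _).trans (by rw [hst, hs'η])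
            almost := fun m => halm m _
            approx := fun m => happ m _
            map_mem := fun m => hmem m _
            map_mul_mem := fun m => hmul m _
            E_le := fun m => hle m _
            Ψ_mem := fun m => hΨmem m _
            dense := fun c ε hε => ?_ }, fun m => hPm m _⟩
  obtain ⟨m, hm⟩ := (TopologicalSpace.denseRange_denseSeq C).exists_dist_lt c hε
  refine ⟨m + 1, _, hdense m (st m), ?_⟩
  rw [← dist_eq_norm, dist_comm]
  exact hm.le

end TowerExistence

/-! ### The limit algebra of a tower -/

section LimitAlgebra

open Filter Topology

lemma matrixNorm_one {A : Type*} [NonUnitalCStarAlgebra A] (a : A) :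
    matrixNorm 1 (Matrix.of fun _ _ => a) = ‖a‖ := by
  refine le_antisymm ((matrixNorm_le_sum _).trans (by simp)) ?_
  exact norm_entry_le_matrixNorm (Matrix.of fun _ _ => a : Matrix (Fin 1) (Fin 1) A) 0 0

variable {C : Type u} {B : Type v} [NonUnitalCStarAlgebra C] [NonUnitalCStarAlgebra B]
  {i q : C →⋆ₙₐ[ℂ] B}

namespace LiftingTower

variable (S : LiftingTower i q)

/-- The maps `Θ m : E m → A` are limits of the compositions of connecting maps. They are required
to be defined on all of `C` for convenience only. -/
structure IsLimit {A : Type*} [NonUnitalCStarAlgebra A] (Θ : ℕ → C →ₗ[ℂ] A) : Prop where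
  norm_le : ∀ m, ∀ x ∈ S.E m, ‖Θ m x‖ ≤ (1 + 4 * S.η m) * ‖x‖
  mul_sub_le : ∀ m, ∀ x ∈ S.E m, ∀ y ∈ S.E m, ∀ z ∈ S.E m,
    ‖Θ m x * Θ m y - Θ m z‖ ≤ 2 * ‖x * y - z‖ + 16 * S.η m * (‖x‖ * ‖y‖)
  map_star : ∀ m, ∀ x ∈ S.E m, Θ m (star x) = star (Θ m x)
  compat : ∀ m, ∀ x ∈ S.E m, Θ m x = Θ (m + 1) (S.θ m x)
  le_matrixNorm : ∀ m n (X : Matrix (Fin n) (Fin n) C), (∀ a b, X a b ∈ S.E m) → ∀ c : ℝ,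
    (∀ k ≥ m, c * matrixNorm n X ≤ matrixNorm n (X.map (S.iter m k))) →
    c * matrixNorm n X ≤ matrixNorm n (X.map (Θ m))

/-- The orbit of an element of `E n` under the connecting maps. -/
noncomputable def orbit (n : ℕ) : S.E n →ₗ[ℂ] lp (fun _ : ℕ => C) ∞ where
  toFun x := ⟨fun k => S.iter n k x, memℓp_infty ⟨2 * ‖x‖, by
    rintro _ ⟨k, rfl⟩
    exact S.norm_iter_le_two_mul n k x.2⟩⟩
  map_add' x y := by ext k; exact map_add (S.iter n k) _ _
  map_smul' c x := by ext k; exact map_smul (S.iter n k) c _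

/-- The limit maps exist in the ultrapower of `C`: they send an element to its orbit. -/
lemma exists_isLimit : ∃ (Q : Type u) (_ : NonUnitalCStarAlgebra Q) (Θ : ℕ → C →ₗ[ℂ] Q),
    S.IsLimit Θ := by
  obtain ⟨Q, _, ρ, hρ⟩ := exists_ultrapower C (hyperfilter ℕ)
  choose Θ hΘ using fun n => LinearMap.exists_extend ((ρ : _ →ₗ[ℂ] Q) ∘ₗ S.orbit n)
  have hval : ∀ n x (hx : x ∈ S.E n), Θ n x = ρ (S.orbit n ⟨x, hx⟩) := fun n x hx =>
    LinearMap.congr_fun (hΘ n) ⟨x, hx⟩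
  have hge : ∀ m : ℕ, ∀ᶠ k in (hyperfilter ℕ : Filter ℕ), m ≤ k := fun m =>
    (Nat.hyperfilter_le_atTop (eventually_ge_atTop m))
  have heq : ∀ (m : ℕ) (s t : lp (fun _ : ℕ => C) ∞), (∀ k ≥ m, s k = t k) → ρ s = ρ t := by
    intro m s t hst
    rw [← sub_eq_zero, ← map_sub, ← norm_eq_zero]
    refine tendsto_nhds_unique (hρ (s - t)) (tendsto_const_nhds.congr' ?_)
    filter_upwards [hge m] with k hk
    rw [lp.coeFn_sub, Pi.sub_apply, hst k hk, sub_self, norm_zero]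
  refine ⟨Q, inferInstance, Θ, ⟨fun m x hx => ?_, fun m x hx y hy z hz => ?_, fun m x hx => ?_,
    fun m x hx => ?_, fun m n X hX c hc => ?_⟩⟩
  · rw [hval m x hx]
    refine le_of_tendsto (hρ _) ?_
    filter_upwards [hge m] with k hk
    refine (S.norm_iter_le hk hx).trans ?_
    gcongr
    linarith [S.η_pos k]
  · rw [hval m x hx, hval m y hy, hval m z hz, ← map_mul, ← map_sub]
    refine le_of_tendsto (hρ _) ?_
    filter_upwards [hge m] with k hk
    refine (S.norm_iter_mul_sub_le hk hx hy hz).trans ?_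
    have := S.η_pos k
    have := S.η_le m
    gcongr
    · linarith
    · linarith
  · rw [hval m x hx, hval m _ (S.star_mem m x hx), ← map_star]
    exact heq m _ _ fun k hk => S.iter_star hk hx
  · have hx' : S.θ m x ∈ S.E (m + 1) := S.Ψ_mem m _ (S.map_mem m x hx)
    rw [hval m x hx, hval (m + 1) _ hx']
    exact heq (m + 1) _ _ fun k hk => S.iter_succ_left hk x
  · let X' : Matrix (Fin n) (Fin n) (lp (fun _ : ℕ => C) ∞) :=
      Matrix.of fun a b => S.orbit m ⟨X a b, hX a b⟩
    have h1 : X.map (Θ m) = X'.map ρ := by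
      ext a b
      exact hval m _ (hX a b)
    rw [h1]
    refine ge_of_tendsto (tendsto_matrixNorm_map (ev := lpEval C) hρ X') ?_
    filter_upwards [hge m] with k hk using hc k hk

variable {S}

namespace IsLimit

variable {A : Type*} [NonUnitalCStarAlgebra A] {Θ : ℕ → C →ₗ[ℂ] A}

/-- The limit maps, composed with the liftings, are almost morphisms on `F m`. -/
lemma almostMorphismOn (h : S.IsLimit Θ) (m : ℕ) :
    AlmostMorphismOn (40 * S.η m) (S.F m) (Θ (m + 1) ∘ₗ S.Ψ m) where
  norm_le b hb := by
    have h0 := S.η_pos m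
    have h1 := S.η_le m
    have h2 := S.η_succ m
    have h3 := S.η_pos (m + 1)
    refine (h.norm_le (m + 1) _ (S.Ψ_mem m b hb)).trans ?_
    calc _ ≤ (1 + 4 * S.η (m + 1)) * ((1 + S.η m) * ‖b‖) := by
          gcongr
          exact S.norm_Ψ_le m hb
      _ = ((1 + 4 * S.η (m + 1)) * (1 + S.η m)) * ‖b‖ := by ring
      _ ≤ _ := by
          gcongr
          nlinarith
  mul_approx a ha b hb hab := by
    have h0 := S.η_pos m
    have h1 := S.η_le m
    have h2 := S.η_succ m
    have h3 := S.η_pos (m + 1)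
    have h4 := h.mul_sub_le (m + 1) _ (S.Ψ_mem m a ha) _ (S.Ψ_mem m b hb) _ (S.Ψ_mem m _ hab)
    have h5 := (S.almost m).mul_approx a ha b hb hab
    rw [norm_sub_rev] at h4 h5
    have h6 : ‖S.Ψ m a‖ * ‖S.Ψ m b‖ ≤ (2 * ‖a‖) * (2 * ‖b‖) := by
      have hΨ : ∀ b ∈ S.F m, ‖S.Ψ m b‖ ≤ 2 * ‖b‖ := fun b hb =>
        (S.norm_Ψ_le m hb).trans (by gcongr; linarith)
      gcongr
      · exact hΨ a ha
      · exact hΨ b hb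
    have h7 : 16 * S.η (m + 1) * (‖S.Ψ m a‖ * ‖S.Ψ m b‖) ≤
        16 * (S.η m / 2) * ((2 * ‖a‖) * (2 * ‖b‖)) := by gcongr
    have h8 : 0 ≤ S.η m * (‖a‖ * ‖b‖) := by positivity
    simp only [LinearMap.comp_apply]
    linarith
  map_star b hb hb' := by
    simp only [LinearMap.comp_apply]
    rw [(S.almost m).map_star b hb hb', h.map_star _ _ (S.Ψ_mem m b hb)]

lemma comp_iter (h : S.IsLimit Θ) {n m : ℕ} (hnm : n ≤ m) {x : C} (hx : x ∈ S.E n) :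
    Θ n x = Θ m (S.iter n m x) := by
  induction m, hnm using Nat.le_induction with
  | base => rw [iter_of_le _ le_rfl, LinearMap.id_apply]
  | succ m hm ih => rw [ih, h.compat m _ (S.iter_mem hm hx), S.iter_succ hm]

end IsLimit

/-- The limit algebra: the closure of the union of the spaces `Θ m (E m)`. That it is closed under
products comes from the almost multiplicativity of `Θ (m + 1) ∘ Ψ m` on `F m ∋ i (x * y)`. -/
lemma IsLimit.exists_separable {Q : Type u} [NonUnitalCStarAlgebra Q] {Θ : ℕ → C →ₗ[ℂ] Q}
    (h : S.IsLimit Θ) (hη : Tendsto S.η atTop (𝓝 0))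
    (hlow : ∀ m, ∀ x ∈ S.E m, ‖x‖ ≤ 2 * ‖Θ m x‖) :
    ∃ (A : Type u) (_ : NonUnitalCStarAlgebra A) (Θ' : ℕ → C →ₗ[ℂ] A),
      TopologicalSpace.SeparableSpace A ∧ S.IsLimit Θ' ∧
      ∀ a : A, ∀ ε > 0, ∃ N, ∀ m ≥ N, ∃ x ∈ S.E m, ‖Θ' m x - a‖ ≤ ε := by
  let R : NonUnitalStarSubalgebra ℂ Q :=
    { carrier := {a | ∀ ε > 0, ∃ N, ∀ m ≥ N, ∃ x ∈ S.E m, ‖Θ m x - a‖ ≤ ε}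
      zero_mem' := fun ε hε => ⟨0, fun m _ => ⟨0, Submodule.zero_mem _, by simpa using hε.le⟩⟩
      add_mem' := by
        intro a b ha hb ε hε
        obtain ⟨N, hN⟩ := ha (ε / 2) (half_pos hε)
        obtain ⟨N', hN'⟩ := hb (ε / 2) (half_pos hε)
        refine ⟨max N N', fun m hm => ?_⟩
        obtain ⟨x, hx, hxa⟩ := hN m (le_of_max_le_left hm)
        obtain ⟨y, hy, hyb⟩ := hN' m (le_of_max_le_right hm)
        refine ⟨x + y, Submodule.add_mem _ hx hy, ?_⟩
        rw [map_add, add_sub_add_comm]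
        exact (norm_add_le _ _).trans (by linarith)
      smul_mem' := by
        intro c a ha ε hε
        obtain ⟨N, hN⟩ := ha (ε / (‖c‖ + 1)) (by positivity)
        refine ⟨N, fun m hm => ?_⟩
        obtain ⟨x, hx, hxa⟩ := hN m hm
        refine ⟨c • x, Submodule.smul_mem _ _ hx, ?_⟩
        rw [map_smul, ← smul_sub, norm_smul]
        rw [le_div_iff₀ (by positivity)] at hxa
        nlinarith [norm_nonneg (Θ m x - a)]
      star_mem' := by
        intro a ha ε hε
        obtain ⟨N, hN⟩ := ha ε hε
        refine ⟨N, fun m hm => ?_⟩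
        obtain ⟨x, hx, hxa⟩ := hN m hm
        refine ⟨star x, S.star_mem m x hx, ?_⟩
        rwa [h.map_star m x hx, ← star_sub, norm_star]
      mul_mem' := by
        intro a b ha hb ε hε
        let M := 2 * (‖a‖ + 1) * (2 * (‖b‖ + 1))
        have hlim : Tendsto (fun m => 40 * S.η m * M) atTop (𝓝 0) := by
          simpa only [mul_zero, zero_mul] using (hη.const_mul 40).mul_const M
        obtain ⟨N₀, hN₀⟩ := eventually_atTop.1 (hlim.eventually_le_const (half_pos hε))
        let δ := min 1 (ε / (2 * (‖a‖ + ‖b‖ + 2)))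
        have hδ : 0 < δ := lt_min one_pos (by positivity)
        obtain ⟨N, hN⟩ := ha δ hδ
        obtain ⟨N', hN'⟩ := hb δ hδ
        refine ⟨max (max N N') N₀ + 1, fun m hm => ?_⟩
        obtain ⟨k, rfl⟩ : ∃ k, m = k + 1 := ⟨m - 1, by omega⟩
        have hk : max (max N N') N₀ ≤ k := by omega
        obtain ⟨x, hx, hxa⟩ := hN k (le_of_max_le_left (le_of_max_le_left hk))
        obtain ⟨y, hy, hyb⟩ := hN' k (le_of_max_le_right (le_of_max_le_left hk))
        refine ⟨S.Ψ k (i (x * y)), S.Ψ_mem k _ (S.map_mul_mem k x hx y hy), ?_⟩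
        have h1 := (h.almostMorphismOn k).mul_approx _ (S.map_mem k x hx) _ (S.map_mem k y hy)
          (by rw [← map_mul]; exact S.map_mul_mem k x hx y hy)
        simp only [LinearMap.comp_apply] at h1
        rw [← map_mul, ← θ_apply S k x, ← θ_apply S k y, ← h.compat k x hx,
          ← h.compat k y hy] at h1
        have hδ1 : δ ≤ 1 := min_le_left _ _
        have hna : ‖Θ k x‖ ≤ ‖a‖ + 1 := by
          have := norm_le_norm_add_norm_sub' (Θ k x) a
          linarith
        have hnb : ‖Θ k y‖ ≤ ‖b‖ + 1 := by
          have := norm_le_norm_add_norm_sub' (Θ k y) b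
          linarith
        have h2 : 40 * S.η k * ‖i x‖ * ‖i y‖ ≤ ε / 2 := by
          refine le_trans ?_ (hN₀ k (le_of_max_le_right hk))
          have := S.η_pos k
          rw [mul_assoc (40 * S.η k)]
          refine mul_le_mul_of_nonneg_left (mul_le_mul ?_ ?_ (norm_nonneg _) (by positivity))
            (by positivity)
          · exact (NonUnitalStarAlgHom.norm_apply_le i x).trans
              ((hlow k x hx).trans (by gcongr))
          · exact (NonUnitalStarAlgHom.norm_apply_le i y).trans
              ((hlow k y hy).trans (by gcongr))
        have h3 : ‖Θ k x * Θ k y - a * b‖ ≤ ε / 2 := by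
          have e1 : Θ k x * Θ k y - a * b = (Θ k x - a) * Θ k y + a * (Θ k y - b) := by
            noncomm_ring
          rw [e1]
          refine (norm_add_le _ _).trans ?_
          have e2 : ‖(Θ k x - a) * Θ k y‖ ≤ δ * (‖b‖ + 1) :=
            (norm_mul_le _ _).trans (by gcongr)
          have e3 : ‖a * (Θ k y - b)‖ ≤ (‖a‖ + 1) * δ :=
            (norm_mul_le _ _).trans (by gcongr; linarith)
          have e4 : δ ≤ ε / (2 * (‖a‖ + ‖b‖ + 2)) := min_le_right _ _
          rw [le_div_iff₀ (by positivity)] at e4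
          linarith
        have h4 : Θ (k + 1) (S.Ψ k (i (x * y))) - a * b =
            (Θ (k + 1) (S.Ψ k (i (x * y))) - Θ k x * Θ k y) + (Θ k x * Θ k y - a * b) := by abel
        rw [h4]
        exact (norm_add_le _ _).trans (by linarith) }
  have hmemR : ∀ a, a ∈ R ↔ ∀ ε > 0, ∃ N, ∀ m ≥ N, ∃ x ∈ S.E m, ‖Θ m x - a‖ ≤ ε := fun a => Iff.rfl
  have hR : IsClosed (R : Set Q) := by
    refine isClosed_of_closure_subset fun a ha => ?_
    refine (hmemR a).2 fun ε hε => ?_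
    obtain ⟨b, hb, hab⟩ := Metric.mem_closure_iff.1 ha (ε / 2) (half_pos hε)
    obtain ⟨N, hN⟩ := (hmemR b).1 hb (ε / 2) (half_pos hε)
    refine ⟨N, fun m hm => ?_⟩
    obtain ⟨x, hx, hxb⟩ := hN m hm
    refine ⟨x, hx, ?_⟩
    rw [dist_comm, dist_eq_norm] at hab
    have := norm_add_le (Θ m x - b) (b - a)
    rw [sub_add_sub_cancel] at this
    linarith
  have hΘR : ∀ m, ∀ x ∈ S.E m, Θ m x ∈ R := fun m x hx => (hmemR _).2 fun ε hε =>
    ⟨m, fun k hk => ⟨S.iter m k x, S.iter_mem hk hx, by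
      rw [← h.comp_iter hk hx, sub_self, norm_zero]
      exact hε.le⟩⟩
  have : IsClosed (R : Set Q) := hR
  let f : ∀ m, S.E m →ₗ[ℂ] R := fun m =>
    { toFun := fun x => ⟨Θ m x, hΘR m x x.2⟩
      map_add' := fun x y => Subtype.ext (map_add (Θ m) _ _)
      map_smul' := fun c x => Subtype.ext (map_smul (Θ m) c _) }
  choose Θ' hΘ' using fun m => LinearMap.exists_extend (f m)
  have hval : ∀ m, ∀ x ∈ S.E m, (Θ' m x : Q) = Θ m x := fun m x hx =>
    congrArg Subtype.val (LinearMap.congr_fun (hΘ' m) ⟨x, hx⟩)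
  refine ⟨R, inferInstance, Θ', ?_, ⟨fun m x hx => ?_, fun m x hx y hy z hz => ?_,
    fun m x hx => ?_, fun m x hx => ?_, fun m n X hX c hc => ?_⟩, fun a ε hε => ?_⟩
  · have hsep : TopologicalSpace.IsSeparable (R : Set Q) := by
      have h1 : TopologicalSpace.IsSeparable
          (⋃ m, ((S.E m).map (Θ m) : Set Q)) := .iUnion fun m => by
        have := S.finE m
        have : ProperSpace ((S.E m).map (Θ m)) := FiniteDimensional.proper ℂ _
        have : TopologicalSpace.SeparableSpace ((S.E m).map (Θ m) : Set Q) :=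
          inferInstanceAs (TopologicalSpace.SeparableSpace ((S.E m).map (Θ m)))
        exact TopologicalSpace.IsSeparable.of_subtype _
      refine h1.closure.mono fun a ha => Metric.mem_closure_iff.2 fun ε hε => ?_
      obtain ⟨N, hN⟩ := (hmemR a).1 ha (ε / 2) (half_pos hε)
      obtain ⟨x, hx, hxa⟩ := hN N le_rfl
      refine ⟨Θ N x, Set.mem_iUnion.2 ⟨N, Submodule.mem_map_of_mem hx⟩, ?_⟩
      rw [dist_comm, dist_eq_norm]
      linarith
    exact hsep.separableSpace
  · change ‖(Θ' m x : Q)‖ ≤ _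
    rw [hval m x hx]
    exact h.norm_le m x hx
  · change ‖(Θ' m x : Q) * (Θ' m y : Q) - (Θ' m z : Q)‖ ≤ _
    rw [hval m x hx, hval m y hy, hval m z hz]
    exact h.mul_sub_le m x hx y hy z hz
  · refine Subtype.ext ?_
    change (Θ' m (star x) : Q) = star (Θ' m x : Q)
    rw [hval m x hx, hval m _ (S.star_mem m x hx)]
    exact h.map_star m x hx
  · refine Subtype.ext ?_
    rw [hval m x hx, hval (m + 1) (S.θ m x) (S.Ψ_mem m _ (S.map_mem m x hx))]
    exact h.compat m x hx
  · rw [← matrixNorm_map_eq (i := NonUnitalStarSubalgebraClass.subtype R) Subtype.val_injective]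
    have h1 : (X.map (Θ' m)).map (NonUnitalStarSubalgebraClass.subtype R) = X.map (Θ m) := by
      ext a b
      exact hval m _ (hX a b)
    rw [h1]
    exact h.le_matrixNorm m n X hX c hc
  · obtain ⟨N, hN⟩ := (hmemR a).1 a.2 ε hε
    refine ⟨N, fun m hm => ?_⟩
    obtain ⟨x, hx, hxa⟩ := hN m hm
    refine ⟨x, hx, ?_⟩
    change ‖(Θ' m x : Q) - (a : Q)‖ ≤ ε
    rwa [hval m x hx]

end LiftingTower

end LimitAlgebra

/-! ### Local equivalence -/

section LocalEquivalence

open Filter Topology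

variable {A : Type u} {C : Type v} [NonUnitalCStarAlgebra A] [NonUnitalCStarAlgebra C]

lemma cbNorm_le {E : Submodule ℂ A} {F : Submodule ℂ C} (u : E →ₗ[ℂ] F) {c : ℝ} (hc : 0 ≤ c)
    (h : ∀ (n : ℕ) (X : Matrix (Fin n) (Fin n) E),
      matrixNorm n (X.map fun e => (u e : C)) ≤ c * matrixNorm n (X.map fun e => (e : A))) :
    cbNorm u ≤ ENNReal.ofReal c :=
  iSup_le fun n => iSup_le fun X => iSup_le fun hX =>
    ENNReal.ofReal_le_ofReal ((h n X).trans (mul_le_of_le_one_right hc hX))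

/-- Local embeddability in terms of maps that are almost completely isometric. -/
lemma locallyEmbeds_of_forall (h : ∀ ε : ℝ, 0 < ε → ∀ Z : Submodule ℂ A, FiniteDimensional ℂ Z →
    ∃ u : Z →ₗ[ℂ] C, ∀ (n : ℕ) (X : Matrix (Fin n) (Fin n) Z),
      matrixNorm n (X.map u) ≤ (1 + ε) * matrixNorm n (X.map fun z => (z : A)) ∧
      matrixNorm n (X.map fun z => (z : A)) ≤ (1 + ε) * matrixNorm n (X.map u)) :
    LocallyEmbeds A C := by
  intro ε hε Z hZ
  obtain ⟨ε', hε'0, hε'⟩ : ∃ ε' : ℝ, 0 < ε' ∧ (1 + ε') * (1 + ε') ≤ 1 + ε := by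
    refine ⟨min 1 (ε / 3), lt_min one_pos (by positivity), ?_⟩
    have h1 : min 1 (ε / 3) ≤ 1 := min_le_left _ _
    have h2 : min 1 (ε / 3) ≤ ε / 3 := min_le_right _ _
    have h3 : 0 < min 1 (ε / 3) := lt_min one_pos (by positivity)
    nlinarith
  obtain ⟨u, hu⟩ := h ε' hε'0 Z hZ
  have hinj : Function.Injective u := by
    rw [injective_iff_map_eq_zero]
    intro z hz
    have h1 := (hu 1 (Matrix.of fun _ _ => z)).2
    have h2 : (Matrix.of fun _ _ => z : Matrix (Fin 1) (Fin 1) Z).map u = 0 := by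
      ext a b
      simp [hz]
    rw [h2, matrixNorm_zero, mul_zero] at h1
    have h3 := (norm_entry_le_matrixNorm
      ((Matrix.of fun _ _ => z : Matrix (Fin 1) (Fin 1) Z).map fun z => (z : A)) 0 0).trans h1
    simpa using h3
  let e := LinearEquiv.ofInjective u hinj
  have he : ∀ z, (e z : C) = u z := fun z => rfl
  refine ⟨u.range, inferInstance, (iInf_le _ e).trans ?_⟩
  have h1 : cbNorm (e : Z →ₗ[ℂ] u.range) ≤ ENNReal.ofReal (1 + ε') :=
    cbNorm_le _ (by positivity) fun n X => (hu n X).1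
  have h2 : cbNorm (e.symm : u.range →ₗ[ℂ] Z) ≤ ENNReal.ofReal (1 + ε') := by
    refine cbNorm_le _ (by positivity) fun n X => ?_
    have h3 := (hu n (X.map e.symm)).2
    have h4 : (X.map e.symm).map u = X.map fun y => (y : C) := by
      ext a b
      simp only [Matrix.map_apply, ← he, LinearEquiv.apply_symm_apply]
    rw [h4] at h3
    exact h3
  refine (mul_le_mul' h1 h2).trans ?_
  rw [← ENNReal.ofReal_mul (by positivity)]
  exact ENNReal.ofReal_le_ofReal hε'

/-- A finite-dimensional space is approximated, uniformly on matrices, by spaces whose images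
under maps `f m` become dense. -/
lemma exists_approx_matrixNorm {Y : Type u} [NonUnitalCStarAlgebra Y] {E : ℕ → Submodule ℂ C}
    {f : ℕ → C →ₗ[ℂ] Y} (hf : ∀ a : Y, ∀ ε > 0, ∃ N, ∀ m ≥ N, ∃ x ∈ E m, ‖f m x - a‖ ≤ ε)
    (Z : Submodule ℂ Y) [FiniteDimensional ℂ Z] {ε : ℝ} (hε : 0 < ε) :
    ∃ N, ∀ m ≥ N, ∃ u : Z →ₗ[ℂ] C, (∀ z, u z ∈ E m) ∧
      ∀ (n : ℕ) (X : Matrix (Fin n) (Fin n) Z),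
        matrixNorm n (X.map (fun z => f m (u z)) - X.map fun z => (z : Y)) ≤
          ε * matrixNorm n (X.map fun z => (z : Y)) := by
  obtain ⟨K, hK, hpert⟩ := exists_matrixNorm_map_le.{u} Z
  let b := Module.finBasis ℂ Z
  let g : Fin (Module.finrank ℂ Z) → Z →L[ℂ] ℂ := fun j => (b.coord j).toContinuousLinearMap
  let L : ℝ := ∑ j, ‖g j‖
  have hL : 0 ≤ L := Finset.sum_nonneg fun j _ => norm_nonneg (g j)
  have hδ : 0 < ε / (K * (L + 1)) := by positivity
  choose N hN using fun j => hf (b j) _ hδ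
  refine ⟨Finset.univ.sup N, fun m hm => ?_⟩
  choose x hxE hx using fun j => hN j m ((Finset.le_sup (Finset.mem_univ j)).trans hm)
  let u : Z →ₗ[ℂ] C := b.constr ℂ x
  have hu : ∀ z, u z = ∑ j, g j z • x j := fun z => by
    simp [u, g, Module.Basis.constr_apply_fintype, Module.Basis.equivFun_apply]
  have hcoord : ∀ z : Z, (z : Y) = ∑ j, g j z • (b j : Y) := fun z => by
    have h := congrArg Z.subtype (b.sum_repr z)
    rw [map_sum] at h
    exact h.symm
  refine ⟨u, fun z => ?_, fun n X => ?_⟩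
  · rw [hu]
    exact Submodule.sum_mem _ fun j _ => Submodule.smul_mem _ _ (hxE j)
  · let w : Z →ₗ[ℂ] Y := f m ∘ₗ u - Z.subtype
    have hw : ∀ z, ‖w z‖ ≤ (L * (ε / (K * (L + 1)))) * ‖z‖ := fun z => by
      have h1 : w z = ∑ j, g j z • (f m (x j) - b j) := by
        simp only [w, LinearMap.sub_apply, LinearMap.comp_apply, Submodule.subtype_apply, hu,
          map_sum, map_smul, smul_sub, Finset.sum_sub_distrib]
        rw [← hcoord z]
      rw [h1, Finset.sum_mul, Finset.sum_mul]
      refine (norm_sum_le _ _).trans (Finset.sum_le_sum fun j _ => ?_)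
      rw [norm_smul]
      calc ‖g j z‖ * ‖f m (x j) - b j‖ ≤ (‖g j‖ * ‖z‖) * (ε / (K * (L + 1))) := by
            gcongr
            · exact (g j).le_opNorm z
            · exact hx j
        _ = _ := by ring
    have h2 := hpert w _ hw n X
    have h3 : X.map w = X.map (fun z => f m (u z)) - X.map fun z => (z : Y) := by
      ext a b
      rfl
    rw [h3] at h2
    refine h2.trans ?_
    gcongr
    · exact matrixNorm_nonneg _
    · rw [show K * (L * (ε / (K * (L + 1)))) = ε * (L / (L + 1)) by field_simp]
      exact mul_le_of_le_one_right hε.le ((div_le_one (by positivity)).2 (by linarith))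

end LocalEquivalence

section LocallyEquivalent

variable {A C : Type u} [NonUnitalCStarAlgebra A] [NonUnitalCStarAlgebra C]

/-- Algebras with a common asymptotically dense system of finite-dimensional operator spaces are
locally equivalent. -/
lemma locallyEquivalent_of_dense {E : ℕ → Submodule ℂ C} {Θ : ℕ → C →ₗ[ℂ] A}
    (hΘ : ∀ ε : ℝ, 0 < ε → ∃ N, ∀ m ≥ N, ∀ (n : ℕ) (X : Matrix (Fin n) (Fin n) C),
      (∀ a b, X a b ∈ E m) → matrixNorm n (X.map (Θ m)) ≤ (1 + ε) * matrixNorm n X ∧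
        matrixNorm n X ≤ (1 + ε) * matrixNorm n (X.map (Θ m)))
    (hA : ∀ a : A, ∀ ε > 0, ∃ N, ∀ m ≥ N, ∃ x ∈ E m, ‖Θ m x - a‖ ≤ ε)
    (hC : ∀ c : C, ∀ ε > 0, ∃ N, ∀ m ≥ N, ∃ x ∈ E m, ‖x - c‖ ≤ ε) :
    LocallyEquivalent A C := by
  have hsmall : ∀ ε : ℝ, 0 < ε → ∃ δ : ℝ, 0 < δ ∧ δ ≤ 1 / 2 ∧ (1 + δ) * (1 + δ) ≤ 1 + ε ∧
      1 + δ ≤ (1 + ε) * (1 - δ) := by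
    intro ε hε
    have h1 : min (1 / 2) (ε / (3 + ε)) ≤ 1 / 2 := min_le_left _ _
    have h2 : min (1 / 2) (ε / (3 + ε)) ≤ ε / (3 + ε) := min_le_right _ _
    have h3 : 0 < min (1 / 2) (ε / (3 + ε)) := lt_min (by norm_num) (by positivity)
    rw [le_div_iff₀ (by positivity)] at h2
    refine ⟨_, h3, h1, ?_, ?_⟩
    · nlinarith
    · nlinarith
  constructor
  · refine locallyEmbeds_of_forall fun ε hε Z hZ => ?_
    obtain ⟨δ, hδ0, hδ2, hδ1, hδε⟩ := hsmall ε hε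
    obtain ⟨N, hN⟩ := exists_approx_matrixNorm hA Z hδ0
    obtain ⟨N', hN'⟩ := hΘ δ hδ0
    obtain ⟨u, huE, hu⟩ := hN (max N N') (le_max_left _ _)
    refine ⟨u, fun n X => ?_⟩
    obtain ⟨h1, h2⟩ := hN' (max N N') (le_max_right _ _) n (X.map u) fun a b => huE _
    have h3 := hu n X
    have h4 : (X.map u).map (Θ (max N N')) = X.map fun z => Θ (max N N') (u z) := rfl
    rw [h4] at h1 h2
    have h5 := matrixNorm_le_add_sub (X.map fun z => Θ (max N N') (u z)) (X.map fun z => (z : A))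
    have h6 := matrixNorm_le_add_sub (X.map fun z => (z : A)) (X.map fun z => Θ (max N N') (u z))
    rw [← neg_sub, matrixNorm_neg] at h6
    have h7 := matrixNorm_nonneg (X.map fun z => (z : A))
    have h8 := matrixNorm_nonneg (X.map u)
    constructor <;> nlinarith
  · refine locallyEmbeds_of_forall fun ε hε Z hZ => ?_
    obtain ⟨δ, hδ0, hδ2, hδ1, hδε⟩ := hsmall ε hε
    obtain ⟨N, hN⟩ := exists_approx_matrixNorm (f := fun _ => LinearMap.id) hC Z hδ0
    obtain ⟨N', hN'⟩ := hΘ δ hδ0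
    obtain ⟨u, huE, hu⟩ := hN (max N N') (le_max_left _ _)
    refine ⟨Θ (max N N') ∘ₗ u, fun n X => ?_⟩
    obtain ⟨h1, h2⟩ := hN' (max N N') (le_max_right _ _) n (X.map u) fun a b => huE _
    have h3 := hu n X
    have h4 : (X.map u).map (Θ (max N N')) = X.map (Θ (max N N') ∘ₗ u) := rfl
    have h4' : (X.map fun z => (LinearMap.id : C →ₗ[ℂ] C) (u z)) = X.map u := rfl
    rw [h4] at h1 h2
    rw [h4'] at h3
    have h5 := matrixNorm_le_add_sub (X.map u) (X.map fun z => (z : C))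
    have h6 := matrixNorm_le_add_sub (X.map fun z => (z : C)) (X.map u)
    rw [← neg_sub, matrixNorm_neg] at h6
    have h7 := matrixNorm_nonneg (X.map fun z => (z : C))
    have h8 := matrixNorm_nonneg (X.map u)
    have h9 := matrixNorm_nonneg (X.map (Θ (max N N') ∘ₗ u))
    constructor <;> nlinarith

end LocallyEquivalent

/-! ### Nuclearity of the limit algebra and the conclusion -/

section Nuclearity

open Filter Topology

variable {A : Type u} {C : Type v} {D : Type w} [NonUnitalCStarAlgebra A]
  [NonUnitalCStarAlgebra C] [NonUnitalCStarAlgebra D]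

/-- Tensors in `A ⊗ D` are approximated by tensors with entries in `Θ m (E m)` and in a dense
sequence of `D`, with control of the size of the entries. -/
lemma exists_approx_tensor {E : ℕ → Submodule ℂ C} {Θ : ℕ → C →ₗ[ℂ] A}
    (hlow : ∃ N, ∀ m ≥ N, ∀ x ∈ E m, ‖x‖ ≤ 2 * ‖Θ m x‖)
    (hA : ∀ a : A, ∀ ε > 0, ∃ N, ∀ m ≥ N, ∃ x ∈ E m, ‖Θ m x - a‖ ≤ ε)
    {d : ℕ → D} (hd : DenseRange d) (t : A ⊗[ℂ] D) :
    ∃ K : ℝ, ∀ ε : ℝ, 0 < ε → ∃ N, ∀ m ≥ N, ∃ x : ℕ → C, (∀ j, x j ∈ E m) ∧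
      ∑ j ∈ Finset.range m, ‖x j‖ ≤ K ∧
      maxSeminorm A D (t - ∑ j ∈ Finset.range m, Θ m (x j) ⊗ₜ[ℂ] d j) ≤ ε := by
  induction t using TensorProduct.induction_on with
  | zero => exact ⟨0, fun ε hε => ⟨0, fun m _ => ⟨0, fun j => Submodule.zero_mem _, by simp,
      by simpa using hε.le⟩⟩⟩
  | add s t hs ht =>
    obtain ⟨K, hK⟩ := hs
    obtain ⟨K', hK'⟩ := ht
    refine ⟨K + K', fun ε hε => ?_⟩
    obtain ⟨N, hN⟩ := hK (ε / 2) (half_pos hε)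
    obtain ⟨N', hN'⟩ := hK' (ε / 2) (half_pos hε)
    refine ⟨max N N', fun m hm => ?_⟩
    obtain ⟨x, hxE, hx, hxs⟩ := hN m (le_of_max_le_left hm)
    obtain ⟨y, hyE, hy, hyt⟩ := hN' m (le_of_max_le_right hm)
    refine ⟨x + y, fun j => Submodule.add_mem _ (hxE j) (hyE j), ?_, ?_⟩
    · refine (Finset.sum_le_sum fun j _ => norm_add_le (x j) (y j)).trans ?_
      rw [Finset.sum_add_distrib]
      exact add_le_add hx hy
    · simp only [Pi.add_apply, map_add, TensorProduct.add_tmul, Finset.sum_add_distrib,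
        add_sub_add_comm]
      exact (map_add_le_add _ _ _).trans (by linarith)
  | tmul a b =>
    obtain ⟨N₀, hN₀⟩ := hlow
    refine ⟨2 * (‖a‖ + 1), fun ε hε => ?_⟩
    obtain ⟨δ, hδ0, hδ1, hδ⟩ : ∃ δ : ℝ, 0 < δ ∧ δ ≤ 1 ∧ δ * (‖b‖ + ‖a‖ + 1) ≤ ε := by
      refine ⟨min 1 (ε / (‖b‖ + ‖a‖ + 1)), lt_min one_pos (by positivity), min_le_left _ _, ?_⟩
      rw [← le_div_iff₀ (by positivity)]
      exact min_le_right _ _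
    obtain ⟨j₀, hj₀⟩ := hd.exists_dist_lt b hδ0
    obtain ⟨N, hN⟩ := hA a δ hδ0
    refine ⟨max (max N N₀) (j₀ + 1), fun m hm => ?_⟩
    obtain ⟨x, hxE, hx⟩ := hN m (le_of_max_le_left (le_of_max_le_left hm))
    have hjm : j₀ ∈ Finset.range m := Finset.mem_range.2 (le_of_max_le_right hm)
    have hna : ‖Θ m x‖ ≤ ‖a‖ + 1 := by
      have := norm_le_norm_add_norm_sub' (Θ m x) a
      linarith
    refine ⟨Pi.single j₀ x, fun j => ?_, ?_, ?_⟩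
    · rcases eq_or_ne j j₀ with rfl | hj
      · simpa using hxE
      · simp [hj]
    · rw [Finset.sum_eq_single_of_mem j₀ hjm fun j _ hj => by simp [hj], Pi.single_eq_same]
      exact (hN₀ m (le_of_max_le_right (le_of_max_le_left hm)) x hxE).trans (by gcongr)
    · rw [Finset.sum_eq_single_of_mem j₀ hjm fun j _ hj => by simp [hj], Pi.single_eq_same]
      have h1 : a ⊗ₜ[ℂ] b - Θ m x ⊗ₜ[ℂ] d j₀ =
          (a - Θ m x) ⊗ₜ[ℂ] b + Θ m x ⊗ₜ[ℂ] (b - d j₀) := by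
        rw [TensorProduct.sub_tmul, TensorProduct.tmul_sub]
        abel
      rw [h1]
      refine (map_add_le_add _ _ _).trans
        ((add_le_add (maxSeminorm_tmul_le _ _) (maxSeminorm_tmul_le _ _)).trans ?_)
      rw [norm_sub_rev] at hx
      rw [dist_eq_norm] at hj₀
      have h2 : ‖a - Θ m x‖ * ‖b‖ ≤ δ * ‖b‖ := by gcongr
      have h3 : ‖Θ m x‖ * ‖b - d j₀‖ ≤ (‖a‖ + 1) * δ := by gcongr
      linarith

/-- If the maximal norm of tensors over `Θ m (E m)` is controlled by the minimal norm over `E m`,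
then the limit is nuclear relative to `D`. -/
lemma isNuclearPair_of_approx {E : ℕ → Submodule ℂ C} {Θ : ℕ → C →ₗ[ℂ] A}
    (hΘ : ∀ ε : ℝ, 0 < ε → ∃ N, ∀ m ≥ N, ∀ (n : ℕ) (X : Matrix (Fin n) (Fin n) C),
      (∀ a b, X a b ∈ E m) → matrixNorm n X ≤ (1 + ε) * matrixNorm n (X.map (Θ m)))
    (hA : ∀ a : A, ∀ ε > 0, ∃ N, ∀ m ≥ N, ∃ x ∈ E m, ‖Θ m x - a‖ ≤ ε)
    {d : ℕ → D} (hd : DenseRange d)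
    (hmax : ∀ ε : ℝ, 0 < ε → ∃ N, ∀ m ≥ N, ∀ x : ℕ → C, (∀ j, x j ∈ E m) →
      maxSeminorm A D (∑ j ∈ Finset.range m, Θ m (x j) ⊗ₜ[ℂ] d j) ≤
        minSeminorm C D (∑ j ∈ Finset.range m, x j ⊗ₜ[ℂ] d j) +
          ε * ∑ j ∈ Finset.range m, ‖x j‖) :
    IsNuclearPair A D := by
  have hlow : ∃ N, ∀ m ≥ N, ∀ x ∈ E m, ‖x‖ ≤ 2 * ‖Θ m x‖ := by
    obtain ⟨N, hN⟩ := hΘ 1 one_pos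
    refine ⟨N, fun m hm x hx => ?_⟩
    have h1 := hN m hm 1 (Matrix.of fun _ _ => x) fun _ _ => hx
    have h2 : (Matrix.of fun _ _ => x : Matrix (Fin 1) (Fin 1) C).map (Θ m) =
        Matrix.of fun _ _ => Θ m x := rfl
    rw [h2, matrixNorm_one, matrixNorm_one] at h1
    linarith
  intro t
  refine le_antisymm (minNorm_le_maxNorm t) ?_
  rw [← ofReal_maxSeminorm, ← ofReal_minSeminorm]
  refine ENNReal.ofReal_le_ofReal ?_
  obtain ⟨K, hK⟩ := exists_approx_tensor hlow hA hd t
  have key : ∀ ε : ℝ, 0 < ε →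
      maxSeminorm A D t ≤ (1 + ε) * (minSeminorm A D t + ε) + ε * K + ε := by
    intro ε hε
    obtain ⟨N₁, h₁⟩ := hK ε hε
    obtain ⟨N₂, h₂⟩ := hΘ ε hε
    obtain ⟨N₃, h₃⟩ := hmax ε hε
    let m := max N₁ (max N₂ N₃)
    obtain ⟨x, hxE, hxK, hx⟩ := h₁ m (le_max_left _ _)
    have e1 := h₃ m ((le_max_right _ _).trans (le_max_right _ _)) x hxE
    have e2 := minSeminorm_sum_le_of_matrixNorm_le (D := D) (Θ m) (by linarith : 0 ≤ 1 + ε)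
      (h₂ m ((le_max_left _ _).trans (le_max_right _ _))) (Finset.range m) x
      (fun j _ => hxE j) d
    set s := ∑ j ∈ Finset.range m, Θ m (x j) ⊗ₜ[ℂ] d j with hs
    have e3 : maxSeminorm A D t ≤ maxSeminorm A D s + ε := by
      have := map_add_le_add (maxSeminorm A D) s (t - s)
      rw [add_sub_cancel] at this
      linarith
    have e4 : minSeminorm A D s ≤ minSeminorm A D t + ε := by
      have h5 := map_add_le_add (minSeminorm A D) t (s - t)
      rw [add_sub_cancel, map_sub_rev (minSeminorm A D)] at h5
      have h6 := minSeminorm_le_maxSeminorm (t - s)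
      linarith
    have e5 : (1 + ε) * minSeminorm A D s ≤ (1 + ε) * (minSeminorm A D t + ε) := by gcongr
    have e6 : ε * ∑ j ∈ Finset.range m, ‖x j‖ ≤ ε * K := by gcongr
    linarith
  have hlim : Tendsto (fun ε : ℝ => (1 + ε) * (minSeminorm A D t + ε) + ε * K + ε) (𝓝[>] 0)
      (𝓝 ((1 + 0) * (minSeminorm A D t + 0) + 0 * K + 0)) := by
    refine Tendsto.mono_left ?_ nhdsWithin_le_nhds
    have : Continuous fun ε : ℝ => (1 + ε) * (minSeminorm A D t + ε) + ε * K + ε := by fun_prop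
    exact this.tendsto 0
  have h := ge_of_tendsto hlim (eventually_nhdsWithin_of_forall fun ε hε => key ε hε)
  simpa using h

end Nuclearity

section Conclusion

open Filter Topology

lemma AlmostMorphismOn.comp_starHom {C B A : Type*} [NonUnitalCStarAlgebra C]
    [NonUnitalCStarAlgebra B] [NonUnitalCStarAlgebra A] {δ : ℝ} (hδ : 0 ≤ δ) {E : Submodule ℂ C}
    {F : Submodule ℂ B} {ψ : B →ₗ[ℂ] A} (h : AlmostMorphismOn δ F ψ) (i : C →⋆ₙₐ[ℂ] B)
    (hEF : ∀ x ∈ E, i x ∈ F) : AlmostMorphismOn δ E (ψ ∘ₗ (i : C →ₗ[ℂ] B)) where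
  norm_le x hx := (h.norm_le _ (hEF x hx)).trans
    (by gcongr; exact NonUnitalStarAlgHom.norm_apply_le i x)
  mul_approx x hx y hy hxy := by
    have h1 := h.mul_approx _ (hEF x hx) _ (hEF y hy) (by rw [← map_mul]; exact hEF _ hxy)
    rw [← map_mul] at h1
    refine h1.trans ?_
    gcongr
    · exact NonUnitalStarAlgHom.norm_apply_le i x
    · exact NonUnitalStarAlgHom.norm_apply_le i y
  map_star x hx hx' := by
    have h1 := h.map_star _ (hEF x hx) (by rw [← StarHomClass.map_star i]; exact hEF _ hx')
    rw [← StarHomClass.map_star i] at h1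
    exact h1

variable {C : Type u} {B : Type v} {D : Type w} [NonUnitalCStarAlgebra C]
  [NonUnitalCStarAlgebra B] [NonUnitalCStarAlgebra D]

/-- What the next lifting in a tower is required to achieve: small perturbations of `i` are small
on matrices over `E`, and almost morphisms of `B` control maximal norms of tensors over `i E` and
norms of matrices over `i E`. -/
structure IsGoodStage (i : C →⋆ₙₐ[ℂ] B) (d : ℕ → D) (ε : ℝ) (m : ℕ) (E : Submodule ℂ C)
    (F : Submodule ℂ B) (η : ℝ) : Prop where
  η_le : η ≤ ε
  perturb : ∀ w : E →ₗ[ℂ] B, (∀ z, ‖w z‖ ≤ η * ‖z‖) → ∀ (n : ℕ) (X : Matrix (Fin n) (Fin n) E),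
    matrixNorm n (X.map w) ≤ ε * matrixNorm n (X.map fun z => (z : C))
  matrix_le : ∀ (A : Type u) [NonUnitalCStarAlgebra A] (ψ : B →ₗ[ℂ] A),
    AlmostMorphismOn (40 * η) F ψ → ∀ (n : ℕ) (X : Matrix (Fin n) (Fin n) C),
    (∀ a b, X a b ∈ E) →
    matrixNorm n (X.map (ψ ∘ₗ (i : C →ₗ[ℂ] B))) ≤ (1 + ε) * matrixNorm n X
  max_le : ∀ (A : Type u) [NonUnitalCStarAlgebra A] (ψ : B →ₗ[ℂ] A),
    AlmostMorphismOn (40 * η) F ψ → ∀ x : ℕ → C, (∀ j, x j ∈ E) →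
    maxSeminorm A D (∑ j ∈ Finset.range m, ψ (i (x j)) ⊗ₜ[ℂ] d j) ≤
      maxSeminorm B D (∑ j ∈ Finset.range m, i (x j) ⊗ₜ[ℂ] d j) +
        ε * ∑ j ∈ Finset.range m, ‖x j‖

lemma exists_isGoodStage (hC : HasLLP C) (i : C →⋆ₙₐ[ℂ] B) (d : ℕ → D) {ε : ℝ} (hε : 0 < ε)
    (m : ℕ) (E : Submodule ℂ C) (hE : FiniteDimensional ℂ E) :
    ∃ (F₀ : Submodule ℂ B) (δ : ℝ), FiniteDimensional ℂ F₀ ∧ 0 < δ ∧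
      ∀ F η, F₀ ≤ F → η ≤ δ → 0 < η → IsGoodStage i d ε m E F η := by
  obtain ⟨K, hK, hpert⟩ := exists_matrixNorm_map_le.{v} E
  obtain ⟨E₁, δ₁, hE₁, hδ₁, h₁⟩ := hC.exists_matrixNorm_map_le.{u, u} E hε
  have hiE : FiniteDimensional ℂ (E.map (i : C →ₗ[ℂ] B)) := inferInstance
  obtain ⟨F₂, δ₂, hF₂, hδ₂, h₂⟩ := exists_almostMorphism_maxSeminorm_sum_le.{v, u, w}
    (E.map (i : C →ₗ[ℂ] B)) d m hε
  refine ⟨E₁.map (i : C →ₗ[ℂ] B) ⊔ F₂, min (min ε (ε / K)) (min (δ₁ / 40) (δ₂ / 40)),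
    inferInstance, by positivity, fun F η hF hη hη0 => ?_⟩
  have e1 : η ≤ ε := hη.trans ((min_le_left _ _).trans (min_le_left _ _))
  have e2 : η ≤ ε / K := hη.trans ((min_le_left _ _).trans (min_le_right _ _))
  have e3 : η ≤ δ₁ / 40 := hη.trans ((min_le_right _ _).trans (min_le_left _ _))
  have e4 : η ≤ δ₂ / 40 := hη.trans ((min_le_right _ _).trans (min_le_right _ _))
  refine ⟨e1, fun w hw n X => ?_, fun A _ ψ hψ n X hX => ?_, fun A _ ψ hψ x hx => ?_⟩
  · refine (hpert w η hw n X).trans ?_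
    rw [le_div_iff₀ hK] at e2
    gcongr
    · exact matrixNorm_nonneg _
    · linarith
  · refine h₁ A _ ((hψ.mono (δ' := δ₁) (by linarith) le_rfl).comp_starHom hδ₁.le i
      fun x hx => hF ?_) n X hX
    exact Submodule.mem_sup_left (Submodule.mem_map_of_mem hx)
  · refine (h₂ A ψ (hψ.mono (by linarith) (le_sup_right.trans hF)) (fun j => i (x j))
      fun j => Submodule.mem_map_of_mem (hx j)).trans ?_
    gcongr with j _
    exact NonUnitalStarAlgHom.norm_apply_le i (x j)

/-- The algebra `A` of the theorem, as the limit of a tower all of whose stages are good. -/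
lemma exists_nuclear_locallyEquivalent [TopologicalSpace.SeparableSpace C]
    [TopologicalSpace.SeparableSpace D] (hC : HasLLP C) (i : C →⋆ₙₐ[ℂ] B)
    (hi : Function.Injective i) (q : C →⋆ₙₐ[ℂ] B) (hlift : AlmostAllowsLiftings q)
    (hcont : IsMinMaxContinuous i D) :
    ∃ (A : Type u) (_ : NonUnitalCStarAlgebra A),
      TopologicalSpace.SeparableSpace A ∧ IsNuclearPair A D ∧ LocallyEquivalent A C := by
  have hne : Nonempty D := ⟨0⟩
  let d := TopologicalSpace.denseSeq D
  have hd : DenseRange d := TopologicalSpace.denseRange_denseSeq D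
  let ε : ℕ → ℝ := fun m => (1 / 4) * (1 / 2) ^ m
  have hε0 : ∀ m, 0 < ε m := fun m => by positivity
  have hεs : ∀ m, ε (m + 1) = ε m / 2 := fun m => by simp only [ε, pow_succ]; ring
  have hεanti : Antitone ε := antitone_nat_of_succ_le fun m => by linarith [hεs m, hε0 m]
  have hε4 : ∀ m, ε m ≤ 1 / 4 := fun m => (hεanti (Nat.zero_le m)).trans (by simp [ε])
  have hεlim : Tendsto ε atTop (𝓝 0) := by
    have := (tendsto_pow_atTop_nhds_zero_of_lt_one (r := (1 / 2 : ℝ)) (by norm_num)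
      (by norm_num)).const_mul (1 / 4)
    simpa only [mul_zero] using this
  obtain ⟨S, hS⟩ := exists_liftingTower i q hlift (fun m E F η => IsGoodStage i d (ε m) m E F η)
    fun m E hE => exists_isGoodStage hC i d (hε0 m) m E hE
  have hη : Tendsto S.η atTop (𝓝 0) :=
    squeeze_zero (fun m => (S.η_pos m).le) (fun m => (hS m).η_le) hεlim
  -- all maps of the system are almost completely isometric from below
  have hiter : ∀ m n (X : Matrix (Fin n) (Fin n) C), (∀ a b, X a b ∈ S.E m) → ∀ k ≥ m,
      (1 - 2 * ε m) * matrixNorm n X ≤ matrixNorm n (X.map (S.iter m k)) := by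
    intro m n X hX k hk
    refine le_trans ?_ (S.matrixNorm_le_iter hi (fun m => (hε0 m).le)
      (fun m => (hε4 m).trans (by norm_num)) (fun m => (hεs m).le) (fun m => (hS m).perturb) hk X
      hX)
    gcongr
    · exact matrixNorm_nonneg X
    · linarith [hε0 k]
  have hlower : ∀ {A : Type u} [NonUnitalCStarAlgebra A] {Θ : ℕ → C →ₗ[ℂ] A}, S.IsLimit Θ →
      ∀ m n (X : Matrix (Fin n) (Fin n) C), (∀ a b, X a b ∈ S.E m) →
      (1 - 2 * ε m) * matrixNorm n X ≤ matrixNorm n (X.map (Θ m)) := fun hΘ m n X hX =>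
    hΘ.le_matrixNorm m n X hX _ (hiter m n X hX)
  obtain ⟨Q, _, Θ₀, hΘ₀⟩ := S.exists_isLimit
  obtain ⟨A, _, Θ, hsep, hΘ, hdense⟩ := hΘ₀.exists_separable hη fun m x hx => by
    have h1 := hlower hΘ₀ m 1 (Matrix.of fun _ _ => x) fun _ _ => hx
    have h2 : (Matrix.of fun _ _ => x : Matrix (Fin 1) (Fin 1) C).map (Θ₀ m) =
        Matrix.of fun _ _ => Θ₀ m x := rfl
    rw [h2, matrixNorm_one, matrixNorm_one] at h1
    nlinarith [norm_nonneg x, hε4 m]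
  have hcomp : ∀ m, ∀ x ∈ S.E m, Θ (m + 1) (S.Ψ m (i x)) = Θ m x := fun m x hx =>
    (hΘ.compat m x hx).symm
  have hupper : ∀ m n (X : Matrix (Fin n) (Fin n) C), (∀ a b, X a b ∈ S.E m) →
      matrixNorm n (X.map (Θ m)) ≤ (1 + ε m) * matrixNorm n X := by
    intro m n X hX
    have h1 := (hS m).matrix_le A _ (hΘ.almostMorphismOn m) n X hX
    have h2 : X.map ((Θ (m + 1) ∘ₗ S.Ψ m) ∘ₗ (i : C →ₗ[ℂ] B)) = X.map (Θ m) := by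
      ext a b
      exact hcomp m _ (hX a b)
    rwa [h2] at h1
  have hboth : ∀ δ : ℝ, 0 < δ → ∃ N, ∀ m ≥ N, ∀ (n : ℕ) (X : Matrix (Fin n) (Fin n) C),
      (∀ a b, X a b ∈ S.E m) → matrixNorm n (X.map (Θ m)) ≤ (1 + δ) * matrixNorm n X ∧
        matrixNorm n X ≤ (1 + δ) * matrixNorm n (X.map (Θ m)) := by
    intro δ hδ
    obtain ⟨N, hN⟩ := eventually_atTop.1 (hεlim.eventually_le_const
      (show 0 < δ / (4 * (1 + δ)) by positivity))
    refine ⟨N, fun m hm n X hX => ?_⟩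
    have h1 := hN m hm
    rw [le_div_iff₀ (by positivity)] at h1
    have h2 := hupper m n X hX
    have h3 := hlower hΘ m n X hX
    have h4 := matrixNorm_nonneg X
    have h5 := hε0 m
    constructor
    · refine h2.trans ?_
      gcongr
      nlinarith
    · have h6 : (1 + δ) * ((1 - 2 * ε m) * matrixNorm n X) ≤
          (1 + δ) * matrixNorm n (X.map (Θ m)) := by gcongr
      refine le_trans ?_ h6
      rw [← mul_assoc]
      refine le_mul_of_one_le_left h4 ?_
      linarith
  have hCdense : ∀ c : C, ∀ δ > 0, ∃ N, ∀ m ≥ N, ∃ x ∈ S.E m, ‖x - c‖ ≤ δ := fun c δ hδ => by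
    obtain ⟨N, x, hx, hxc⟩ := S.dense c δ hδ
    exact ⟨N, fun m hm => ⟨x, S.E_mono hm hx, hxc⟩⟩
  refine ⟨A, inferInstance, hsep, ?_, locallyEquivalent_of_dense hboth hdense hCdense⟩
  refine isNuclearPair_of_approx (fun δ hδ => ?_) hdense hd fun δ hδ => ?_
  · obtain ⟨N, hN⟩ := hboth δ hδ
    exact ⟨N, fun m hm n X hX => (hN m hm n X hX).2⟩
  · obtain ⟨N, hN⟩ := eventually_atTop.1 (hεlim.eventually_le_const hδ)
    refine ⟨N, fun m hm x hx => ?_⟩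
    have h1 := (hS m).max_le A _ (hΘ.almostMorphismOn m) x hx
    have h2 : ∑ j ∈ Finset.range m, (Θ (m + 1) ∘ₗ S.Ψ m) (i (x j)) ⊗ₜ[ℂ] d j =
        ∑ j ∈ Finset.range m, Θ m (x j) ⊗ₜ[ℂ] d j :=
      Finset.sum_congr rfl fun j _ => congrArg (· ⊗ₜ[ℂ] d j) (hcomp m _ (hx j))
    rw [h2] at h1
    have h3 := hcont.maxNorm_le (∑ j ∈ Finset.range m, x j ⊗ₜ[ℂ] d j)
    rw [← ofReal_maxSeminorm, ← ofReal_minSeminorm,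
      ENNReal.ofReal_le_ofReal_iff (apply_nonneg _ _)] at h3
    have h4 : tensorId i D (∑ j ∈ Finset.range m, x j ⊗ₜ[ℂ] d j) =
        ∑ j ∈ Finset.range m, i (x j) ⊗ₜ[ℂ] d j := by
      simp only [map_sum, tensorId_tmul]
    rw [h4] at h3
    have h5 : ε m * ∑ j ∈ Finset.range m, ‖x j‖ ≤ δ * ∑ j ∈ Finset.range m, ‖x j‖ := by
      gcongr
      exact hN m hm
    linarith

end Conclusion

theorem corollary9p5 {C : Type u} {B : Type v} {D : Type w}
    [NonUnitalCStarAlgebra C] [TopologicalSpace.SeparableSpace C]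
    [NonUnitalCStarAlgebra B]
    [NonUnitalCStarAlgebra D] [TopologicalSpace.SeparableSpace D]
    (hC : HasLLP C)
    (i : C →⋆ₙₐ[ℂ] B) (hi : Function.Injective i)
    (q : C →⋆ₙₐ[ℂ] B) (hq : Function.Surjective q) (hlift : AlmostAllowsLiftings q)
    (hcont : IsMinMaxContinuous i D) :
    (∀ t : C ⊗[ℂ] D, maxNorm (tensorId i D t) = minNorm t) ∧
    ∃ (A : Type u) (_ : NonUnitalCStarAlgebra A),
      TopologicalSpace.SeparableSpace A ∧ IsNuclearPair A D ∧ LocallyEquivalent A C := by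
  refine ⟨fun t => le_antisymm (hcont.maxNorm_le t) ?_,
    exists_nuclear_locallyEquivalent hC i hi q hlift hcont⟩
  refine le_trans ?_ (minNorm_le_maxNorm _)
  rw [← ofReal_minSeminorm, ← ofReal_minSeminorm]
  exact ENNReal.ofReal_le_ofReal (minSeminorm_le_tensorId hi t)
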